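/- Setting. Let $d\in\{2,3\}$ and let $\Omega\subset\mathbb R^d$ be a bounded polygonal/polyhedral domain (without slits: $\Omega=\operatorname{int}\overline\Omega$) with boundary $\Gamma$, let $T>0$, let $\rho,\chi,s,\alpha,\beta,\omega>0$ be constants, and let $\mathcal C,\mathcal D$ be symmetric positive definite linear maps on the space $\mathbb S=\mathbb R^{d\times d}_{\rm sym}$ of symmetric matrices such that $\mathcal D-\mathcal C$ is positive definite. Put $\mathcal A=\mathcal C^{-1}$, $\mathcal G=(\mathcal D-\mathcal C)^{-1}$, $\varepsilon(u)=\frac12(\nabla u+\nabla u^{T})$, $(\cdot,\cdot)_\Omega$ for the $L^2(\Omega)$ inner product, and $$((u,p),(v,q))_{\mathcal H_1}=(\rho u,v)_\Omega+(\chi p,q)_\Omega,\qquad ((\sigma_E,\sigma_V,\psi),(\tau_E,\tau_V,\varphi))_{\mathcal H_2}=(\mathcal A\sigma_E,\tau_E)_\Omega+(\omega\mathcal G\sigma_V,\omega\tau_V)_\Omega+(s\psi,\varphi)_\Omega$$ on $\mathcal H_1=[L^2(\Omega,\mathbb R^d)]^2$ and $\mathcal H_2=[L^2(\Omega,\mathbb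 S)]^2\times L^2(\Omega)$. Let $\mathcal X_1=H^1_0(\Omega,\mathbb R^d)\times H(\mathrm{div},\Omega)$ and let $\mathcal X_2$ be the space of all $(\tau_E,\tau_V,\varphi)\in[L^2(\Omega,\mathbb S)]^2\times H^1_0(\Omega)$ with $\tau_E+\omega\tau_V-\alpha\varphi I_d\in H(\mathbf{div},\Omega,\mathbb S)$, with the graph norms of $(u,p)\mapsto(\varepsilon(u),\operatorname{div}p+\alpha\operatorname{div}u)$ and $(\tau_E,\tau_V,\varphi)\mapsto(\mathbf{div}(\tau_E+\omega\tau_V-\alpha\varphi I_d),\nabla\varphi)$. Let $(u,p)\in C^1([0,T];\mathcal H_1)\cap C^0([0,T];\mathcal X_1)$ and $(\sigma_E,\sigma_V,\psi)\in C^1([0,T];\mathcal H_2)\cap C^0([0,T];\mathcal X_2)$ be a solution of $$\rho\dot u-\mathbf{div}(\sigma_E+\omega\sigma_V-\alpha\psi I_d)=F,\quad \dot\sigma_E=\mathcal C\varepsilon(u),\quad \omega\dot\sigma_V+\sigma_V=(\mathcal D-\mathcal C)\varepsilon(u),\quad \chi\dot p+\beta p+\nabla\psi=0,\quad s\dot\psi+\operatorname{div}p+\alpha\operatorname{div}u=g$$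 in $L^2(\Omega)$ for all $t\in[0,T]$. Discretization. Let $\mathcal T_h$ be a mesh of $\overline\Omega$, possibly with hanging nodes, consisting of triangles and/or convex quadrilaterals ($d=2$) or of tetrahedra and/or parallelepipeds ($d=3$). Let $\mathcal F_h$ be the set of its interior faces (the intersections $F=K\cap K'$ of two distinct elements that have positive $(d-1)$-dimensional measure) and boundary faces (the faces of elements, as far as they lie on $\partial\Omega$ with positive measure), let $\mathcal F(K)$ be the set of faces contained in the element $K$, let $n$ be the outward unit normal of each element, $h_F$ the diameter of $F$, $(\cdot,\cdot)_{\mathcal T_h}=\sum_K(\cdot,\cdot)_K$ and $\langle\cdot,\cdot\rangle_{\partial\mathcal T_h}=\sum_K\sum_{F\in\mathcal F(K)}\int_F$. Let $\mathcal P_m(D)$ be the polynomials on $D$ of degree at most $m$ if $D$ is a simplex, and of degree at most $m$ in each variable otherwise (with respect to any affine coordinates fixed on $D$, in which $D$, if it is a face, lies in a coordinate hyperplane). For $k\ge0$ let $\mathcal U_h$ be the space of pairs $\vec v_h=(v_h,\hat v_h)$ of $\mathbb R^d$-valued functions, $v_h$ piecewise $\mathcal P_{k+1}$ on $\mathcal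 T_h$ and $\hat v_h$ piecewise $\mathcal P_{k+1}$ on $\mathcal F_h$, with $\hat v_h=0$ on all boundary faces; let $\mathcal Q_h$ be the same space of pairs $\vec q_h=(q_h,\hat q_h)$ without the boundary condition, and let $\mathcal H_{2,h}$ be the space of piecewise $\mathcal P_k$ triples $(\tau_{E,h},\tau_{V,h},\varphi_h)$ with values in $\mathbb S\times\mathbb S\times\mathbb R$. With the jump $[\![(v,\hat v)]\!]=v-\hat v$ on element boundaries, put $$B_h((\vec v,\vec q),(\tau_E,\tau_V,\varphi))=(\tau_E+\omega\tau_V-\alpha\varphi I_d,\varepsilon(v))_{\mathcal T_h}-(\varphi,\operatorname{div}q)_{\mathcal T_h}-\langle(\tau_E+\omega\tau_V-\alpha\varphi I_d)n,[\![\vec v]\!]\rangle_{\partial\mathcal T_h}+\langle\varphi n,[\![\vec q]\!]\rangle_{\partial\mathcal T_h}.$$ Claim (consistency). Assume that, for some $r>\frac12$, $\sigma_E+\omega\sigma_V-\alpha\psi I_d\in C^0([0,T];H^r(\mathcal T_h,\mathbb S))$ and $(u,p)\in C^0([0,T];[H^r(\mathcal T_h,\mathbb R^d)]^2)$, where $H^r(\mathcal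 T_h)$ is the broken Sobolev space of functions that are $H^r$ on each element. Then, for every $t\in[0,T]$, the total stress $\sigma_E+\omega\sigma_V-\alpha\psi I_d$, $\psi$, $u$ and $p$ have traces in $L^2$ on the faces of each element, the trace $u|_{\mathcal F_h}$ is single-valued and vanishes on boundary faces, and $$\begin{aligned}&((\dot u,\dot p),(v_h,q_h))_{\mathcal H_1}+((\dot\sigma_E,\dot\sigma_V,\dot\psi),(\tau_{E,h},\tau_{V,h},\varphi_h))_{\mathcal H_2}+(\mathcal G\sigma_V,\omega\tau_{V,h})_\Omega+(\beta p,q_h)_\Omega\\&\quad+B_h((\vec v_h,\vec q_h),(\sigma_E,\sigma_V,\psi))-B_h\big(((u,u|_{\mathcal F_h}),(p,p|_{\mathcal F_h})),(\tau_{E,h},\tau_{V,h},\varphi_h)\big)\\&\quad+\big\langle\tfrac{(k+1)^2}{h_F}(u-u|_{\mathcal F_h}),[\![\vec v_h]\!]\big\rangle_{\partial\mathcal T_h}+\big\langle\tfrac{(k+1)^2}{h_F}(p-p|_{\mathcal F_h}),[\![\vec q_h]\!]\big\rangle_{\partial\mathcal T_h}=(F,v_h)_\Omega+(g,\varphi_h)_\Omega\end{aligned}$$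 for all $\vec v_h\in\mathcal U_h$, $\vec q_h\in\mathcal Q_h$ and $(\tau_{E,h},\tau_{V,h},\varphi_h)\in\mathcal H_{2,h}$. Here $p|_{\mathcal F_h}$ is the trace of $p$ on the faces whenever the traces of $p$ from the two sides of each interior face coincide; in general (for the tangential components of $p$ may jump) the same equation holds with $p|_{\mathcal F_h}$ understood, on the boundary of each element, as the trace of $p$ from that element. -/

import Mathlib

open MeasureTheory Set Filter Topology
open scoped ENNReal

noncomputable section

namespace HDG

/-! ### Vectors, symmetric matrices, components -/

/-- `ℝ^d` with its Euclidean structure. -/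
abbrev Vec (d : ℕ) := EuclideanSpace ℝ (Fin d)

/-- Symmetric real `d × d` matrices, with the Frobenius inner product `σ : τ = ∑ i j, σ i j * τ i j`. -/
def SymMat (d : ℕ) : Submodule ℝ (EuclideanSpace ℝ (Fin d × Fin d)) where
  carrier := {τ | ∀ i j, τ (i, j) = τ (j, i)}
  add_mem' := by
    intro a b ha hb i j
    simp [ha i j, hb i j]
  zero_mem' := by
    intro i j
    simp
  smul_mem' := by
    intro c a ha i j
    simp [ha i j]

/-- The symmetric matrix with entries `(a i j + a j i) / 2`. -/
def symPart {d : ℕ} (a : Fin d → Fin d → ℝ) : SymMat d :=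
  ⟨WithLp.toLp 2 fun ij => (a ij.1 ij.2 + a ij.2 ij.1) / 2, by
    intro i j
    simp [add_comm]⟩

/-- The identity matrix `I_d`. -/
def idMat (d : ℕ) : SymMat d := symPart fun i j => if i = j then 1 else 0

/-- The `i`-th row of a symmetric matrix. -/
def row {d : ℕ} (τ : SymMat d) (i : Fin d) : Vec d := WithLp.toLp 2 fun j => τ.1 (i, j)

/-- Scalar components of a vector field. -/
def compV {d : ℕ} (v : Vec d → Vec d) : Fin d → Vec d → ℝ := fun i x => v x i

/-- Scalar components of a field of symmetric matrices. -/
def compM {d : ℕ} (τ : Vec d → SymMat d) : Fin d × Fin d → Vec d → ℝ := fun ij x => (τ x).1 ij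

/-- Square integrable functions on `Ω` with values in `V`. -/
abbrev L2 {d : ℕ} (Ω : Set (Vec d)) (V : Type) [NormedAddCommGroup V] :=
  Lp V 2 ((volume : Measure (Vec d)).restrict Ω)

/-! ### Weak derivatives -/

/-- Smooth test functions with compact support in `U`. -/
def IsTest {d : ℕ} (U : Set (Vec d)) (φ : Vec d → ℝ) : Prop :=
  ContDiff ℝ (⊤ : ℕ∞) φ ∧ HasCompactSupport φ ∧ tsupport φ ⊆ U

/-- `g = ∂_i f` in the sense of distributions on the open set `U`. -/
def HasWeakPartial {d : ℕ} (U : Set (Vec d)) (i : Fin d) (f g : Vec d → ℝ) : Prop :=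
  LocallyIntegrableOn f U ∧ LocallyIntegrableOn g U ∧
    ∀ φ, IsTest U φ →
      ∫ x in U, f x * fderiv ℝ φ x (EuclideanSpace.single i 1) = -∫ x in U, g x * φ x

/-- `g = div q` in the sense of distributions on the open set `U`. -/
def HasWeakDiv {d : ℕ} (U : Set (Vec d)) (q : Vec d → Vec d) (g : Vec d → ℝ) : Prop :=
  LocallyIntegrableOn q U ∧ LocallyIntegrableOn g U ∧
    ∀ φ, IsTest U φ → ∫ x in U, fderiv ℝ φ x (q x) = -∫ x in U, g x * φ x

open Classical in
/-- The weak partial derivative (unique a.e. on `U` when it exists, `0` otherwise). -/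
def weakPartial {d : ℕ} (U : Set (Vec d)) (i : Fin d) (f : Vec d → ℝ) : Vec d → ℝ :=
  if h : ∃ g, HasWeakPartial U i f g then h.choose else 0

open Classical in
/-- The weak divergence (unique a.e. on `U` when it exists, `0` otherwise). -/
def weakDiv {d : ℕ} (U : Set (Vec d)) (q : Vec d → Vec d) : Vec d → ℝ :=
  if h : ∃ g, HasWeakDiv U q g then h.choose else 0

/-- Weak gradient. -/
def weakGrad {d : ℕ} (U : Set (Vec d)) (f : Vec d → ℝ) (x : Vec d) : Vec d :=
  WithLp.toLp 2 fun i => weakPartial U i f x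

/-- Linearized strain `ε(v) = (∇v + ∇vᵀ) / 2`. -/
def strain {d : ℕ} (U : Set (Vec d)) (v : Vec d → Vec d) (x : Vec d) : SymMat d :=
  symPart fun i j => weakPartial U j (compV v i) x

/-- Row-wise weak divergence of a matrix field. -/
def weakDivM {d : ℕ} (U : Set (Vec d)) (τ : Vec d → SymMat d) (x : Vec d) : Vec d :=
  WithLp.toLp 2 fun i => weakDiv U (fun y => row (τ y) i) x

/-! ### Sobolev spaces of real order -/

/-- Squared Gagliardo (Sobolev-Slobodeckij) seminorm of order `θ`. -/
def gagliardoSq {d : ℕ} (U : Set (Vec d)) (θ : ℝ) (f : Vec d → ℝ) : ℝ≥0∞ :=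
  ∫⁻ x in U, ∫⁻ y in U, ‖f x - f y‖ₑ ^ 2 / ‖x - y‖ₑ ^ ((d : ℝ) + 2 * θ)

/-- Squared norm of order `m + θ`, `m : ℕ`, `0 ≤ θ < 1`: the squared `L²` norms of the weak
derivatives up to order `m`, and, if `θ ≠ 0`, the squared Gagliardo seminorms of those of order `m`. -/
def sobSq {d : ℕ} (U : Set (Vec d)) (θ : ℝ) : ℕ → (Vec d → ℝ) → ℝ≥0∞
  | 0, f => (∫⁻ x in U, ‖f x‖ₑ ^ 2) + (if θ = 0 then 0 else gagliardoSq U θ f)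
  | m + 1, f => (∫⁻ x in U, ‖f x‖ₑ ^ 2) + ∑ i, sobSq U θ m (weakPartial U i f)

/-- Membership in the space of order `m + θ`. -/
def MemSob {d : ℕ} (U : Set (Vec d)) (θ : ℝ) : ℕ → (Vec d → ℝ) → Prop
  | 0, f => MemLp f 2 (volume.restrict U) ∧ (θ ≠ 0 → gagliardoSq U θ f < ⊤)
  | m + 1, f => MemLp f 2 (volume.restrict U) ∧
      ∀ i, ∃ g, HasWeakPartial U i f g ∧ MemSob U θ m g

/-- `f ∈ H^s(U)`, `s ≥ 0`. -/
def MemHs {d : ℕ} (U : Set (Vec d)) (s : ℝ) (f : Vec d → ℝ) : Prop :=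
  MemSob U (Int.fract s) ⌊s⌋₊ f

/-- Squared norm of `H^s(U)`, `s ≥ 0`. -/
def hsSq {d : ℕ} (U : Set (Vec d)) (s : ℝ) (f : Vec d → ℝ) : ℝ≥0∞ :=
  sobSq U (Int.fract s) ⌊s⌋₊ f

/-- `q ∈ H(div, U)`. -/
def MemHdiv {d : ℕ} (U : Set (Vec d)) (q : Vec d → Vec d) : Prop :=
  MemLp q 2 (volume.restrict U) ∧ ∃ g, HasWeakDiv U q g ∧ MemLp g 2 (volume.restrict U)

/-! ### Traces -/

/-- Surface measure: the `(d-1)`-dimensional Hausdorff measure, normalized so as to agree with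
Lebesgue measure on hyperplanes. -/
def surf (d : ℕ) : Measure (Vec d) := Measure.euclideanHausdorffMeasure (d - 1)

/-- `g` is the trace on `F ⊆ ∂U` of `f`: for some `r > 1/2`, `f ∈ H^r(U)`, and `f` is the limit in
`H^r(U)` of smooth functions whose restrictions to `F` converge to `g` in `L²(F)`. In other words, `g`
is the value at `f` of the continuous extension to `H^r(U)` of the restriction operator. -/
def HasTrace {d : ℕ} (U F : Set (Vec d)) (f g : Vec d → ℝ) : Prop :=
  MemLp g 2 ((surf d).restrict F) ∧
    ∃ r : ℝ, 1 / 2 < r ∧ MemHs U r f ∧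
      ∃ φ : ℕ → Vec d → ℝ, (∀ n, ContDiff ℝ (⊤ : ℕ∞) (φ n)) ∧
        Tendsto (fun n => hsSq U r (fun x => φ n x - f x)) atTop (𝓝 0) ∧
        Tendsto (fun n => eLpNorm (fun x => φ n x - g x) 2 ((surf d).restrict F)) atTop (𝓝 0)

open Classical in
/-- The trace (`0` when it does not exist). -/
def trace {d : ℕ} (U F : Set (Vec d)) (f : Vec d → ℝ) : Vec d → ℝ :=
  if h : ∃ g, HasTrace U F f g then h.choose else 0

/-- Trace of a vector field. -/
def traceV {d : ℕ} (U F : Set (Vec d)) (v : Vec d → Vec d) (x : Vec d) : Vec d :=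
  WithLp.toLp 2 fun i => trace U F (compV v i) x

/-- Trace of a matrix field multiplied by the constant vector `n`. -/
def traceMn {d : ℕ} (U F : Set (Vec d)) (τ : Vec d → SymMat d) (n : Vec d) (x : Vec d) : Vec d :=
  WithLp.toLp 2 fun i => ∑ j, trace U F (compM τ (i, j)) x * n j

/-- `H¹` functions on `Ω` with zero trace on the whole boundary. -/
def MemH1D {d : ℕ} (Ω : Set (Vec d)) (f : Vec d → ℝ) : Prop :=
  MemHs Ω 1 f ∧ HasTrace Ω (frontier Ω) f 0

/-! ### The continuous problem -/

/-- The material coefficients. -/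
structure Coeff (d : ℕ) where
  (ρ χ s α β ω : ℝ)
  ρ_pos : 0 < ρ
  χ_pos : 0 < χ
  s_pos : 0 < s
  α_pos : 0 < α
  β_pos : 0 < β
  ω_pos : 0 < ω
  /-- The elastic tensor. -/
  C : SymMat d →L[ℝ] SymMat d
  /-- The viscoelastic tensor. -/
  D : SymMat d →L[ℝ] SymMat d
  C_symm : ∀ σ τ, inner ℝ (C σ) τ = inner ℝ σ (C τ)
  D_symm : ∀ σ τ, inner ℝ (D σ) τ = inner ℝ σ (D τ)
  C_pos : ∀ τ, τ ≠ 0 → 0 < inner ℝ (C τ) τ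
  D_pos : ∀ τ, τ ≠ 0 → 0 < inner ℝ (D τ) τ
  DC_pos : ∀ τ, τ ≠ 0 → 0 < inner ℝ ((D - C) τ) τ

variable {d : ℕ}

/-- `𝒜 = C⁻¹`. -/
def Coeff.A (c : Coeff d) : SymMat d →L[ℝ] SymMat d := c.C.inverse

/-- `𝒢 = (D - C)⁻¹`. -/
def Coeff.G (c : Coeff d) : SymMat d →L[ℝ] SymMat d := (c.D - c.C).inverse

/-- The total stress `σE + ω σV - α ψ I`. -/
def Coeff.total (c : Coeff d) (σE σV : Vec d → SymMat d) (ψ : Vec d → ℝ) (x : Vec d) : SymMat d :=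
  σE x + c.ω • σV x - (c.α * ψ x) • idMat d

/-- The inner product of `ℋ₁`. -/
def innerH1 (c : Coeff d) (Ω : Set (Vec d)) (u p v q : Vec d → Vec d) : ℝ :=
  (∫ x in Ω, inner ℝ (c.ρ • u x) (v x)) + ∫ x in Ω, inner ℝ (c.χ • p x) (q x)

/-- The inner product of `ℋ₂`. -/
def innerH2 (c : Coeff d) (Ω : Set (Vec d)) (σE σV : Vec d → SymMat d) (ψ : Vec d → ℝ)
    (τE τV : Vec d → SymMat d) (φ : Vec d → ℝ) : ℝ :=
  (∫ x in Ω, inner ℝ (c.A (σE x)) (τE x)) + (∫ x in Ω, inner ℝ (c.ω • c.G (σV x)) (c.ω • τV x))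
    + ∫ x in Ω, c.s * ψ x * φ x

/-- `(u, p) ∈ 𝒳₁ = H¹_D(Ω, ℝ^d) × H(div, Ω)`. -/
def MemX1 (Ω : Set (Vec d)) (u p : Vec d → Vec d) : Prop :=
  (∀ i, MemH1D Ω (compV u i)) ∧ MemHdiv Ω p

/-- The squared norm of `𝒳₁`. -/
def normX1Sq (c : Coeff d) (Ω : Set (Vec d)) (u p : Vec d → Vec d) : ℝ :=
  innerH1 c Ω u p u p + (∫ x in Ω, ‖strain Ω u x‖ ^ 2)
    + ∫ x in Ω, 1 / c.s * (weakDiv Ω p x + c.α * weakDiv Ω u x) ^ 2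

/-- `(σE, σV, ψ) ∈ 𝒳₂`: `σE, σV ∈ L²`, `ψ ∈ H¹_D(Ω)` and the total stress lies in `H(div, Ω)`. -/
def MemX2 (c : Coeff d) (Ω : Set (Vec d)) (σE σV : Vec d → SymMat d) (ψ : Vec d → ℝ) : Prop :=
  MemLp σE 2 (volume.restrict Ω) ∧ MemLp σV 2 (volume.restrict Ω) ∧ MemH1D Ω ψ ∧
    ∀ i, MemHdiv Ω (fun x => row (c.total σE σV ψ x) i)

/-- The squared norm of `𝒳₂`. -/
def normX2Sq (c : Coeff d) (Ω : Set (Vec d)) (σE σV : Vec d → SymMat d) (ψ : Vec d → ℝ) : ℝ :=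
  innerH2 c Ω σE σV ψ σE σV ψ + (∫ x in Ω, 1 / c.ρ * ‖weakDivM Ω (c.total σE σV ψ) x‖ ^ 2)
    + ∫ x in Ω, 1 / c.χ * ‖weakGrad Ω ψ x‖ ^ 2

/-- Time derivative in `L²(Ω)` on `[0, T]` (one-sided at the end points). -/
def dot {Ω : Set (Vec d)} {V : Type} [NormedAddCommGroup V] [NormedSpace ℝ V] (T : ℝ)
    (f : ℝ → L2 Ω V) (t : ℝ) : Vec d → V :=
  (derivWithin f (Icc 0 T) t : L2 Ω V)

/-- `(u, p) ∈ 𝒞¹([0,T]; ℋ₁) ∩ 𝒞⁰([0,T]; 𝒳₁)` and `(σE, σV, ψ) ∈ 𝒞¹([0,T]; ℋ₂) ∩ 𝒞⁰([0,T]; 𝒳₂)` solve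
the first order system, as an evolution equation in `L²(Ω)`, with sources `f` and `g`. -/
structure IsSolution (c : Coeff d) (Ω : Set (Vec d)) (T : ℝ)
    (f : ℝ → L2 Ω (Vec d)) (g : ℝ → L2 Ω ℝ)
    (u p : ℝ → L2 Ω (Vec d)) (σE σV : ℝ → L2 Ω (SymMat d)) (ψ : ℝ → L2 Ω ℝ) : Prop where
  u_C1 : ContDiffOn ℝ 1 u (Icc 0 T)
  p_C1 : ContDiffOn ℝ 1 p (Icc 0 T)
  σE_C1 : ContDiffOn ℝ 1 σE (Icc 0 T)
  σV_C1 : ContDiffOn ℝ 1 σV (Icc 0 T)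
  ψ_C1 : ContDiffOn ℝ 1 ψ (Icc 0 T)
  mem_X1 : ∀ t ∈ Icc 0 T, MemX1 Ω (u t) (p t)
  mem_X2 : ∀ t ∈ Icc 0 T, MemX2 c Ω (σE t) (σV t) (ψ t)
  cont_X1 : ∀ t₀ ∈ Icc 0 T,
    Tendsto (fun t => normX1Sq c Ω (u t - u t₀ : L2 Ω (Vec d)) (p t - p t₀ : L2 Ω (Vec d)))
      (𝓝[Icc 0 T] t₀) (𝓝 0)
  cont_X2 : ∀ t₀ ∈ Icc 0 T,
    Tendsto (fun t => normX2Sq c Ω (σE t - σE t₀ : L2 Ω (SymMat d))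
      (σV t - σV t₀ : L2 Ω (SymMat d)) (ψ t - ψ t₀ : L2 Ω ℝ)) (𝓝[Icc 0 T] t₀) (𝓝 0)
  momentum : ∀ t ∈ Icc 0 T, ∀ᵐ x ∂volume.restrict Ω,
    c.ρ • dot T u t x - weakDivM Ω (c.total (σE t) (σV t) (ψ t)) x = f t x
  elastic : ∀ t ∈ Icc 0 T, ∀ᵐ x ∂volume.restrict Ω,
    dot T σE t x = c.C (strain Ω (u t) x)
  viscous : ∀ t ∈ Icc 0 T, ∀ᵐ x ∂volume.restrict Ω,
    c.ω • dot T σV t x + σV t x = (c.D - c.C) (strain Ω (u t) x)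
  flux : ∀ t ∈ Icc 0 T, ∀ᵐ x ∂volume.restrict Ω,
    c.χ • dot T p t x + c.β • p t x + weakGrad Ω (ψ t) x = 0
  conservation : ∀ t ∈ Icc 0 T, ∀ᵐ x ∂volume.restrict Ω,
    c.s * dot T ψ t x + weakDiv Ω (p t) x + c.α * weakDiv Ω (u t) x = g t x

/-! ### Meshes -/

/-- Bounded domain without slits (that it is polygonal or polyhedral follows from the existence of
a mesh). -/
structure IsPolyDomain (Ω : Set (Vec d)) : Prop where
  isOpen : IsOpen Ω
  isConnected : IsConnected Ω
  isBounded : Bornology.IsBounded Ω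
  interior_closure : interior (closure Ω) = Ω

/-- A nondegenerate closed `n`-simplex. -/
def IsSimplex (n : ℕ) (K : Set (Vec d)) : Prop :=
  ∃ v : Fin (n + 1) → Vec d, AffineIndependent ℝ v ∧ K = convexHull ℝ (range v)

/-- A nondegenerate closed parallelepiped. -/
def IsParallelepiped (K : Set (Vec d)) : Prop :=
  ∃ (a : Vec d) (e : Fin d → Vec d), LinearIndependent ℝ e ∧
    K = (fun x => a + x) '' parallelepiped e

/-- A convex quadrilateral (four points, none of which lies in the convex hull of the others). -/
def IsQuadrilateral (K : Set (Vec d)) : Prop :=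
  ∃ v : Fin 4 → Vec d, ConvexIndependent ℝ v ∧ K = convexHull ℝ (range v)

/-- Mesh elements: triangles and quadrilaterals if `d = 2`, tetrahedra and parallelepipeds
if `d = 3`. -/
def IsElement (K : Set (Vec d)) : Prop :=
  IsSimplex d K ∨ (d = 2 ∧ IsQuadrilateral K) ∨ (d = 3 ∧ IsParallelepiped K)

/-- `G` is a (full) edge/face of the convex polytope `K`. -/
def IsFacet (K G : Set (Vec d)) : Prop :=
  0 < surf d G ∧ ∃ n : Vec d, ‖n‖ = 1 ∧ G = {x ∈ K | ∀ y ∈ K, inner ℝ n (y - x) ≤ 0}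

/-- Interior faces: intersections of positive surface measure of two distinct elements. -/
def interiorFaces (elems : Finset (Set (Vec d))) : Set (Set (Vec d)) :=
  {F | 0 < surf d F ∧ ∃ K ∈ elems, ∃ K' ∈ elems, K ≠ K' ∧ F = K ∩ K'}

/-- Boundary faces: parts of positive surface measure of `∂Ω` cut out by an edge/face of an element
(the whole edge/face if this is contained in `∂Ω`). -/
def boundaryFaces (Ω : Set (Vec d)) (elems : Finset (Set (Vec d))) : Set (Set (Vec d)) :=
  {F | 0 < surf d F ∧ ∃ K ∈ elems, ∃ G, IsFacet K G ∧ F = G ∩ frontier Ω}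

/-- A mesh of `Ω`, hanging nodes being allowed. For elements and faces that are not simplices,
`coord` is the system of affine coordinates with respect to which the degree of a polynomial in each
variable is measured; a face lies in a coordinate hyperplane of its system. -/
structure Mesh (Ω : Set (Vec d)) where
  elems : Finset (Set (Vec d))
  isElement : ∀ K ∈ elems, IsElement K
  cover : ⋃ K ∈ elems, K = closure Ω
  disjoint : ∀ K ∈ elems, ∀ K' ∈ elems, K ≠ K' → Disjoint (interior K) (interior K')
  coord : Set (Vec d) → (Vec d ≃ᵃ[ℝ] Vec d)
  coord_face : ∀ F ∈ interiorFaces elems ∪ boundaryFaces Ω elems,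
    ∃ (i : Fin d) (a : ℝ), ∀ x ∈ F, coord F x i = a

variable {Ω : Set (Vec d)}

/-- All faces `ℱ_h`. -/
def Mesh.faces (𝓣 : Mesh Ω) : Set (Set (Vec d)) :=
  interiorFaces 𝓣.elems ∪ boundaryFaces Ω 𝓣.elems

/-- The faces `ℱ(K)` of the element `K`. -/
def Mesh.facesOf (𝓣 : Mesh Ω) (K : Set (Vec d)) : Set (Set (Vec d)) :=
  {F ∈ 𝓣.faces | F ⊆ K}

open Classical in
/-- The unit outward normal of the element `K` on its (flat) face `F`. -/
def normal (K F : Set (Vec d)) : Vec d :=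
  if h : ∃ n : Vec d, ‖n‖ = 1 ∧ ∀ x ∈ F, ∀ y ∈ K, inner ℝ n (y - x) ≤ 0 then h.choose else 0

/-- `∑_K ∫_K f`. -/
def Mesh.volSum (𝓣 : Mesh Ω) (f : Set (Vec d) → Vec d → ℝ) : ℝ :=
  ∑ K ∈ 𝓣.elems, ∫ x in K, f K x

/-- `∑_K ∑_{F ∈ ℱ(K)} ∫_F f`. -/
def Mesh.bdrySum (𝓣 : Mesh Ω) (f : Set (Vec d) → Set (Vec d) → Vec d → ℝ) : ℝ :=
  ∑ K ∈ 𝓣.elems, ∑ᶠ F ∈ 𝓣.facesOf K, ∫ x in F, f K F x ∂(surf d)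

/-- `w ∈ 𝒞⁰([0,T]; H^r(𝒯_h))`, for a time dependent finite family `w` of scalar components. -/
def Mesh.ContBroken {ι : Type} [Fintype ι] (𝓣 : Mesh Ω) (r T : ℝ) (w : ℝ → ι → Vec d → ℝ) : Prop :=
  (∀ t ∈ Icc 0 T, ∀ K ∈ 𝓣.elems, ∀ i, MemHs (interior K) r (w t i)) ∧
    ∀ t₀ ∈ Icc 0 T, Tendsto
      (fun t => ∑ K ∈ 𝓣.elems, ∑ i, hsSq (interior K) r (fun x => w t i x - w t₀ i x))
      (𝓝[Icc 0 T] t₀) (𝓝 0)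

/-! ### Hybrid variables, traces on the skeleton

An element of `L²(∂𝒯_h, ℝ^d)` is a family `ŵ K F` of vector fields on the faces `F` of the elements
`K`; an element of `L²(ℱ_h, ℝ^d)` is a family `v̂ F` of vector fields on the faces `F`, and is regarded
as the element `fun _ F => v̂ F` of `L²(∂𝒯_h, ℝ^d)`. -/

/-- Every member of the finite family `w` of scalar components has traces in `L²` on the faces
of all elements. -/
def Mesh.HasTraces {ι : Type} (𝓣 : Mesh Ω) (w : ι → Vec d → ℝ) : Prop :=
  ∀ K ∈ 𝓣.elems, ∀ F ∈ 𝓣.facesOf K, ∀ i, ∃ g, HasTrace (interior K) F (w i) g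

/-- `ŵ ∈ L²(∂𝒯_h, ℝ^d)` is the family of the traces of `v` from the elements. -/
def Mesh.IsElemTrace (𝓣 : Mesh Ω) (v : Vec d → Vec d)
    (vh : Set (Vec d) → Set (Vec d) → Vec d → Vec d) : Prop :=
  ∀ K ∈ 𝓣.elems, ∀ F ∈ 𝓣.facesOf K, ∀ i, HasTrace (interior K) F (compV v i) (compV (vh K F) i)

/-- `v̂ ∈ L²(ℱ_h, ℝ^d)` is the trace `v|_{ℱ_h}`: on each face it is the trace of `v` from
every element that has this face. -/
def Mesh.IsFaceTrace (𝓣 : Mesh Ω) (v : Vec d → Vec d) (vh : Set (Vec d) → Vec d → Vec d) : Prop :=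
  𝓣.IsElemTrace v (fun _ F => vh F)

/-! ### Discrete spaces -/

/-- `f` coincides on `S` with a member of `𝒫_m(D)`, `D` of dimension `n`: polynomials of total degree
`≤ m` if `D` is a simplex, of degree `≤ m` in each variable otherwise. -/
def Mesh.PolyOn (𝓣 : Mesh Ω) (n m : ℕ) (D S : Set (Vec d)) (f : Vec d → ℝ) : Prop :=
  (IsSimplex n D ∧ ∃ P : MvPolynomial (Fin d) ℝ, P.totalDegree ≤ m ∧
      ∀ x ∈ S, f x = MvPolynomial.eval (fun i => x i) P) ∨
    (¬ IsSimplex n D ∧ ∃ P : MvPolynomial (Fin d) ℝ, (∀ i, P.degreeOf i ≤ m) ∧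
      ∀ x ∈ S, f x = MvPolynomial.eval (fun i => 𝓣.coord D x i) P)

/-- Components in `𝒫_m(𝒯_h)`. -/
def Mesh.PolyVol {ι : Type} (𝓣 : Mesh Ω) (m : ℕ) (w : ι → Vec d → ℝ) : Prop :=
  ∀ K ∈ 𝓣.elems, ∀ i, 𝓣.PolyOn d m K (interior K) (w i)

/-- `v̂ ∈ 𝒫_m(ℱ_h, ℝ^d)`. -/
def Mesh.PolyFace (𝓣 : Mesh Ω) (m : ℕ) (vh : Set (Vec d) → Vec d → Vec d) : Prop :=
  ∀ F ∈ 𝓣.faces, ∀ i, 𝓣.PolyOn (d - 1) m F F (compV (vh F) i)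

/-- `(v, v̂) ∈ 𝒰_h`. -/
def Mesh.MemUh (𝓣 : Mesh Ω) (k : ℕ) (v : Vec d → Vec d) (vh : Set (Vec d) → Vec d → Vec d) : Prop :=
  𝓣.PolyVol (k + 1) (compV v) ∧ 𝓣.PolyFace (k + 1) vh ∧
    ∀ F ∈ boundaryFaces Ω 𝓣.elems, ∀ x ∈ F, vh F x = 0

/-- `(q, q̂) ∈ 𝒬_h`. -/
def Mesh.MemQh (𝓣 : Mesh Ω) (k : ℕ) (q : Vec d → Vec d) (qh : Set (Vec d) → Vec d → Vec d) : Prop :=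
  𝓣.PolyVol (k + 1) (compV q) ∧ 𝓣.PolyFace (k + 1) qh

/-- `(τE, τV, φ) ∈ ℋ_{2,h}`. -/
def Mesh.MemH2h (𝓣 : Mesh Ω) (k : ℕ) (τE τV : Vec d → SymMat d) (φ : Vec d → ℝ) : Prop :=
  𝓣.PolyVol k (compM τE) ∧ 𝓣.PolyVol k (compM τV) ∧ 𝓣.PolyVol k (fun _ : Unit => φ)

/-! ### The HDG scheme -/

/-- The jump `⟦(v, v̂)⟧ = v - v̂` on the face `F` of the element `K`. -/
def jump (v : Vec d → Vec d) (vh : Set (Vec d) → Set (Vec d) → Vec d → Vec d)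
    (K F : Set (Vec d)) (x : Vec d) : Vec d :=
  traceV (interior K) F v x - vh K F x

/-- The bilinear form `B_h(((v, v̂), (q, q̂)), (τE, τV, φ))`. -/
def Mesh.Bh (𝓣 : Mesh Ω) (c : Coeff d)
    (v : Vec d → Vec d) (vh : Set (Vec d) → Set (Vec d) → Vec d → Vec d)
    (q : Vec d → Vec d) (qh : Set (Vec d) → Set (Vec d) → Vec d → Vec d)
    (τE τV : Vec d → SymMat d) (φ : Vec d → ℝ) : ℝ :=
  𝓣.volSum (fun K x => inner ℝ (c.total τE τV φ x) (strain (interior K) v x))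
    - 𝓣.volSum (fun K x => φ x * weakDiv (interior K) q x)
    - 𝓣.bdrySum (fun K F x =>
        inner ℝ (traceMn (interior K) F (c.total τE τV φ) (normal K F) x) (jump v vh K F x))
    + 𝓣.bdrySum (fun K F x =>
        inner ℝ (trace (interior K) F φ x • normal K F) (jump q qh K F x))

/-- The stabilization form `⟨(k+1)² / h_F ⟦(u, û)⟧, ⟦(v, v̂)⟧⟩_{∂𝒯_h}`, where `h_F = diam F`. -/
def Mesh.stab (𝓣 : Mesh Ω) (k : ℕ)
    (u : Vec d → Vec d) (uh : Set (Vec d) → Set (Vec d) → Vec d → Vec d)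
    (v : Vec d → Vec d) (vh : Set (Vec d) → Set (Vec d) → Vec d → Vec d) : ℝ :=
  𝓣.bdrySum (fun K F x =>
    inner ℝ ((((k : ℝ) + 1) ^ 2 / Metric.diam F) • jump u uh K F x) (jump v vh K F x))

/-- The semi-discrete HDG equation at a given time, for the time derivatives `u'`, `p'`, `σE'`,
`σV'`, `ψ'`, the unknowns `(u, û)`, `(p, p̂)`, `σE`, `σV`, `ψ`, the sources `f`, `g` and the
test functions `(v, v̂)`, `(q, q̂)`, `τE`, `τV`, `φ`. -/
def Mesh.HDGEquation (𝓣 : Mesh Ω) (c : Coeff d) (k : ℕ)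
    (u' p' : Vec d → Vec d) (σE' σV' : Vec d → SymMat d) (ψ' : Vec d → ℝ)
    (u : Vec d → Vec d) (uh : Set (Vec d) → Set (Vec d) → Vec d → Vec d)
    (p : Vec d → Vec d) (ph : Set (Vec d) → Set (Vec d) → Vec d → Vec d)
    (σE σV : Vec d → SymMat d) (ψ : Vec d → ℝ)
    (f : Vec d → Vec d) (g : Vec d → ℝ)
    (v : Vec d → Vec d) (vh : Set (Vec d) → Set (Vec d) → Vec d → Vec d)
    (q : Vec d → Vec d) (qh : Set (Vec d) → Set (Vec d) → Vec d → Vec d)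
    (τE τV : Vec d → SymMat d) (φ : Vec d → ℝ) : Prop :=
  innerH1 c Ω u' p' v q + innerH2 c Ω σE' σV' ψ' τE τV φ
    + (∫ x in Ω, inner ℝ (c.G (σV x)) (c.ω • τV x)) + (∫ x in Ω, inner ℝ (c.β • p x) (q x))
    + 𝓣.Bh c v vh q qh σE σV ψ - 𝓣.Bh c u uh p ph τE τV φ
    + 𝓣.stab k u uh v vh + 𝓣.stab k p ph q qh
  = (∫ x in Ω, inner ℝ (f x) (v x)) + ∫ x in Ω, g x * φ x

end HDG

end

/-!
The equation follows by testing the continuous equations with the discrete functions, once `B_h` is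
reduced to volume terms. The work lies in the traces and in integration by parts on the elements,
from the definitions of weak derivatives, broken Sobolev spaces and traces.

*Traces.* On an element `K`, fix a ball in its interior and average a function `f` over the
contractions `x ↦ (1 - ε) x + ε w`, with `w` distributed over the ball. These smoothings `S_ε f` are
smooth up to the boundary of `K`, converge to `f` in `H^r(K)` (`tendsto_hsSq_smoothing`; the case
`0 < r ≤ 1` suffices) and satisfy
`div S_ε q = (1 - ε) S_ε div q` (`div_smoothing`). At a point of a face, two smoothings differ by an
average of `f x - f x'` over points at distance of order `ε`. The squared mean oscillation of `f` at
this scale is of order `ε^(d + 2 r)` (`exists_osc_le`), the averaging densities are of order `ε^(-d)`,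
and balls of radius `ε` cut a surface of order `ε^(d - 1)` out of the face; hence
`‖S_ε f - S_{ε/2} f‖²` in `L²` of the face is of order `ε^(2 r - 1)`. For `r > 1/2` the smoothings form
a Cauchy sequence there. Its limit is a trace of `f`, bounded by the norm of `H^r(K)`
(`IsTraceSet.exists_limit`), and every trace of `f` is this limit (`IsTraceSet.tendsto_of_hasTrace`).

*Green's formula.* An element is the union of the cones over its faces with an interior apex `x₀`.
Integration along rays gives the divergence theorem for the radial fields `f(x) (x - x₀)`
(`Mesh.integral_radial`), and the difference of two such identities with different apexes gives it for
fields of constant direction (`Mesh.integral_fderiv`). Applied to `v S_ε q`, in the limit `ε → 0`, it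
yields Green's formula for fields with weak divergence in `L²` and traces on the faces
(`Mesh.integral_weakDiv_mul`). Here one needs that the faces in the sense of the mesh, hanging nodes
included, cover the boundary of an element and overlap only in null sets (`Mesh.surf_frontier_diff`,
`Mesh.surf_inter_facesOf`).

*Consistency.* Green's formula on two neighbours shows that normal components of fields with weak
divergence in `L²(Ω)` are single-valued (`Mesh.normal_trace_add_eq_zero`). Therefore traces of `H¹`
functions are single-valued, and the hybrid test functions drop out of the boundary terms
(`Mesh.volSum_sub_bdrySum`); on boundary faces they vanish with `v̂_h` or with the trace of `ψ`. So
`B_h` with the exact stress and pressure tests the divergence of the stress and the gradient of the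
pressure (`Mesh.Bh_of_memHdiv`). With the traces of `u` and `p` as hybrid variables, their jumps vanish,
so that the stabilization is zero and `B_h` is a volume integral (`Mesh.Bh_elemTrace`).
-/

namespace HDG

/-! ### Surface measure on hyperplanes -/

/-- The hyperplane `{y | ⟨n, y⟩ = a}`. -/
def flat {d : ℕ} (n : Vec d) (a : ℝ) : Set (Vec d) := {y | inner ℝ n y = a}

variable {d : ℕ}

theorem isClosed_flat (n : Vec d) (a : ℝ) : IsClosed (flat n a) :=
  isClosed_eq (by fun_prop) continuous_const

theorem surf_succ (e : ℕ) : surf (e + 1) = (Measure.euclideanHausdorffMeasure e : Measure (Vec (e + 1))) := by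
  simp [surf]

theorem exists_isometry_flat {e : ℕ} {n : Vec (e + 1)} (hn : ‖n‖ = 1) (a : ℝ) :
    ∃ Λ : Vec e →ₗᵢ[ℝ] Vec (e + 1), Isometry (fun z => a • n + Λ z) ∧
      range (fun z => a • n + Λ z) = flat n a := by
  have hn0 : n ≠ 0 := by
    rintro rfl
    simp at hn
  have : Fact (Module.finrank ℝ (Vec (e + 1)) = e + 1) := ⟨by simp⟩
  let b := OrthonormalBasis.fromOrthogonalSpanSingleton (𝕜 := ℝ) e hn0
  let Λ : Vec e →ₗᵢ[ℝ] Vec (e + 1) :=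
    ((ℝ ∙ n)ᗮ).subtypeₗᵢ.comp b.repr.symm.toLinearIsometry
  have hnn : inner ℝ n n = 1 := by rw [real_inner_self_eq_norm_sq, hn]; norm_num
  refine ⟨Λ, ?_, ?_⟩
  · intro x y
    simp [edist_add_left, Λ.isometry.edist_eq]
  · ext y
    simp only [mem_range, flat, mem_ofPred_eq]
    constructor
    · rintro ⟨z, rfl⟩
      have : inner ℝ n (Λ z) = 0 :=
        Submodule.mem_orthogonal_singleton_iff_inner_right.1 (b.repr.symm z).2
      rw [inner_add_right, inner_smul_right, hnn, this]
      simp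
    · intro h
      have hy : y - a • n ∈ (ℝ ∙ n)ᗮ := by
        rw [Submodule.mem_orthogonal_singleton_iff_inner_right, inner_sub_right, inner_smul_right,
          hnn, h]
        simp
      refine ⟨b.repr ⟨y - a • n, hy⟩, ?_⟩
      simp [Λ]

/-- Hyperplanes are upper `(d - 1)`-regular. -/
theorem surf_flat_inter_closedBall_le (hd : 0 < d) {n : Vec d} (hn : ‖n‖ = 1) (a : ℝ) :
    ∃ C : ℝ≥0∞, C ≠ ⊤ ∧ ∀ (x : Vec d) (ρ : ℝ), 0 ≤ ρ →
      surf d (flat n a ∩ Metric.closedBall x ρ) ≤ C * ENNReal.ofReal (ρ ^ (d - 1)) := by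
  obtain ⟨e, rfl⟩ : ∃ e, d = e + 1 := ⟨d - 1, by omega⟩
  obtain ⟨Λ, hJ, hr⟩ := exists_isometry_flat hn a
  set J : Vec e → Vec (e + 1) := fun z => a • n + Λ z with hJdef
  refine ⟨volume (Metric.closedBall (0 : Vec e) 2), measure_closedBall_lt_top.ne, fun x ρ hρ => ?_⟩
  rw [surf_succ, inter_comm, ← hr, ← hJ.euclideanHausdorffMeasure_preimage,
    EuclideanSpace.euclideanHausdorffMeasure_eq_volume]
  rcases (J ⁻¹' Metric.closedBall x ρ).eq_empty_or_nonempty with h0 | ⟨z, hz⟩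
  · rw [h0]; simp
  have hsub : J ⁻¹' Metric.closedBall x ρ ⊆ Metric.closedBall z (ρ * 2) := by
    intro w hw
    simp only [mem_preimage, Metric.mem_closedBall] at hw hz ⊢
    rw [← hJ.dist_eq]
    have := dist_triangle_right (J w) (J z) x
    linarith
  refine (measure_mono hsub).trans ?_
  rw [Measure.addHaar_closedBall_mul _ _ hρ (by norm_num)]
  simp [mul_comm]

theorem surf_flat_inter_ne_top (hd : 0 < d) {n : Vec d} (hn : ‖n‖ = 1) {a : ℝ} {F : Set (Vec d)}
    (hF : F ⊆ flat n a) (hb : Bornology.IsBounded F) : surf d F ≠ ⊤ := by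
  obtain ⟨C, hC, h⟩ := surf_flat_inter_closedBall_le hd hn a
  obtain ⟨ρ, hρ⟩ := hb.subset_closedBall 0
  have : F ⊆ flat n a ∩ Metric.closedBall 0 (max ρ 0) :=
    subset_inter hF (hρ.trans (Metric.closedBall_subset_closedBall (le_max_left _ _)))
  refine ((measure_mono this).trans_lt ((h 0 _ (le_max_right _ _)).trans_lt ?_)).ne
  exact ENNReal.mul_lt_top hC.lt_top ENNReal.ofReal_lt_top

/-- Two hyperplanes that share a set of positive surface measure coincide. -/
theorem flat_eq_of_surf_pos (hd : 0 < d) {n n' : Vec d} (hn : ‖n‖ = 1) (hn' : ‖n'‖ = 1) {a a' : ℝ}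
    {F : Set (Vec d)} (hF : F ⊆ flat n a) (hF' : F ⊆ flat n' a') (hpos : 0 < surf d F) :
    (n' = n ∧ a' = a) ∨ (n' = -n ∧ a' = -a) := by
  obtain ⟨e, rfl⟩ : ∃ e, d = e + 1 := ⟨d - 1, by omega⟩
  obtain ⟨Λ, hJ, hr⟩ := exists_isometry_flat hn a
  set J : Vec e → Vec (e + 1) := fun z => a • n + Λ z with hJdef
  have h1 : 0 < volume (J ⁻¹' F) := by
    rw [← EuclideanSpace.euclideanHausdorffMeasure_eq_volume, hJ.euclideanHausdorffMeasure_preimage,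
      hr, inter_eq_left.2 hF, ← surf_succ]
    exact hpos
  let A : AffineSubspace ℝ (Vec e) :=
    (AffineSubspace.mk' (a' • n') (ℝ ∙ n')ᗮ).comap
      ((Λ.toLinearMap.toAffineMap) + AffineMap.const ℝ _ (a • n))
  have hnn' : inner ℝ n' n' = (1 : ℝ) := by rw [real_inner_self_eq_norm_sq, hn']; norm_num
  have hnn : inner ℝ n n = (1 : ℝ) := by rw [real_inner_self_eq_norm_sq, hn]; norm_num
  have hA : ∀ z, z ∈ A ↔ inner ℝ n' (J z) = a' := by
    intro z
    simp only [A, AffineSubspace.mem_comap, AffineSubspace.mem_mk',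
      Submodule.mem_orthogonal_singleton_iff_inner_right, vsub_eq_sub, inner_sub_right,
      inner_smul_right, hnn']
    simp [J, add_comm, sub_eq_zero]
  have hAtop : A = ⊤ := by
    by_contra hne
    have h0 := Measure.addHaar_affineSubspace (volume : Measure (Vec e)) A hne
    have : J ⁻¹' F ⊆ A := fun z hz => (hA z).2 (hF' hz)
    exact h1.ne' (measure_mono_null this h0)
  have hall : ∀ z, inner ℝ n' (J z) = a' := fun z => (hA z).1 (by rw [hAtop]; trivial)
  have h0 := hall 0
  simp only [J, map_zero, add_zero, inner_smul_right] at h0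
  have hperp : ∀ y, inner ℝ n y = (0 : ℝ) → inner ℝ n' y = (0 : ℝ) := by
    intro y hy
    have hy2 : a • n + y ∈ range J := by
      rw [hr]; simp [flat, inner_add_right, inner_smul_right, hn, hy]
    obtain ⟨z, hz⟩ := hy2
    have := hall z
    rw [hz, inner_add_right, inner_smul_right] at this
    linarith
  set s : ℝ := inner ℝ n' n with hs
  have key : n' = s • n := by
    have h2 : inner ℝ n (n' - s • n) = (0 : ℝ) := by
      rw [inner_sub_right, inner_smul_right, hnn, hs, real_inner_comm]; ring
    have h3 := hperp _ h2
    have h4 : inner ℝ (n' - s • n) (n' - s • n) = (0 : ℝ) := by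
      rw [inner_sub_left, h3, inner_smul_left, h2]; simp
    exact sub_eq_zero.1 (inner_self_eq_zero.1 h4)
  have hs1 : |s| = 1 := by
    have := congrArg norm key
    rw [norm_smul, hn, hn', Real.norm_eq_abs] at this
    linarith
  rcases eq_or_eq_neg_of_abs_eq hs1 with h | h
  · left
    rw [h] at key h0
    exact ⟨by simpa using key, by linarith⟩
  · right
    rw [h] at key h0
    exact ⟨by simpa using key, by linarith⟩

/-- The relative boundary of a convex subset of a hyperplane is a null set for the surface
measure. -/
theorem surf_flat_relBoundary (hd : 0 < d) {n : Vec d} (hn : ‖n‖ = 1) {a : ℝ} {S : Set (Vec d)}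
    (hS : S ⊆ flat n a) (hc : Convex ℝ S) :
    surf d {x ∈ S | ¬ ∃ ε > 0, flat n a ∩ Metric.ball x ε ⊆ S} = 0 := by
  obtain ⟨e, rfl⟩ : ∃ e, d = e + 1 := ⟨d - 1, by omega⟩
  obtain ⟨Λ, hJ, hr⟩ := exists_isometry_flat hn a
  set J : Vec e → Vec (e + 1) := fun z => a • n + Λ z with hJdef
  set R := {x ∈ S | ¬ ∃ ε > 0, flat n a ∩ Metric.ball x ε ⊆ S} with hR
  have hcJ : Convex ℝ (J ⁻¹' S) := by
    have : J ⁻¹' S = Λ.toLinearMap ⁻¹' ((fun x => a • n + x) ⁻¹' S) := rfl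
    rw [this]
    exact (hc.translate_preimage_right (a • n)).linear_preimage _
  have h1 : J ⁻¹' R ⊆ frontier (J ⁻¹' S) := by
    intro z hz
    refine ⟨subset_closure hz.1, fun hint => hz.2 ?_⟩
    obtain ⟨ε, hε, hb⟩ := Metric.mem_nhds_iff.1 (mem_interior_iff_mem_nhds.1 hint)
    refine ⟨ε, hε, ?_⟩
    rintro y ⟨hy1, hy2⟩
    rw [← hr] at hy1
    obtain ⟨w, rfl⟩ := hy1
    rw [Metric.mem_ball] at hy2
    have : w ∈ Metric.ball z ε := by
      rw [Metric.mem_ball, ← hJ.dist_eq]; exact hy2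
    exact hb this
  have h2 : volume (J ⁻¹' R) = 0 := measure_mono_null h1 (hcJ.addHaar_frontier volume)
  rwa [← EuclideanSpace.euclideanHausdorffMeasure_eq_volume, hJ.euclideanHausdorffMeasure_preimage,
      hr, inter_eq_left.2 ((sep_subset _ _).trans hS), ← surf_succ] at h2

/-! ### Cones over flat sets -/

/-- The open cone with apex `x₀` over `F`, without the apex and without `F` itself. -/
def cone (x₀ : Vec d) (F : Set (Vec d)) : Set (Vec d) :=
  (fun z : ℝ × Vec d => AffineMap.homothety x₀ z.1 z.2) '' (Ioo 0 1 ×ˢ F)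

theorem inner_homothety {n x₀ : Vec d} {a s : ℝ} {y : Vec d} (hy : y ∈ flat n a) :
    inner ℝ n (AffineMap.homothety x₀ s y - x₀) = s * (a - inner ℝ n x₀) := by
  have : inner ℝ n y = a := hy
  simp [AffineMap.homothety_apply, inner_smul_right, inner_sub_right, this]

theorem mem_cone_iff {n x₀ : Vec d} {a : ℝ} (h : inner ℝ n x₀ < a) {F : Set (Vec d)}
    (hF : F ⊆ flat n a) {x : Vec d} :
    x ∈ cone x₀ F ↔ inner ℝ n (x - x₀) ∈ Ioo 0 (a - inner ℝ n x₀) ∧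
      AffineMap.homothety x₀ ((a - inner ℝ n x₀) / inner ℝ n (x - x₀)) x ∈ F := by
  have hh : 0 < a - inner ℝ n x₀ := sub_pos.2 h
  constructor
  · rintro ⟨⟨s, y⟩, ⟨⟨hs0, hs1⟩, hy⟩, rfl⟩
    have e := inner_homothety (x₀ := x₀) (s := s) (hF hy)
    simp only
    rw [e]
    refine ⟨⟨mul_pos hs0 hh, by nlinarith⟩, ?_⟩
    have e2 : (a - inner ℝ n x₀) / (s * (a - inner ℝ n x₀)) = s⁻¹ := by field_simp
    rw [e2]
    simpa [AffineMap.homothety_apply, smul_smul, inv_mul_cancel₀ hs0.ne'] using hy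
  · rintro ⟨⟨h0, h1⟩, hx⟩
    refine ⟨(inner ℝ n (x - x₀) / (a - inner ℝ n x₀), _), ⟨⟨div_pos h0 hh, ?_⟩, hx⟩, ?_⟩
    · rwa [div_lt_one hh]
    · have : inner ℝ n (x - x₀) / (a - inner ℝ n x₀) * ((a - inner ℝ n x₀) / inner ℝ n (x - x₀)) = 1 := by
        field_simp
      simp [AffineMap.homothety_apply, smul_smul, this]

theorem measurable_homothety_prod (x₀ : Vec d) :
    Measurable (fun z : ℝ × Vec d => AffineMap.homothety x₀ z.1 z.2) := by
  simp only [AffineMap.homothety_apply, vsub_eq_sub, vadd_eq_add]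
  fun_prop

theorem measurableSet_cone {n x₀ : Vec d} {a : ℝ} (h : inner ℝ n x₀ < a) {F : Set (Vec d)}
    (hF : F ⊆ flat n a) (hm : MeasurableSet F) : MeasurableSet (cone x₀ F) := by
  have h1 : Measurable (fun x : Vec d => (inner ℝ n (x - x₀) : ℝ)) := by fun_prop
  have h2 : Measurable (fun x : Vec d =>
      AffineMap.homothety x₀ ((a - inner ℝ n x₀) / inner ℝ n (x - x₀)) x) :=
    (measurable_homothety_prod x₀).comp ((measurable_const.div h1).prodMk measurable_id)
  have : cone x₀ F = (fun x : Vec d => (inner ℝ n (x - x₀) : ℝ)) ⁻¹' Ioo 0 (a - inner ℝ n x₀) ∩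
      (fun x : Vec d =>
      AffineMap.homothety x₀ ((a - inner ℝ n x₀) / inner ℝ n (x - x₀)) x) ⁻¹' F := by
    ext x
    exact mem_cone_iff h hF
  rw [this]
  exact (h1 measurableSet_Ioo).inter (h2 hm)

/-- Volume of a piece of a cone, by slicing parallel to the base. -/
theorem volume_inter_cone {n x₀ : Vec d} (hn : ‖n‖ = 1) {a : ℝ}
    (h : inner ℝ n x₀ < a) {F : Set (Vec d)} (hF : F ⊆ flat n a) (hm : MeasurableSet F)
    {t : Set (Vec d)} (ht : MeasurableSet t) :
    volume (t ∩ cone x₀ F) = ENNReal.ofReal (a - inner ℝ n x₀) *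
      ∫⁻ s in Ioo (0 : ℝ) 1, ENNReal.ofReal (s ^ (d - 1)) *
        surf d (AffineMap.homothety x₀ s ⁻¹' t ∩ F) := by
  have hh : 0 < a - inner ℝ n x₀ := sub_pos.2 h
  set c : ℝ := a - inner ℝ n x₀ with hc
  have hv : c • n ≠ 0 := by
    rw [← norm_pos_iff, norm_smul, hn, Real.norm_eq_abs, abs_of_pos hh]; simpa using hh
  have hmt : MeasurableSet (t ∩ cone x₀ F) := ht.inter (measurableSet_cone h hF hm)
  have key := EuclideanGeometry.euclideanHausdorffMeasure_eq_lintegral x₀ hv hmt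
  rw [InnerProductSpace.euclideanHausdorffMeasure_eq_volume] at key
  rw [key]
  have e1 : ‖c • n‖ₑ = ENNReal.ofReal c := by
    rw [← ofReal_norm, norm_smul, hn, Real.norm_eq_abs, abs_of_pos hh, mul_one]
  rw [e1, ← lintegral_indicator measurableSet_Ioo]
  congr 1
  refine lintegral_congr fun s => ?_
  have hfr : Module.finrank ℝ (Vec d) - 1 = d - 1 := by simp
  rw [hfr]
  have hmem : ∀ x, x ∈ AffineSubspace.mk' (s • c • n +ᵥ x₀) (ℝ ∙ (c • n))ᗮ ↔
      inner ℝ n (x - x₀) = s * c := by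
    intro x
    rw [AffineSubspace.mem_mk', Submodule.mem_orthogonal_singleton_iff_inner_right, vsub_eq_sub,
      vadd_eq_add, inner_smul_left]
    have : x - (s • c • n + x₀) = (x - x₀) - (s * c) • n := by rw [mul_smul]; abel
    rw [this, inner_sub_right, inner_smul_right, real_inner_self_eq_norm_sq, hn]
    simp [hh.ne', sub_eq_zero]
  by_cases hs : s ∈ Ioo (0 : ℝ) 1
  · rw [indicator_of_mem hs]
    have himg : t ∩ cone x₀ F ∩ (AffineSubspace.mk' (s • c • n +ᵥ x₀) (ℝ ∙ (c • n))ᗮ : Set (Vec d)) =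
        AffineMap.homothety x₀ s '' (AffineMap.homothety x₀ s ⁻¹' t ∩ F) := by
      ext x
      constructor
      · rintro ⟨⟨hx1, ⟨⟨s', y⟩, ⟨hs', hy⟩, rfl⟩⟩, hx3⟩
        have h3 := (hmem _).1 hx3
        have h4 := inner_homothety (x₀ := x₀) (s := s') (hF hy)
        rw [h4] at h3
        have h5 : s' = s := mul_right_cancel₀ hh.ne' h3
        subst h5
        exact ⟨y, ⟨hx1, hy⟩, rfl⟩
      · rintro ⟨y, ⟨hy1, hy2⟩, rfl⟩
        exact ⟨⟨hy1, ⟨(s, y), ⟨hs, hy2⟩, rfl⟩⟩, (hmem _).2 (inner_homothety (hF hy2))⟩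
    rw [himg, euclideanHausdorffMeasure_homothety_image _ _ hs.1.ne']
    rw [ENNReal.ofReal_pow hs.1.le, ENNReal.smul_def, smul_eq_mul, surf]
    congr 2
    rw [Real.toNNReal_of_nonneg hs.1.le]
    congr 1
    exact NNReal.eq (Real.norm_of_nonneg hs.1.le)
  · rw [indicator_of_notMem hs]
    have : t ∩ cone x₀ F ∩ (AffineSubspace.mk' (s • c • n +ᵥ x₀) (ℝ ∙ (c • n))ᗮ : Set (Vec d)) = ∅ := by
      rw [eq_empty_iff_forall_notMem]
      rintro x ⟨⟨hx1, ⟨⟨s', y⟩, ⟨hs', hy⟩, rfl⟩⟩, hx3⟩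
      have h3 := (hmem _).1 hx3
      have h4 := inner_homothety (x₀ := x₀) (s := s') (hF hy)
      rw [h4] at h3
      have h5 : s' = s := mul_right_cancel₀ hh.ne' h3
      subst h5
      exact hs hs'
    rw [this, measure_empty]

theorem volume_cone_eq_zero {n x₀ : Vec d} (hn : ‖n‖ = 1) {a : ℝ}
    (h : inner ℝ n x₀ < a) {F : Set (Vec d)} (hF : F ⊆ flat n a) (h0 : surf d F = 0) :
    volume (cone x₀ F) = 0 := by
  obtain ⟨G, hFG, hG, hG0⟩ := exists_measurable_superset_of_null h0
  have hm : MeasurableSet (G ∩ flat n a) := hG.inter (isClosed_flat n a).measurableSet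
  have hsub : cone x₀ F ⊆ univ ∩ cone x₀ (G ∩ flat n a) := by
    rw [univ_inter]
    exact image_mono (prod_mono_right (subset_inter hFG hF))
  refine measure_mono_null hsub ?_
  rw [volume_inter_cone hn h inter_subset_right hm MeasurableSet.univ]
  have : ∀ s : ℝ, surf d (AffineMap.homothety x₀ s ⁻¹' univ ∩ (G ∩ flat n a)) = 0 := fun s =>
    measure_mono_null (inter_subset_right.trans inter_subset_left) hG0
  simp only [this, mul_zero, lintegral_zero]

/-- Volume integrals over a cone in terms of surface integrals over its base. -/
theorem integral_cone (hd : 0 < d) {n x₀ : Vec d} (hn : ‖n‖ = 1) {a : ℝ}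
    (h : inner ℝ n x₀ < a) {F : Set (Vec d)} (hF : F ⊆ flat n a) (hm : IsCompact F)
    {G : Vec d → ℝ} (hG : Continuous G) :
    ∫ x in cone x₀ F, G x = (a - inner ℝ n x₀) *
      ∫ y in F, (∫ s in (0 : ℝ)..1, s ^ (d - 1) * G (AffineMap.homothety x₀ s y)) ∂surf d := by
  have hh : 0 < a - inner ℝ n x₀ := sub_pos.2 h
  set c : ℝ := a - inner ℝ n x₀ with hc
  have hfin : surf d F ≠ ⊤ := surf_flat_inter_ne_top hd hn hF hm.isBounded
  have : IsFiniteMeasure ((surf d).restrict F) := ⟨by simpa using hfin.lt_top⟩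
  let Φ : ℝ × Vec d → Vec d := fun z => AffineMap.homothety x₀ z.1 z.2
  have hΦ : Measurable Φ := measurable_homothety_prod x₀
  have hΦc : Continuous Φ := by
    simp only [Φ, AffineMap.homothety_apply, vsub_eq_sub, vadd_eq_add]
    fun_prop
  let w : ℝ → ℝ≥0∞ := fun s => ENNReal.ofReal (s ^ (d - 1))
  have hw : Measurable w := by fun_prop
  let ν : Measure ℝ := (volume.restrict (Ioo (0 : ℝ) 1)).withDensity w
  -- polar coordinates on the cone, with density `s ^ (d - 1)`
  have hmap : volume.restrict (cone x₀ F) =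
      ENNReal.ofReal c • Measure.map Φ (ν.prod ((surf d).restrict F)) := by
    ext t ht
    rw [Measure.restrict_apply ht, volume_inter_cone hn h hF hm.measurableSet ht,
      Measure.smul_apply, Measure.map_apply hΦ ht, Measure.prod_apply (hΦ ht),
      lintegral_withDensity_eq_lintegral_mul _ hw
        (measurable_measure_prodMk_left (hΦ ht)), smul_eq_mul]
    congr 1
    refine lintegral_congr fun s => ?_
    simp only [Pi.mul_apply]
    congr 1
    have hs : MeasurableSet (Prod.mk s ⁻¹' (Φ ⁻¹' t)) := measurable_prodMk_left (hΦ ht)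
    rw [Measure.restrict_apply hs]
    rfl
  have hmem : ∀ᵐ z ∂((volume.restrict (Ioo (0 : ℝ) 1)).prod ((surf d).restrict F)),
      z.1 ∈ Ioo (0 : ℝ) 1 ∧ z.2 ∈ F :=
    (Measure.quasiMeasurePreserving_fst.ae (ae_restrict_mem measurableSet_Ioo)).and
      (Measure.quasiMeasurePreserving_snd.ae (ae_restrict_mem hm.measurableSet))
  have hint : Integrable (fun z : ℝ × Vec d => z.1 ^ (d - 1) * G (Φ z))
      ((volume.restrict (Ioo (0 : ℝ) 1)).prod ((surf d).restrict F)) := by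
    have hcont : Continuous (fun z : ℝ × Vec d => z.1 ^ (d - 1) * G (Φ z)) := by fun_prop
    obtain ⟨C, hC⟩ := (isCompact_Icc.prod hm : IsCompact (Icc (0 : ℝ) 1 ×ˢ F)).exists_bound_of_continuousOn
      hcont.continuousOn
    refine Integrable.of_bound hcont.aestronglyMeasurable C ?_
    filter_upwards [hmem] with z hz
    exact hC z ⟨Ioo_subset_Icc_self hz.1, hz.2⟩
  rw [hmap, integral_smul_measure, ENNReal.toReal_ofReal hh.le, smul_eq_mul,
    integral_map hΦ.aemeasurable hG.aestronglyMeasurable]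
  congr 1
  have hprod : ν.prod ((surf d).restrict F) =
      ((volume.restrict (Ioo (0 : ℝ) 1)).prod ((surf d).restrict F)).withDensity (fun z => w z.1) := by
    simpa using (prod_withDensity_left (μ := volume.restrict (Ioo (0 : ℝ) 1))
      (ν := (surf d).restrict F) hw)
  have hlt : ∀ᵐ z ∂((volume.restrict (Ioo (0 : ℝ) 1)).prod ((surf d).restrict F)), w z.1 < ⊤ :=
    Eventually.of_forall fun z => ENNReal.ofReal_lt_top
  rw [hprod, integral_withDensity_eq_integral_toReal_smul (by fun_prop) hlt]
  have hcongr : ∫ z, (w z.1).toReal • G (Φ z) ∂((volume.restrict (Ioo (0 : ℝ) 1)).prod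
      ((surf d).restrict F)) = ∫ z, z.1 ^ (d - 1) * G (Φ z) ∂((volume.restrict (Ioo (0 : ℝ) 1)).prod
      ((surf d).restrict F)) := by
    refine integral_congr_ae ?_
    filter_upwards [hmem] with z hz
    have : 0 ≤ z.1 ^ (d - 1) := pow_nonneg hz.1.1.le _
    simp [w, ENNReal.toReal_ofReal this]
  rw [hcongr, integral_prod_symm _ hint]
  refine integral_congr_ae (Eventually.of_forall fun y => ?_)
  simp only
  rw [intervalIntegral.integral_of_le zero_le_one, integral_Ioc_eq_integral_Ioo]

end HDG

namespace HDG
variable {d : ℕ}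

/-! ### Convex bodies and their exposed faces -/

/-- The face of `K` on which the linear form `⟨n, ·⟩` is maximal. -/
def exposedFace (n : Vec d) (K : Set (Vec d)) : Set (Vec d) :=
  {x ∈ K | ∀ y ∈ K, inner ℝ n (y - x) ≤ 0}

theorem exposedFace_subset (n : Vec d) (K : Set (Vec d)) : exposedFace n K ⊆ K := sep_subset _ _

theorem isExposed_exposedFace (n : Vec d) (K : Set (Vec d)) : IsExposed ℝ K (exposedFace n K) := by
  intro _
  refine ⟨innerSL ℝ n, ?_⟩
  ext x
  simp [exposedFace, inner_sub_right]

theorem exists_exposedFace_eq {n : Vec d} {K : Set (Vec d)} (h : (exposedFace n K).Nonempty) :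
    ∃ a, (∀ y ∈ K, inner ℝ n y ≤ a) ∧ exposedFace n K = K ∩ flat n a := by
  obtain ⟨x, hx, hxy⟩ := h
  have h1 : ∀ y ∈ K, inner ℝ n y ≤ (inner ℝ n x : ℝ) := fun y hy => by
    have := hxy y hy
    rw [inner_sub_right] at this
    linarith
  refine ⟨inner ℝ n x, h1, ?_⟩
  ext z
  constructor
  · rintro ⟨hz, hzy⟩
    refine ⟨hz, le_antisymm (h1 z hz) ?_⟩
    have := hzy x hx
    rw [inner_sub_right] at this
    linarith
  · rintro ⟨hz, hz2⟩
    refine ⟨hz, fun y hy => ?_⟩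
    rw [inner_sub_right]
    have := h1 y hy
    have : inner ℝ n z = (inner ℝ n x : ℝ) := hz2
    linarith [h1 y hy]

theorem isClosed_exposedFace (n : Vec d) {K : Set (Vec d)} (hK : IsClosed K) :
    IsClosed (exposedFace n K) := by
  rcases (exposedFace n K).eq_empty_or_nonempty with h | h
  · rw [h]; exact isClosed_empty
  · obtain ⟨a, -, he⟩ := exists_exposedFace_eq h
    rw [he]
    exact hK.inter (isClosed_flat n a)

/-- A polytope has finitely many exposed faces: each is the convex hull of its extreme points, which
are vertices of the polytope. -/
theorem finite_exposedFaces {V : Set (Vec d)} (hV : V.Finite) :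
    {E | ∃ n, E = exposedFace n (convexHull ℝ V)}.Finite := by
  have hcpt : IsCompact (convexHull ℝ V) := hV.isCompact_convexHull ℝ
  refine Set.Finite.of_finite_image (f := fun E => E.extremePoints ℝ) (hV.finite_subsets.subset ?_) ?_
  · rintro _ ⟨_, ⟨n, rfl⟩, rfl⟩
    exact ((isExposed_exposedFace n _).isExtreme.extremePoints_subset_extremePoints).trans
      extremePoints_convexHull_subset
  · rintro _ ⟨n, rfl⟩ _ ⟨n', rfl⟩ h
    have key : ∀ n : Vec d, closure (convexHull ℝ ((exposedFace n (convexHull ℝ V)).extremePoints ℝ)) =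
        exposedFace n (convexHull ℝ V) := fun n =>
      closure_convexHull_extremePoints
        ((isExposed_exposedFace n _).isCompact hcpt)
        ((isExposed_exposedFace n _).convex (convex_convexHull ℝ V))
    have h' : (exposedFace n (convexHull ℝ V)).extremePoints ℝ =
      (exposedFace n' (convexHull ℝ V)).extremePoints ℝ := h
    rw [← key n, ← key n', h']

theorem exists_unit_of_dual {f : StrongDual ℝ (Vec d)} (hf : f ≠ 0) :
    ∃ (n : Vec d) (c : ℝ), ‖n‖ = 1 ∧ 0 < c ∧ ∀ x, inner ℝ n x = c * f x := by
  set m := (InnerProductSpace.toDual ℝ (Vec d)).symm f with hm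
  have hm0 : m ≠ 0 := by simpa [hm] using hf
  refine ⟨‖m‖⁻¹ • m, ‖m‖⁻¹, ?_, by positivity, fun x => ?_⟩
  · rw [norm_smul, norm_inv, norm_norm, inv_mul_cancel₀ (norm_ne_zero_iff.2 hm0)]
  · rw [inner_smul_left, hm, InnerProductSpace.toDual_symm_apply]
    simp

theorem exists_mem_exposedFace {K : Set (Vec d)} (hc : Convex ℝ K) (hcl : IsClosed K)
    (hi : (interior K).Nonempty) {x : Vec d} (hx : x ∈ frontier K) :
    ∃ n : Vec d, ‖n‖ = 1 ∧ x ∈ exposedFace n K := by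
  obtain ⟨f, hf⟩ := geometric_hahn_banach_open_point hc.interior isOpen_interior hx.2
  have hf0 : f ≠ 0 := by
    rintro rfl
    obtain ⟨z, hz⟩ := hi
    simpa using hf z hz
  obtain ⟨n, c, hn, hc0, hnf⟩ := exists_unit_of_dual hf0
  refine ⟨n, hn, hcl.closure_eq ▸ hx.1, fun y hy => ?_⟩
  have hy' : y ∈ closure (interior K) := by
    rw [hc.closure_interior_eq_closure_of_nonempty_interior hi]
    exact subset_closure hy
  have : f y ≤ f x := by
    have hsub : closure (interior K) ⊆ {y | f y ≤ f x} :=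
      closure_minimal (fun a ha => (hf a ha).le) (isClosed_le f.continuous continuous_const)
    exact hsub hy'
  rw [hnf, map_sub]
  nlinarith

/-- Convex bodies with disjoint interiors are separated by a hyperplane. -/
theorem exists_separating_flat {K K' : Set (Vec d)} (hc : Convex ℝ K) (hc' : Convex ℝ K')
    (hi : (interior K).Nonempty) (hi' : (interior K').Nonempty)
    (hdisj : Disjoint (interior K) (interior K')) :
    ∃ (n : Vec d) (a : ℝ), ‖n‖ = 1 ∧ (∀ x ∈ K, inner ℝ n x ≤ a) ∧ ∀ x ∈ K', a ≤ inner ℝ n x := by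
  obtain ⟨f, u, hf0, h1, h2⟩ := geometric_hahn_banach_of_nonempty_interior hc hc'.interior hdisj hi hi'
  obtain ⟨n, c, hn, hc0, hnf⟩ := exists_unit_of_dual hf0
  refine ⟨n, c * u, hn, fun x hx => ?_, fun x hx => ?_⟩
  · rw [hnf]; exact mul_le_mul_of_nonneg_left (h1 x hx) hc0.le
  · rw [hnf]
    refine mul_le_mul_of_nonneg_left ?_ hc0.le
    have hy' : x ∈ closure (interior K') := by
      rw [hc'.closure_interior_eq_closure_of_nonempty_interior hi']
      exact subset_closure hx
    have hsub : closure (interior K') ⊆ {y | u ≤ f y} :=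
      closure_minimal (fun a ha => h2 a ha) (isClosed_le continuous_const f.continuous)
    exact hsub hy'

theorem inner_lt_of_mem_interior {K : Set (Vec d)} {n : Vec d} {a : ℝ} (hn : ‖n‖ = 1)
    (h : ∀ y ∈ K, inner ℝ n y ≤ a) {z : Vec d} (hz : z ∈ interior K) : inner ℝ n z < a := by
  obtain ⟨ε, hε, hb⟩ := Metric.mem_nhds_iff.1 (mem_interior_iff_mem_nhds.1 hz)
  have h1 : z + (ε / 2) • n ∈ K := by
    apply hb
    rw [Metric.mem_ball, dist_eq_norm, add_sub_cancel_left, norm_smul, hn, Real.norm_eq_abs,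
      abs_of_pos (by positivity)]
    linarith
  have h2 := h _ h1
  rw [inner_add_right, inner_smul_right, real_inner_self_eq_norm_sq, hn] at h2
  linarith

theorem false_of_subset_flat {K : Set (Vec d)} (hi : (interior K).Nonempty) {n : Vec d} (hn : ‖n‖ = 1)
    {a : ℝ} (h1 : ∀ y ∈ K, inner ℝ n y ≤ a) (h2 : ∀ y ∈ K, a ≤ inner ℝ n y) : False := by
  obtain ⟨z, hz⟩ := hi
  exact absurd (h2 z (interior_subset hz)) (not_le.2 (inner_lt_of_mem_interior hn h1 hz))

/-- Three convex bodies with disjoint interiors do not share a set of positive surface measure. -/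
theorem surf_inter_three (hd : 0 < d) {K₁ K₂ K₃ : Set (Vec d)}
    (hc₁ : Convex ℝ K₁) (hc₂ : Convex ℝ K₂) (hc₃ : Convex ℝ K₃)
    (hi₁ : (interior K₁).Nonempty) (hi₂ : (interior K₂).Nonempty) (hi₃ : (interior K₃).Nonempty)
    (h₁₂ : Disjoint (interior K₁) (interior K₂)) (h₁₃ : Disjoint (interior K₁) (interior K₃))
    (h₂₃ : Disjoint (interior K₂) (interior K₃)) : surf d (K₁ ∩ K₂ ∩ K₃) = 0 := by
  by_contra hne
  have hpos : 0 < surf d (K₁ ∩ K₂ ∩ K₃) := pos_iff_ne_zero.2 hne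
  obtain ⟨n, a, hn, ha1, ha2⟩ := exists_separating_flat hc₁ hc₂ hi₁ hi₂ h₁₂
  obtain ⟨n', a', hn', ha1', ha3'⟩ := exists_separating_flat hc₁ hc₃ hi₁ hi₃ h₁₃
  obtain ⟨m, b, hm, hb2, hb3⟩ := exists_separating_flat hc₂ hc₃ hi₂ hi₃ h₂₃
  have f1 : K₁ ∩ K₂ ∩ K₃ ⊆ flat n a := fun x hx => le_antisymm (ha1 x hx.1.1) (ha2 x hx.1.2)
  have f2 : K₁ ∩ K₂ ∩ K₃ ⊆ flat n' a' := fun x hx => le_antisymm (ha1' x hx.1.1) (ha3' x hx.2)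
  have f3 : K₁ ∩ K₂ ∩ K₃ ⊆ flat m b := fun x hx => le_antisymm (hb2 x hx.1.2) (hb3 x hx.2)
  rcases flat_eq_of_surf_pos hd hn hn' f1 f2 hpos with ⟨rfl, rfl⟩ | ⟨rfl, rfl⟩
  · rcases flat_eq_of_surf_pos hd hn hm f1 f3 hpos with ⟨rfl, rfl⟩ | ⟨rfl, rfl⟩
    · exact false_of_subset_flat hi₂ hn hb2 ha2
    · refine false_of_subset_flat hi₃ hn (fun y hy => ?_) ha3'
      have := hb3 y hy
      rw [inner_neg_left] at this
      linarith
  · refine false_of_subset_flat hi₁ hn ha1 (fun y hy => ?_)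
    have := ha1' y hy
    rw [inner_neg_left] at this
    linarith

/-- Near a point `x` of the relative interior of a facet, `K` contains one side of the hyperplane. -/
theorem eventually_mem_of_flat {K : Set (Vec d)} (hc : Convex ℝ K) {n : Vec d} {a : ℝ}
    {z : Vec d} (hz : z ∈ K) (hza : inner ℝ n z < a) {x : Vec d} (hx : inner ℝ n x = a) {ε : ℝ}
    (hε : 0 < ε) (hsub : flat n a ∩ Metric.ball x ε ⊆ K) :
    ∀ᶠ y in 𝓝 x, inner ℝ n y ≤ a → y ∈ K := by
  have hpos : 0 < a - inner ℝ n z := sub_pos.2 hza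
  -- `y` is a convex combination of `z` and the projection of `y` from `z` to the hyperplane
  let t : Vec d → ℝ := fun y => (a - inner ℝ n y) / (a - inner ℝ n z)
  have ht : Continuous t := by
    apply Continuous.div_const
    fun_prop
  have htx : t x = 0 := by simp [t, hx]
  let π : Vec d → Vec d := fun y => y + (t y / (1 - t y)) • (y - z)
  have hπ : ContinuousAt π x := by
    have h1 : 1 - t x ≠ 0 := by rw [htx]; norm_num
    have h2 : ContinuousAt (fun y => t y / (1 - t y)) x :=
      ht.continuousAt.div (continuousAt_const.sub ht.continuousAt) h1
    exact continuousAt_id.add (h2.smul (continuousAt_id.sub continuousAt_const))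
  have hπx : π x = x := by simp [π, htx]
  have e1 : ∀ᶠ y in 𝓝 x, π y ∈ Metric.ball x ε := by
    apply hπ.eventually
    rw [hπx]
    exact Metric.ball_mem_nhds x hε
  have e2 : ∀ᶠ y in 𝓝 x, t y < 1 := by
    exact ht.continuousAt.eventually_lt_const (by rw [htx]; exact one_pos)
  filter_upwards [e1, e2] with y h1 h2 hy
  have ht0 : 0 ≤ t y := div_nonneg (by linarith) hpos.le
  have h1t : 0 < 1 - t y := by linarith
  have hflat : π y ∈ flat n a := by
    have : t y * (a - inner ℝ n z) = a - inner ℝ n y := div_mul_cancel₀ _ hpos.ne'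
    simp only [π, flat, mem_ofPred_eq, inner_add_right, inner_smul_right, inner_sub_right]
    field_simp
    linarith
  have hcomb : y = (1 - t y) • π y + t y • z := by
    have : (1 - t y) • π y = (1 - t y) • y + t y • (y - z) := by
      simp only [π, smul_add, smul_smul]
      congr 2
      field_simp
    rw [this]
    module
  rw [hcomb]
  exact hc (hsub ⟨hflat, h1⟩) hz h1t.le ht0 (by ring)

/-- Almost every point common to two convex bodies on different sides of a hyperplane is interior to
their union. -/
theorem surf_inter_diff_interior_union (hd : 0 < d) {K K' : Set (Vec d)}
    (hc : Convex ℝ K) (hc' : Convex ℝ K') (hi : (interior K).Nonempty) (hi' : (interior K').Nonempty)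
    (hdisj : Disjoint (interior K) (interior K')) :
    surf d {x ∈ K ∩ K' | x ∉ interior (K ∪ K')} = 0 := by
  obtain ⟨n, a, hn, h1, h2⟩ := exists_separating_flat hc hc' hi hi' hdisj
  have hflat : K ∩ K' ⊆ flat n a := fun x hx => le_antisymm (h1 x hx.1) (h2 x hx.2)
  refine measure_mono_null ?_ (surf_flat_relBoundary hd hn hflat (hc.inter hc'))
  rintro x ⟨hx, hxi⟩
  refine ⟨hx, ?_⟩
  rintro ⟨ε, hε, hsub⟩
  apply hxi
  obtain ⟨z, hz⟩ := hi
  obtain ⟨z', hz'⟩ := hi'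
  have hza := inner_lt_of_mem_interior hn h1 hz
  have hza' : inner ℝ (-n) z' < -a := by
    refine inner_lt_of_mem_interior (K := K') (by simpa using hn) (fun y hy => ?_) hz'
    rw [inner_neg_left]
    linarith [h2 y hy]
  have e1 := eventually_mem_of_flat hc (interior_subset hz) hza (hflat hx) hε
    (hsub.trans inter_subset_left)
  have e2 := eventually_mem_of_flat (n := -n) (a := -a) hc' (interior_subset hz') hza' (x := x)
    (by rw [inner_neg_left]; exact congrArg Neg.neg (hflat hx)) hε (by
      rintro y ⟨hy, hyb⟩
      refine (hsub ⟨?_, hyb⟩).2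
      simp only [flat, mem_ofPred_eq, inner_neg_left] at hy ⊢
      linarith)
  rw [mem_interior_iff_mem_nhds]
  filter_upwards [e1, e2] with y h1 h2
  rcases le_total (inner ℝ n y) a with h | h
  · exact Or.inl (h1 h)
  · refine Or.inr (h2 ?_)
    rw [inner_neg_left]
    linarith

/-! ### Mesh elements -/

theorem exists_finite_of_isSimplex {K : Set (Vec d)} (h : IsSimplex d K) :
    ∃ V : Set (Vec d), V.Finite ∧ K = convexHull ℝ V ∧ (interior K).Nonempty := by
  obtain ⟨v, hv, rfl⟩ := h
  refine ⟨range v, finite_range v, rfl, ?_⟩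
  rw [interior_convexHull_nonempty_iff_affineSpan_eq_top,
    hv.affineSpan_eq_top_iff_card_eq_finrank_add_one]
  simp

theorem exists_finite_of_isQuadrilateral {K : Set (Vec d)} (hd : d = 2) (h : IsQuadrilateral K) :
    ∃ V : Set (Vec d), V.Finite ∧ K = convexHull ℝ V ∧ (interior K).Nonempty := by
  obtain ⟨v, hv, rfl⟩ := h
  refine ⟨range v, finite_range v, rfl, ?_⟩
  rw [interior_convexHull_nonempty_iff_affineSpan_eq_top]
  by_contra hne
  have hcol : Collinear ℝ (range v) := by
    rw [collinear_iff_finrank_le_one]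
    have h1 : vectorSpan ℝ (range v) ≠ ⊤ := by
      intro h
      exact hne ((AffineSubspace.affineSpan_eq_top_iff_vectorSpan_eq_top_of_nonempty ℝ _ _
        (range_nonempty v)).2 h)
    have h2 := Submodule.finrank_lt h1
    have h3 : Module.finrank ℝ (Vec d) = d := by simp
    omega
  have hsub : Collinear ℝ {v 0, v 1, v 2} := by
    apply hcol.subset
    rintro x (rfl | rfl | rfl) <;> exact mem_range_self _
  -- no vertex lies between two others
  have key : ∀ i j k : Fin 4, i ≠ j → j ≠ k → ¬ Wbtw ℝ (v i) (v j) (v k) := by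
    intro i j k hij hjk hw
    have h1 := mem_segment_iff_wbtw.2 hw
    have h2 : v j ∈ convexHull ℝ (v '' {i, k}) := by
      rw [image_pair, convexHull_pair]
      exact h1
    have h3 : j ∈ ({i, k} : Set (Fin 4)) := hv _ _ h2
    rcases h3 with h3 | h3
    · exact hij h3.symm
    · exact hjk h3
  rcases hsub.wbtw_or_wbtw_or_wbtw with h | h | h
  · exact key 0 1 2 (by decide) (by decide) h
  · exact key 1 2 0 (by decide) (by decide) h
  · exact key 2 0 1 (by decide) (by decide) h

open scoped Pointwise in
theorem exists_finite_of_isParallelepiped {K : Set (Vec d)} (h : IsParallelepiped K) :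
    ∃ V : Set (Vec d), V.Finite ∧ K = convexHull ℝ V ∧ (interior K).Nonempty := by
  obtain ⟨a, e, he, rfl⟩ := h
  have himg : (fun x => a + x) '' parallelepiped e = convexHull ℝ ((fun x => a + x) ''
      (∑ i, {0, e i} : Set (Vec d))) := by
    rw [parallelepiped_eq_convexHull]
    exact ((AffineEquiv.constVAdd ℝ (Vec d) a).toAffineMap.image_convexHull _)
  refine ⟨_, ?_, himg, ?_⟩
  · apply Set.Finite.image
    classical
    have : ∀ s : Finset (Fin d), (∑ i ∈ s, ({0, e i} : Set (Vec d))).Finite := by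
      intro s
      induction s using Finset.induction_on with
      | empty => simp
      | insert i s hi ih =>
        rw [Finset.sum_insert hi]
        exact Set.Finite.add (by simp) ih
    exact this Finset.univ
  · have hcard : Fintype.card (Fin d) = Module.finrank ℝ (Vec d) := by simp
    have h1 : (interior (parallelepiped e)).Nonempty := by
      rcases Nat.eq_zero_or_pos d with rfl | hd
      · refine ⟨0, ?_⟩
        have : parallelepiped e = univ := by
          ext x
          simp only [mem_univ, iff_true, parallelepiped, mem_image]
          exact ⟨0, by simp, Subsingleton.elim _ _⟩
        simp [this]
      · have : Nonempty (Fin d) := ⟨⟨0, hd⟩⟩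
        have := (basisOfLinearIndependentOfCardEqFinrank he hcard).parallelepiped.interior_nonempty
        simpa using this
    have : interior ((fun x => a + x) '' parallelepiped e) = (fun x => a + x) '' interior (parallelepiped e) :=
      ((Homeomorph.addLeft a).image_interior _).symm
    rw [this]
    exact h1.image _

theorem IsElement.exists_finite {K : Set (Vec d)} (h : IsElement K) :
    ∃ V : Set (Vec d), V.Finite ∧ K = convexHull ℝ V ∧ (interior K).Nonempty := by
  rcases h with h | ⟨hd, h⟩ | ⟨-, h⟩
  · exact exists_finite_of_isSimplex h
  · exact exists_finite_of_isQuadrilateral hd h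
  · exact exists_finite_of_isParallelepiped h

theorem IsElement.convex {K : Set (Vec d)} (h : IsElement K) : Convex ℝ K := by
  obtain ⟨V, -, rfl, -⟩ := h.exists_finite
  exact convex_convexHull ℝ V

theorem IsElement.isCompact {K : Set (Vec d)} (h : IsElement K) : IsCompact K := by
  obtain ⟨V, hV, rfl, -⟩ := h.exists_finite
  exact hV.isCompact_convexHull ℝ

theorem IsElement.nonempty_interior {K : Set (Vec d)} (h : IsElement K) : (interior K).Nonempty := by
  obtain ⟨V, hV, hK, h⟩ := h.exists_finite
  exact h

theorem IsElement.finite_exposedFaces {K : Set (Vec d)} (h : IsElement K) :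
    {E | ∃ n, E = exposedFace n K}.Finite := by
  obtain ⟨V, hV, rfl, -⟩ := h.exists_finite
  exact HDG.finite_exposedFaces hV

end HDG

namespace HDG
variable {d : ℕ} {Ω : Set (Vec d)}

/-! ### Faces of a mesh -/

namespace Mesh
variable (𝓣 : Mesh Ω) {K K' F F' : Set (Vec d)}

theorem subset_closure (hK : K ∈ 𝓣.elems) : K ⊆ closure Ω := by
  rw [← 𝓣.cover]
  exact subset_biUnion_of_mem (u := fun K => K) hK

theorem interior_union_subset (hΩ : IsPolyDomain Ω) (hK : K ∈ 𝓣.elems) (hK' : K' ∈ 𝓣.elems) :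
    interior (K ∪ K') ⊆ Ω := by
  have := interior_mono (union_subset (𝓣.subset_closure hK) (𝓣.subset_closure hK'))
  rwa [hΩ.interior_closure] at this

theorem interior_subset (hΩ : IsPolyDomain Ω) (hK : K ∈ 𝓣.elems) : interior K ⊆ Ω := by
  simpa using 𝓣.interior_union_subset hΩ hK hK

/-- A face between two elements does not lie on the boundary of the domain: almost every point common to
two elements is interior to their union, hence a point of `Ω = interior (closure Ω)`. -/
theorem surf_inter_frontier (hd : 0 < d) (hΩ : IsPolyDomain Ω) (hK : K ∈ 𝓣.elems)
    (hK' : K' ∈ 𝓣.elems) (hne : K ≠ K') : surf d (K ∩ K' ∩ frontier Ω) = 0 := by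
  have h := 𝓣.isElement K hK
  have h' := 𝓣.isElement K' hK'
  refine measure_mono_null ?_ (surf_inter_diff_interior_union hd h.convex h'.convex h.nonempty_interior
    h'.nonempty_interior (𝓣.disjoint K hK K' hK' hne))
  rintro x ⟨hx, hf⟩
  refine ⟨hx, fun hi => ?_⟩
  rw [hΩ.isOpen.frontier_eq] at hf
  exact hf.2 (𝓣.interior_union_subset hΩ hK hK' hi)

theorem surf_inter_inter (hd : 0 < d) {K₁ K₂ K₃ : Set (Vec d)} (h₁ : K₁ ∈ 𝓣.elems)
    (h₂ : K₂ ∈ 𝓣.elems) (h₃ : K₃ ∈ 𝓣.elems) (h₁₂ : K₁ ≠ K₂) (h₁₃ : K₁ ≠ K₃) (h₂₃ : K₂ ≠ K₃) :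
    surf d (K₁ ∩ K₂ ∩ K₃) = 0 :=
  surf_inter_three hd (𝓣.isElement _ h₁).convex (𝓣.isElement _ h₂).convex (𝓣.isElement _ h₃).convex
    (𝓣.isElement _ h₁).nonempty_interior (𝓣.isElement _ h₂).nonempty_interior
    (𝓣.isElement _ h₃).nonempty_interior (𝓣.disjoint _ h₁ _ h₂ h₁₂) (𝓣.disjoint _ h₁ _ h₃ h₁₃)
    (𝓣.disjoint _ h₂ _ h₃ h₂₃)

theorem surf_pos_of_mem_faces (hF : F ∈ 𝓣.faces) : 0 < surf d F := by
  rcases hF with hF | hF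
  · exact hF.1
  · exact hF.1

theorem isCompact_of_mem_faces (hF : F ∈ 𝓣.faces) : IsCompact F := by
  rcases hF with ⟨-, K, hK, K', hK', -, rfl⟩ | ⟨-, K, hK, G, ⟨-, n, -, rfl⟩, rfl⟩
  · exact (𝓣.isElement K hK).isCompact.inter (𝓣.isElement K' hK').isCompact
  · have hc := (𝓣.isElement K hK).isCompact
    exact (hc.of_isClosed_subset (isClosed_exposedFace n hc.isClosed)
      (exposedFace_subset n K)).inter_right isClosed_frontier

theorem exists_subset_of_mem_faces (hF : F ∈ 𝓣.faces) : ∃ K ∈ 𝓣.elems, F ⊆ K := by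
  rcases hF with ⟨-, K, hK, K', hK', -, rfl⟩ | ⟨-, K, hK, G, ⟨-, n, -, rfl⟩, rfl⟩
  · exact ⟨K, hK, inter_subset_left⟩
  · exact ⟨K, hK, inter_subset_left.trans (exposedFace_subset n K)⟩

theorem finite_faces : 𝓣.faces.Finite := by
  refine Set.Finite.union ?_ ?_
  · refine (((𝓣.elems.finite_toSet).prod 𝓣.elems.finite_toSet).image (fun z => z.1 ∩ z.2)).subset ?_
    rintro F ⟨-, K, hK, K', hK', -, rfl⟩
    exact ⟨(K, K'), ⟨hK, hK'⟩, rfl⟩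
  · have : (⋃ K ∈ (𝓣.elems : Set (Set (Vec d))),
        (fun G => G ∩ frontier Ω) '' {E | ∃ n, E = exposedFace n K}).Finite :=
      𝓣.elems.finite_toSet.biUnion fun K hK =>
        ((𝓣.isElement K hK).finite_exposedFaces).image _
    refine this.subset ?_
    rintro F ⟨-, K, hK, G, ⟨-, n, -, rfl⟩, rfl⟩
    exact mem_biUnion hK ⟨_, ⟨n, rfl⟩, rfl⟩

theorem finite_facesOf : (𝓣.facesOf K).Finite := 𝓣.finite_faces.subset (sep_subset _ _)

/-- A face contained in two elements is their intersection. -/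
theorem eq_inter_of_subset (hd : 0 < d) (hΩ : IsPolyDomain Ω) (hF : F ∈ 𝓣.faces)
    (hK : K ∈ 𝓣.elems) (hK' : K' ∈ 𝓣.elems) (hne : K ≠ K') (h : F ⊆ K) (h' : F ⊆ K') :
    F = K ∩ K' ∧ F ∉ boundaryFaces Ω 𝓣.elems := by
  have hpos := 𝓣.surf_pos_of_mem_faces hF
  have hb : F ∉ boundaryFaces Ω 𝓣.elems := by
    rintro ⟨-, L, hL, G, -, rfl⟩
    exact hpos.ne' (measure_mono_null (subset_inter (subset_inter h h') inter_subset_right)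
      (𝓣.surf_inter_frontier hd hΩ hK hK' hne))
  refine ⟨?_, hb⟩
  rcases hF with ⟨-, K₁, hK₁, K₂, hK₂, hne₁₂, rfl⟩ | hF
  · have key : ∀ L ∈ 𝓣.elems, K₁ ∩ K₂ ⊆ L → L = K₁ ∨ L = K₂ := by
      intro L hL hsub
      by_contra! hcon
      exact hpos.ne' (measure_mono_null (subset_inter Subset.rfl hsub)
        (𝓣.surf_inter_inter hd hK₁ hK₂ hL hne₁₂ hcon.1.symm hcon.2.symm))
    rcases key K hK h with rfl | rfl <;> rcases key K' hK' h' with rfl | rfl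
    · exact absurd rfl hne
    · rfl
    · exact inter_comm _ _
    · exact absurd rfl hne
  · exact absurd hF hb

theorem mem_facesOf_cases (hd : 0 < d) (hΩ : IsPolyDomain Ω) (hK : K ∈ 𝓣.elems)
    (hF : F ∈ 𝓣.facesOf K) :
    (∃ K' ∈ 𝓣.elems, K ≠ K' ∧ F = K ∩ K') ∨
      (F ∈ boundaryFaces Ω 𝓣.elems ∧ ∃ n : Vec d, ‖n‖ = 1 ∧ F = exposedFace n K ∩ frontier Ω) := by
  obtain ⟨hFf, hsub⟩ := hF
  by_cases hex : ∃ K' ∈ 𝓣.elems, K ≠ K' ∧ F ⊆ K'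
  · obtain ⟨K', hK', hne, h'⟩ := hex
    exact Or.inl ⟨K', hK', hne, (𝓣.eq_inter_of_subset hd hΩ hFf hK hK' hne hsub h').1⟩
  · push Not at hex
    right
    rcases hFf with ⟨-, K₁, hK₁, K₂, hK₂, hne, rfl⟩ | hb
    · exfalso
      have e1 : K = K₁ := by
        by_contra hcon
        exact hex K₁ hK₁ hcon inter_subset_left
      have e2 : K = K₂ := by
        by_contra hcon
        exact hex K₂ hK₂ hcon inter_subset_right
      exact hne (e1.symm.trans e2)
    · refine ⟨hb, ?_⟩
      obtain ⟨-, L, hL, G, ⟨-, n, hn, rfl⟩, rfl⟩ := hb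
      have : K = L := by
        by_contra hcon
        exact hex L hL hcon (inter_subset_left.trans (exposedFace_subset n L))
      subst this
      exact ⟨n, hn, rfl⟩

theorem exists_supporting (hd : 0 < d) (hΩ : IsPolyDomain Ω) (hK : K ∈ 𝓣.elems)
    (hF : F ∈ 𝓣.facesOf K) : ∃ n : Vec d, ‖n‖ = 1 ∧ F ⊆ exposedFace n K := by
  rcases 𝓣.mem_facesOf_cases hd hΩ hK hF with ⟨K', hK', hne, rfl⟩ | ⟨-, n, hn, rfl⟩
  · have h := 𝓣.isElement K hK
    have h' := 𝓣.isElement K' hK'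
    obtain ⟨n, a, hn, h1, h2⟩ := exists_separating_flat h.convex h'.convex h.nonempty_interior
      h'.nonempty_interior (𝓣.disjoint K hK K' hK' hne)
    refine ⟨n, hn, fun x hx => ⟨hx.1, fun y hy => ?_⟩⟩
    rw [inner_sub_right]
    linarith [h1 y hy, h2 x hx.2]
  · exact ⟨n, hn, inter_subset_left⟩

/-- The junk value in the definition of `normal` does not occur on the faces of an element. -/
theorem normal_spec (hd : 0 < d) (hΩ : IsPolyDomain Ω) (hK : K ∈ 𝓣.elems)
    (hF : F ∈ 𝓣.facesOf K) : ‖normal K F‖ = 1 ∧ F ⊆ exposedFace (normal K F) K := by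
  have hex : ∃ n : Vec d, ‖n‖ = 1 ∧ ∀ x ∈ F, ∀ y ∈ K, inner ℝ n (y - x) ≤ 0 := by
    obtain ⟨n, hn, h⟩ := 𝓣.exists_supporting hd hΩ hK hF
    exact ⟨n, hn, fun x hx => (h hx).2⟩
  rw [normal, dif_pos hex]
  exact ⟨hex.choose_spec.1, fun x hx => ⟨hF.2 hx, hex.choose_spec.2 x hx⟩⟩

theorem exists_normal_flat (hd : 0 < d) (hΩ : IsPolyDomain Ω) (hK : K ∈ 𝓣.elems)
    (hF : F ∈ 𝓣.facesOf K) : ∃ a, F ⊆ flat (normal K F) a ∧ ∀ y ∈ K, inner ℝ (normal K F) y ≤ a := by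
  have hne : (exposedFace (normal K F) K).Nonempty :=
    (nonempty_of_measure_ne_zero (𝓣.surf_pos_of_mem_faces hF.1).ne').mono
      (𝓣.normal_spec hd hΩ hK hF).2
  obtain ⟨a, h1, h2⟩ := exists_exposedFace_eq hne
  exact ⟨a, ((𝓣.normal_spec hd hΩ hK hF).2.trans h2.subset).trans inter_subset_right, h1⟩

theorem normal_eq_neg (hd : 0 < d) (hΩ : IsPolyDomain Ω) (hK : K ∈ 𝓣.elems) (hK' : K' ∈ 𝓣.elems)
    (hne : K ≠ K') (hF : F ∈ 𝓣.facesOf K) (hF' : F ∈ 𝓣.facesOf K') :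
    normal K' F = -normal K F := by
  have hpos := 𝓣.surf_pos_of_mem_faces hF.1
  have h := 𝓣.isElement K hK
  have h' := 𝓣.isElement K' hK'
  obtain ⟨n, a, hn, h1, h2⟩ := exists_separating_flat h.convex h'.convex h.nonempty_interior
    h'.nonempty_interior (𝓣.disjoint K hK K' hK' hne)
  have hflat : F ⊆ flat n a := fun x hx => le_antisymm (h1 x (hF.2 hx)) (h2 x (hF'.2 hx))
  obtain ⟨b, hb, hb1⟩ := 𝓣.exists_normal_flat hd hΩ hK hF
  obtain ⟨b', hb', hb1'⟩ := 𝓣.exists_normal_flat hd hΩ hK' hF'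
  have e1 : normal K F = n := by
    rcases flat_eq_of_surf_pos hd hn (𝓣.normal_spec hd hΩ hK hF).1 hflat hb hpos with h3 | ⟨h3, h4⟩
    · exact h3.1
    · exfalso
      refine false_of_subset_flat h.nonempty_interior hn h1 fun y hy => ?_
      have := hb1 y hy
      rw [h3, h4, inner_neg_left] at this
      linarith
  have e2 : normal K' F = -n := by
    rcases flat_eq_of_surf_pos hd hn (𝓣.normal_spec hd hΩ hK' hF').1 hflat hb' hpos with
      ⟨h3, h4⟩ | h3
    · exfalso
      refine false_of_subset_flat h'.nonempty_interior hn (fun y hy => ?_) h2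
      have := hb1' y hy
      rwa [h3, h4] at this
    · exact h3.1
  rw [e2, e1]

/-- Distinct faces of the same element overlap in a null set for the surface measure. -/
theorem surf_inter_facesOf (hd : 0 < d) (hΩ : IsPolyDomain Ω) (hK : K ∈ 𝓣.elems)
    (hF : F ∈ 𝓣.facesOf K) (hF' : F' ∈ 𝓣.facesOf K) (hne : F ≠ F') : surf d (F ∩ F') = 0 := by
  by_contra h0
  have hpos : 0 < surf d (F ∩ F') := pos_iff_ne_zero.2 h0
  rcases 𝓣.mem_facesOf_cases hd hΩ hK hF with ⟨K₁, hK₁, hne₁, rfl⟩ | ⟨hb, n, hn, rfl⟩ <;>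
  rcases 𝓣.mem_facesOf_cases hd hΩ hK hF' with ⟨K₂, hK₂, hne₂, rfl⟩ | ⟨hb', n', hn', rfl⟩
  · have h12 : K₁ ≠ K₂ := by rintro rfl; exact hne rfl
    refine h0 (measure_mono_null ?_ (𝓣.surf_inter_inter hd hK hK₁ hK₂ hne₁ hne₂ h12))
    rintro x ⟨hx1, hx2⟩
    exact ⟨hx1, hx2.2⟩
  · refine h0 (measure_mono_null ?_ (𝓣.surf_inter_frontier hd hΩ hK hK₁ hne₁))
    rintro x ⟨hx1, hx2⟩
    exact ⟨hx1, hx2.2⟩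
  · refine h0 (measure_mono_null ?_ (𝓣.surf_inter_frontier hd hΩ hK hK₂ hne₂))
    rintro x ⟨hx1, hx2⟩
    exact ⟨hx2, hx1.2⟩
  · obtain ⟨x, hx1, hx2⟩ := nonempty_of_measure_ne_zero h0
    obtain ⟨a, ha, he⟩ := exists_exposedFace_eq ⟨x, hx1.1⟩
    obtain ⟨a', ha', he'⟩ := exists_exposedFace_eq ⟨x, hx2.1⟩
    have s1 : (exposedFace n K ∩ frontier Ω) ∩ (exposedFace n' K ∩ frontier Ω) ⊆ flat n a :=
      fun y hy => (he.subset hy.1.1).2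
    have s2 : (exposedFace n K ∩ frontier Ω) ∩ (exposedFace n' K ∩ frontier Ω) ⊆ flat n' a' :=
      fun y hy => (he'.subset hy.2.1).2
    rcases flat_eq_of_surf_pos hd hn hn' s1 s2 hpos with ⟨rfl, -⟩ | ⟨rfl, rfl⟩
    · exact hne rfl
    · refine false_of_subset_flat (𝓣.isElement K hK).nonempty_interior hn ha fun y hy => ?_
      have := ha' y hy
      rw [inner_neg_left] at this
      linarith

theorem exists_other_of_mem_frontier (hΩ : IsPolyDomain Ω) {x : Vec d}
    (hx : x ∈ frontier K) (hxΩ : x ∈ Ω) : ∃ K' ∈ 𝓣.elems, K ≠ K' ∧ x ∈ K' := by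
  classical
  by_contra! hcon
  have hcl : IsClosed (⋃ K' ∈ 𝓣.elems.erase K, K') :=
    isClosed_biUnion_finset fun K' hK' => (𝓣.isElement K' (Finset.mem_of_mem_erase hK')).isCompact.isClosed
  have hxn : x ∉ ⋃ K' ∈ 𝓣.elems.erase K, K' := by
    simp only [mem_iUnion, not_exists]
    intro K' hK' hxK'
    rw [Finset.mem_erase] at hK'
    exact hcon K' hK'.2 hK'.1.symm hxK'
  have h1 : (⋃ K' ∈ 𝓣.elems.erase K, K')ᶜ ∩ Ω ⊆ K := by
    rintro y ⟨hy, hyΩ⟩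
    have hy2 : y ∈ ⋃ K ∈ 𝓣.elems, K := 𝓣.cover ▸ _root_.subset_closure hyΩ
    simp only [mem_iUnion, exists_prop] at hy2
    obtain ⟨L, hL, hyL⟩ := hy2
    by_cases hLK : L = K
    · exact hLK ▸ hyL
    · refine absurd ?_ hy
      simp only [mem_iUnion, exists_prop]
      exact ⟨L, Finset.mem_erase.2 ⟨hLK, hL⟩, hyL⟩
  exact hx.2 (interior_maximal h1 (hcl.isOpen_compl.inter hΩ.isOpen) ⟨hxn, hxΩ⟩)

/-- The faces of an element cover its boundary up to a null set for the surface measure. -/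
theorem surf_frontier_diff (hΩ : IsPolyDomain Ω) (hK : K ∈ 𝓣.elems) :
    surf d {x ∈ frontier K | ∀ F ∈ 𝓣.facesOf K, x ∉ F} = 0 := by
  have hE := 𝓣.isElement K hK
  have hfin := hE.finite_exposedFaces
  -- the parts of the boundary that are too small to belong to faces
  let N : Set (Vec d) :=
    (⋃ E ∈ {E ∈ {E | ∃ n, E = exposedFace n K} | surf d E = 0}, E) ∪
    (⋃ E ∈ {E ∈ {E | ∃ n, E = exposedFace n K} | surf d (E ∩ frontier Ω) = 0}, E ∩ frontier Ω) ∪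
    ⋃ K' ∈ {K' ∈ (𝓣.elems : Set (Set (Vec d))) | surf d (K ∩ K') = 0}, K ∩ K'
  have hN : surf d N = 0 := by
    refine measure_union_null (measure_union_null ?_ ?_) ?_
    · exact (measure_biUnion_null_iff (hfin.subset (sep_subset _ _)).countable).2 fun E hE => hE.2
    · exact (measure_biUnion_null_iff (hfin.subset (sep_subset _ _)).countable).2 fun E hE => hE.2
    · exact (measure_biUnion_null_iff (𝓣.elems.finite_toSet.subset (sep_subset _ _)).countable).2
        fun E hE => hE.2
  refine measure_mono_null ?_ hN
  rintro x ⟨hx, hxF⟩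
  obtain ⟨n, hn, hxn⟩ := exists_mem_exposedFace hE.convex hE.isCompact.isClosed
    hE.nonempty_interior hx
  by_cases h0 : surf d (exposedFace n K) = 0
  · exact Or.inl (Or.inl (mem_biUnion (t := fun E => E) ⟨⟨n, rfl⟩, h0⟩ hxn))
  · by_cases hxΩ : x ∈ Ω
    · obtain ⟨K', hK', hne, hxK'⟩ := 𝓣.exists_other_of_mem_frontier hΩ hx hxΩ
      have hxx : x ∈ K ∩ K' := ⟨hxn.1, hxK'⟩
      refine Or.inr (mem_biUnion (t := fun E => K ∩ E) ⟨hK', ?_⟩ hxx)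
      by_contra hcon
      exact hxF (K ∩ K') ⟨Or.inl ⟨pos_iff_ne_zero.2 hcon, K, hK, K', hK', hne, rfl⟩,
        inter_subset_left⟩ hxx
    · have hxf : x ∈ frontier Ω := by
        rw [hΩ.isOpen.frontier_eq]
        exact ⟨𝓣.subset_closure hK hxn.1, hxΩ⟩
      refine Or.inl (Or.inr (mem_biUnion (t := fun E => E ∩ frontier Ω) ⟨⟨n, rfl⟩, ?_⟩ ⟨hxn, hxf⟩))
      by_contra hcon
      refine hxF (exposedFace n K ∩ frontier Ω) ⟨Or.inr ⟨pos_iff_ne_zero.2 hcon, K, hK, _,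
        ⟨pos_iff_ne_zero.2 h0, n, hn, rfl⟩, rfl⟩, inter_subset_left.trans (exposedFace_subset n K)⟩
        ⟨hxn, hxf⟩

theorem facesOf_subset_frontier (hd : 0 < d) (hΩ : IsPolyDomain Ω) (hK : K ∈ 𝓣.elems)
    (hF : F ∈ 𝓣.facesOf K) : F ⊆ frontier K := by
  obtain ⟨a, ha, hb⟩ := 𝓣.exists_normal_flat hd hΩ hK hF
  intro x hx
  refine ⟨_root_.subset_closure (hF.2 hx), fun hi => ?_⟩
  have := inner_lt_of_mem_interior (𝓣.normal_spec hd hΩ hK hF).1 hb hi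
  exact this.ne (ha hx)

theorem surf_ne_top (hd : 0 < d) (hΩ : IsPolyDomain Ω) (hF : F ∈ 𝓣.faces) : surf d F ≠ ⊤ := by
  obtain ⟨K, hK, hsub⟩ := 𝓣.exists_subset_of_mem_faces hF
  have hFK : F ∈ 𝓣.facesOf K := ⟨hF, hsub⟩
  obtain ⟨a, ha, -⟩ := 𝓣.exists_normal_flat hd hΩ hK hFK
  exact surf_flat_inter_ne_top hd (𝓣.normal_spec hd hΩ hK hFK).1 ha
    (𝓣.isCompact_of_mem_faces hF).isBounded

/-! ### Decomposition of volume integrals -/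

theorem restrict_interior (hK : K ∈ 𝓣.elems) :
    (volume : Measure (Vec d)).restrict (interior K) = volume.restrict K := by
  apply Measure.restrict_congr_set
  exact interior_ae_eq_of_null_frontier ((𝓣.isElement K hK).convex.addHaar_frontier volume)

theorem aedisjoint (hK : K ∈ 𝓣.elems) (hK' : K' ∈ 𝓣.elems) (hne : K ≠ K') :
    AEDisjoint (volume : Measure (Vec d)) K K' := by
  have h := (𝓣.isElement K hK).convex.addHaar_frontier (volume : Measure (Vec d))
  have h' := (𝓣.isElement K' hK').convex.addHaar_frontier (volume : Measure (Vec d))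
  refine measure_mono_null ?_ (measure_union_null h h')
  rintro x ⟨hx, hx'⟩
  by_contra hcon
  simp only [mem_union, not_or, frontier, Set.mem_sdiff, not_and, not_not] at hcon
  exact disjoint_left.1 (𝓣.disjoint K hK K' hK' hne) (hcon.1 (_root_.subset_closure hx))
    (hcon.2 (_root_.subset_closure hx'))

theorem restrict_eq_sum (hΩ : IsPolyDomain Ω) :
    (volume : Measure (Vec d)).restrict Ω =
      Measure.sum fun K : 𝓣.elems => volume.restrict (K : Set (Vec d)) := by
  have h1 : (Ω : Set (Vec d)) =ᵐ[volume] (⋃ K : 𝓣.elems, (K : Set (Vec d)) : Set (Vec d)) := by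
    have hc : (⋃ K : 𝓣.elems, (K : Set (Vec d))) = closure Ω := by
      rw [← 𝓣.cover, iUnion_subtype]
    rw [hc]
    refine (LE.le.eventuallyLE _root_.subset_closure).antisymm ?_
    have hnull : volume (⋃ K ∈ (𝓣.elems : Set (Set (Vec d))), frontier K) = 0 :=
      (measure_biUnion_null_iff 𝓣.elems.finite_toSet.countable).2 fun K hK =>
        (𝓣.isElement K hK).convex.addHaar_frontier volume
    filter_upwards [compl_mem_ae_iff.2 hnull] with x hx hxc
    have hx2 : x ∈ ⋃ K ∈ 𝓣.elems, K := 𝓣.cover ▸ hxc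
    simp only [mem_iUnion, exists_prop] at hx2
    obtain ⟨K, hK, hxK⟩ := hx2
    apply 𝓣.interior_subset hΩ hK
    by_contra hcon
    exact hx (mem_biUnion (t := fun K => frontier K) hK ⟨_root_.subset_closure hxK, hcon⟩)
  rw [Measure.restrict_congr_set h1, Measure.restrict_iUnion_ae]
  · intro K K' hne
    exact 𝓣.aedisjoint K.2 K'.2 (fun h => hne (Subtype.ext h))
  · intro K
    exact (𝓣.isElement K K.2).isCompact.measurableSet.nullMeasurableSet

theorem integral_eq_volSum (hΩ : IsPolyDomain Ω) {f : Vec d → ℝ}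
    (hf : Integrable f (volume.restrict Ω)) : ∫ x in Ω, f x = 𝓣.volSum fun _ => f := by
  rw [𝓣.restrict_eq_sum hΩ] at hf ⊢
  rw [integral_sum_measure hf, tsum_fintype, volSum, Finset.sum_coe_sort 𝓣.elems (fun K => ∫ x in K, f x)]

end Mesh
end HDG

namespace HDG
variable {d : ℕ} {Ω : Set (Vec d)}

/-! ### The divergence theorem on mesh elements -/

theorem exists_frontier_of_ne {K : Set (Vec d)} (hK : IsCompact K) {x₀ x : Vec d}
    (hx : x ∈ interior K) (hne : x ≠ x₀) :
    ∃ y ∈ frontier K, ∃ s ∈ Ioo (0 : ℝ) 1, AffineMap.homothety x₀ s y = x := by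
  let γ : ℝ → Vec d := fun τ => x₀ + τ • (x - x₀)
  have hγ : Continuous γ := by fun_prop
  have hpre : IsPreconnected (γ '' Ici 1) := isPreconnected_Ici.image γ hγ.continuousOn
  have hx1 : γ 1 = x := by simp [γ]
  have h2 : (γ '' Ici 1 ∩ Kᶜ).Nonempty := by
    obtain ⟨R, hR⟩ := hK.isBounded.subset_closedBall x₀
    have hpos : 0 < ‖x - x₀‖ := norm_pos_iff.2 (sub_ne_zero.2 hne)
    let τ : ℝ := max 1 ((|R| + 1) / ‖x - x₀‖)
    refine ⟨γ τ, ⟨τ, mem_Ici.2 (le_max_left _ _), rfl⟩, fun hmem => ?_⟩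
    have h3 := hR hmem
    have h4 : (|R| + 1) / ‖x - x₀‖ ≤ τ := le_max_right _ _
    have h5 : 1 ≤ τ := le_max_left _ _
    rw [div_le_iff₀ hpos] at h4
    simp only [γ, Metric.mem_closedBall, dist_eq_norm, add_sub_cancel_left, norm_smul,
      Real.norm_eq_abs, abs_of_pos (zero_lt_one.trans_le h5)] at h3
    linarith [le_abs_self R]
  have h3 : (γ '' Ici 1 ∩ interior K).Nonempty := ⟨γ 1, ⟨1, by simp, rfl⟩, by rwa [hx1]⟩
  obtain ⟨y, ⟨τ, hτ, rfl⟩, hy⟩ : (γ '' Ici 1 ∩ frontier K).Nonempty := by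
    by_contra hcon
    rw [not_nonempty_iff_eq_empty, eq_empty_iff_forall_notMem] at hcon
    obtain ⟨y, -, hy1, hy2⟩ := hpre (interior K) Kᶜ isOpen_interior hK.isClosed.isOpen_compl
      (fun y hy => by
        by_contra hc2
        simp only [mem_union, mem_compl_iff, not_or, not_not] at hc2
        exact hcon y ⟨hy, subset_closure hc2.2, hc2.1⟩) h3 h2
    exact hy2 (interior_subset hy1)
  have hτ1 : 1 < τ := by
    refine lt_of_le_of_ne hτ fun h => hy.2 ?_
    rw [← h, hx1]; exact hx
  have hτ0 : 0 < τ := by linarith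
  refine ⟨γ τ, hy, τ⁻¹, ⟨by positivity, inv_lt_one_of_one_lt₀ hτ1⟩, ?_⟩
  simp [γ, AffineMap.homothety_apply, smul_smul, inv_mul_cancel₀ hτ0.ne']

theorem cone_subset {K F : Set (Vec d)} (hc : Convex ℝ K) {x₀ : Vec d} (hx₀ : x₀ ∈ K) (hF : F ⊆ K) :
    cone x₀ F ⊆ K := by
  rintro _ ⟨⟨s, y⟩, ⟨hs, hy⟩, rfl⟩
  have : AffineMap.homothety x₀ s y = (1 - s) • x₀ + s • y := by
    rw [AffineMap.homothety_apply, vsub_eq_sub, vadd_eq_add]; module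
  simp only
  rw [this]
  exact hc hx₀ (hF hy) (by linarith [hs.2]) hs.1.le (by ring)

/-- A ray from an interior point meets the boundary of a convex body only once. -/
theorem cone_inter_cone {K F F' : Set (Vec d)} {x₀ n n' : Vec d} {a a' : ℝ}
    (hF : F ⊆ K ∩ flat n a) (hF' : F' ⊆ K ∩ flat n' a') (h : ∀ y ∈ K, inner ℝ n y ≤ a)
    (h' : ∀ y ∈ K, inner ℝ n' y ≤ a') (hx : inner ℝ n x₀ < a) (hx' : inner ℝ n' x₀ < a') :
    cone x₀ F ∩ cone x₀ F' ⊆ cone x₀ (F ∩ F') := by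
  rintro _ ⟨⟨⟨s, y⟩, ⟨hs, hy⟩, rfl⟩, ⟨⟨s', y'⟩, ⟨hs', hy'⟩, he⟩⟩
  simp only at he hs hs' hy hy'
  have key : ∀ {m : Vec d} {b s s' : ℝ} {y y' : Vec d}, y ∈ flat m b → inner ℝ m y' ≤ b →
      inner ℝ m x₀ < b → 0 < s' →
      AffineMap.homothety x₀ s y = AffineMap.homothety x₀ s' y' → s ≤ s' := by
    intro m b s s' y y' hy hy' hx hs' he
    have h1 := congrArg (fun z => (inner ℝ m (z - x₀) : ℝ)) he
    have h2 : inner ℝ m y = b := hy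
    simp only [AffineMap.homothety_apply, vsub_eq_sub, vadd_eq_add, add_sub_cancel_right,
      inner_smul_right, inner_sub_right, h2] at h1
    have h3 : s * (b - inner ℝ m x₀) ≤ s' * (b - inner ℝ m x₀) := by
      rw [h1]
      exact mul_le_mul_of_nonneg_left (by linarith) hs'.le
    exact le_of_mul_le_mul_right h3 (by linarith)
  have e1 : s ≤ s' := key (hF hy).2 (h y' (hF' hy').1) hx hs'.1 he.symm
  have e2 : s' ≤ s := key (hF' hy').2 (h' y (hF hy).1) hx' hs.1 he
  have e3 : s' = s := le_antisymm e2 e1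
  subst e3
  have e4 : y' = y := by
    simp only [AffineMap.homothety_apply, vsub_eq_sub, vadd_eq_add, add_left_inj] at he
    have := smul_right_injective _ hs.1.ne' he
    exact sub_left_injective this
  subst e4
  exact ⟨(s', y'), ⟨hs, hy, hy'⟩, rfl⟩

namespace Mesh
variable (𝓣 : Mesh Ω) {K : Set (Vec d)}

theorem volume_cone_rest (hΩ : IsPolyDomain Ω) (hK : K ∈ 𝓣.elems) {x₀ : Vec d}
    (hx₀ : x₀ ∈ interior K) :
    volume (cone x₀ {x ∈ frontier K | ∀ F ∈ 𝓣.facesOf K, x ∉ F}) = 0 := by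
  have hE := 𝓣.isElement K hK
  set S := {x ∈ frontier K | ∀ F ∈ 𝓣.facesOf K, x ∉ F} with hS
  have hS0 : surf d S = 0 := 𝓣.surf_frontier_diff hΩ hK
  have hsub : cone x₀ S ⊆ ⋃ E ∈ {E | ∃ n : Vec d, ‖n‖ = 1 ∧ E = exposedFace n K}, cone x₀ (S ∩ E) := by
    rintro _ ⟨⟨s, y⟩, ⟨hs, hy⟩, rfl⟩
    obtain ⟨n, hn, hyn⟩ := exists_mem_exposedFace hE.convex hE.isCompact.isClosed
      hE.nonempty_interior hy.1
    exact mem_biUnion (t := fun E => cone x₀ (S ∩ E)) ⟨n, hn, rfl⟩ ⟨(s, y), ⟨hs, hy, hyn⟩, rfl⟩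
  refine measure_mono_null hsub ((measure_biUnion_null_iff ?_).2 ?_)
  · refine (hE.finite_exposedFaces.subset ?_).countable
    rintro E ⟨n, -, rfl⟩
    exact ⟨n, rfl⟩
  · rintro E ⟨n, hn, rfl⟩
    rcases (exposedFace n K).eq_empty_or_nonempty with h0 | h0
    · simp [h0, cone]
    obtain ⟨a, ha, he⟩ := exists_exposedFace_eq h0
    refine volume_cone_eq_zero hn (inner_lt_of_mem_interior hn ha hx₀) ?_
      (measure_mono_null inter_subset_left hS0)
    rw [he]
    exact inter_subset_right.trans inter_subset_right

/-- Up to null sets, an element is the disjoint union of the cones over its faces, with any interior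
point as apex. -/
theorem restrict_eq_sum_cone (hd : 0 < d) (hΩ : IsPolyDomain Ω) (hK : K ∈ 𝓣.elems) {x₀ : Vec d}
    (hx₀ : x₀ ∈ interior K) :
    (volume : Measure (Vec d)).restrict K =
      Measure.sum fun F : 𝓣.facesOf K => volume.restrict (cone x₀ (F : Set (Vec d))) := by
  have hE := 𝓣.isElement K hK
  have : Finite (𝓣.facesOf K) := 𝓣.finite_facesOf
  have h1 : (K : Set (Vec d)) =ᵐ[volume] (⋃ F : 𝓣.facesOf K, cone x₀ (F : Set (Vec d)) : Set (Vec d)) := by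
    refine EventuallyLE.antisymm ?_ (LE.le.eventuallyLE ?_)
    · have : Nonempty (Fin d) := ⟨⟨0, hd⟩⟩
      have hx0 : volume ({x₀} : Set (Vec d)) = 0 := measure_singleton x₀
      filter_upwards [compl_mem_ae_iff.2 (𝓣.volume_cone_rest hΩ hK hx₀),
        compl_mem_ae_iff.2 (hE.convex.addHaar_frontier (volume : Measure (Vec d))),
        compl_mem_ae_iff.2 hx0] with x h1 h2 h3 hxK
      have hxi : x ∈ interior K := by
        by_contra hcon
        exact h2 ⟨_root_.subset_closure hxK, hcon⟩
      obtain ⟨y, hy, s, hs, rfl⟩ := exists_frontier_of_ne hE.isCompact hxi h3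
      have : ∃ F ∈ 𝓣.facesOf K, y ∈ F := by
        by_contra! hcon
        exact h1 ⟨(s, y), ⟨hs, hy, hcon⟩, rfl⟩
      obtain ⟨F, hF, hyF⟩ := this
      exact mem_iUnion.2 ⟨⟨F, hF⟩, ⟨(s, y), ⟨hs, hyF⟩, rfl⟩⟩
    · exact iUnion_subset fun F => cone_subset hE.convex (_root_.interior_subset hx₀) F.2.2
  rw [Measure.restrict_congr_set h1, Measure.restrict_iUnion_ae]
  · intro F F' hne
    obtain ⟨a, ha, hb⟩ := 𝓣.exists_normal_flat hd hΩ hK F.2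
    obtain ⟨a', ha', hb'⟩ := 𝓣.exists_normal_flat hd hΩ hK F'.2
    have hn := (𝓣.normal_spec hd hΩ hK F.2).1
    have hn' := (𝓣.normal_spec hd hΩ hK F'.2).1
    have hlt := inner_lt_of_mem_interior hn hb hx₀
    have hlt' := inner_lt_of_mem_interior hn' hb' hx₀
    refine measure_mono_null (cone_inter_cone (subset_inter F.2.2 ha) (subset_inter F'.2.2 ha')
      hb hb' hlt hlt') (volume_cone_eq_zero hn hlt (inter_subset_left.trans ha) ?_)
    exact 𝓣.surf_inter_facesOf hd hΩ hK F.2 F'.2 (fun h => hne (Subtype.ext h))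
  · intro F
    obtain ⟨a, ha, hb⟩ := 𝓣.exists_normal_flat hd hΩ hK F.2
    exact (measurableSet_cone (inner_lt_of_mem_interior (𝓣.normal_spec hd hΩ hK F.2).1 hb hx₀) ha
      (𝓣.isCompact_of_mem_faces F.2.1).measurableSet).nullMeasurableSet

/-- The divergence theorem for the field `f(x) (x - x₀)`. On each ray from `x₀` it is the fundamental
theorem of calculus for `s ↦ s^d f(x₀ + s (y - x₀))`. -/
theorem integral_radial (hd : 0 < d) (hΩ : IsPolyDomain Ω) (hK : K ∈ 𝓣.elems) {x₀ : Vec d}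
    (hx₀ : x₀ ∈ interior K) {f : Vec d → ℝ} (hf : ContDiff ℝ 1 f) :
    ∫ x in K, (d * f x + fderiv ℝ f x (x - x₀)) =
      ∑ᶠ F ∈ 𝓣.facesOf K, ∫ y in F, f y * inner ℝ (normal K F) (y - x₀) ∂surf d := by
  have hE := 𝓣.isElement K hK
  have hfin : (𝓣.facesOf K).Finite := 𝓣.finite_facesOf
  let := hfin.fintype
  have hdf : Continuous (fderiv ℝ f) := hf.continuous_fderiv one_ne_zero
  have hcont : Continuous (fun x => d * f x + fderiv ℝ f x (x - x₀)) := by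
    have := hf.continuous
    fun_prop
  have hint : Integrable (fun x => d * f x + fderiv ℝ f x (x - x₀)) (volume.restrict K) :=
    hcont.continuousOn.integrableOn_compact hE.isCompact
  rw [𝓣.restrict_eq_sum_cone hd hΩ hK hx₀] at hint ⊢
  rw [integral_sum_measure hint, tsum_fintype, finsum_mem_eq_finite_toFinset_sum _ hfin,
    ← Finset.sum_coe_sort hfin.toFinset]
  refine Fintype.sum_equiv (Equiv.subtypeEquivRight (by simp)) _ _ ?_
  rintro ⟨F, hF⟩
  obtain ⟨a, ha, hb⟩ := 𝓣.exists_normal_flat hd hΩ hK hF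
  have hn := (𝓣.normal_spec hd hΩ hK hF).1
  have hlt := inner_lt_of_mem_interior hn hb hx₀
  change _ = ∫ y in F, f y * inner ℝ (normal K F) (y - x₀) ∂surf d
  change ∫ x in cone x₀ F, _ = _
  rw [integral_cone hd hn hlt ha (𝓣.isCompact_of_mem_faces hF.1) hcont, ← integral_const_mul]
  refine setIntegral_congr_fun (𝓣.isCompact_of_mem_faces hF.1).measurableSet fun y hy => ?_
  have hya : inner ℝ (normal K F) y = a := ha hy
  have hI : ∫ s in (0 : ℝ)..1, s ^ (d - 1) * (d * f (AffineMap.homothety x₀ s y) +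
      fderiv ℝ f (AffineMap.homothety x₀ s y) (AffineMap.homothety x₀ s y - x₀)) = f y := by
    have hder : ∀ s : ℝ, HasDerivAt (fun s : ℝ => s ^ d * f (x₀ + s • (y - x₀)))
        (s ^ (d - 1) * (d * f (AffineMap.homothety x₀ s y) +
          fderiv ℝ f (AffineMap.homothety x₀ s y) (AffineMap.homothety x₀ s y - x₀))) s := by
      intro s
      have h1 : HasDerivAt (fun s : ℝ => x₀ + s • (y - x₀)) (y - x₀) s := by
        simpa using ((hasDerivAt_id s).smul_const (y - x₀)).const_add x₀
      have h2 := ((hf.differentiable one_ne_zero (x₀ + s • (y - x₀))).hasFDerivAt).comp_hasDerivAt s h1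
      have h3 := (hasDerivAt_pow d s).mul h2
      have e : AffineMap.homothety x₀ s y = x₀ + s • (y - x₀) := by
        rw [AffineMap.homothety_apply, vsub_eq_sub, vadd_eq_add, add_comm]
      rw [e]
      refine h3.congr_deriv ?_
      rw [add_sub_cancel_left, map_smul, smul_eq_mul]
      obtain ⟨e, rfl⟩ : ∃ e, d = e + 1 := ⟨d - 1, by omega⟩
      simp only [Function.comp, Nat.add_sub_cancel, pow_succ]
      ring
    rw [intervalIntegral.integral_eq_sub_of_hasDerivAt (fun s _ => hder s)]
    · simp [hd.ne']
    · apply Continuous.intervalIntegrable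
      have h4 : Continuous (fun s : ℝ => AffineMap.homothety x₀ s y) := by
        simp only [AffineMap.homothety_apply, vsub_eq_sub, vadd_eq_add]
        fun_prop
      exact (continuous_pow _).mul (hcont.comp h4)
  rw [hI, inner_sub_right, hya]
  ring

/-- The divergence theorem on a mesh element, for fields of constant direction. -/
theorem integral_fderiv (hd : 0 < d) (hΩ : IsPolyDomain Ω) (hK : K ∈ 𝓣.elems)
    {f : Vec d → ℝ} (hf : ContDiff ℝ 1 f) (e : Vec d) :
    ∫ x in K, fderiv ℝ f x e =
      ∑ᶠ F ∈ 𝓣.facesOf K, ∫ y in F, f y * inner ℝ (normal K F) e ∂surf d := by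
  have hE := 𝓣.isElement K hK
  obtain ⟨x₀, hx₀⟩ := hE.nonempty_interior
  -- compare the radial fields with respect to two nearby centres
  obtain ⟨c, hc0, hc⟩ : ∃ c : ℝ, c ≠ 0 ∧ x₀ - c • e ∈ interior K := by
    have h1 : Tendsto (fun c : ℝ => x₀ - c • e) (𝓝 0) (𝓝 x₀) := by
      have : Continuous (fun c : ℝ => x₀ - c • e) := by fun_prop
      simpa using this.tendsto 0
    have h2 := (h1.mono_left (nhdsWithin_le_nhds (s := {0}ᶜ))).eventually (isOpen_interior.mem_nhds hx₀)
    obtain ⟨c, hc, hc'⟩ := (h2.and (self_mem_nhdsWithin (s := {(0 : ℝ)}ᶜ))).exists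
    exact ⟨c, hc', hc⟩
  have r0 := 𝓣.integral_radial hd hΩ hK hx₀ hf
  have r1 := 𝓣.integral_radial hd hΩ hK hc hf
  have hfin : (𝓣.facesOf K).Finite := 𝓣.finite_facesOf
  rw [finsum_mem_eq_finite_toFinset_sum _ hfin] at r0 r1 ⊢
  have hdf : Continuous (fderiv ℝ f) := hf.continuous_fderiv one_ne_zero
  have hfc := hf.continuous
  have hint : ∀ z : Vec d, Integrable (fun x => d * f x + fderiv ℝ f x (x - z)) (volume.restrict K) := by
    intro z
    have : Continuous (fun x => d * f x + fderiv ℝ f x (x - z)) := by fun_prop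
    exact this.continuousOn.integrableOn_compact hE.isCompact
  have e1 : ∫ x in K, c * fderiv ℝ f x e = ∑ F ∈ hfin.toFinset,
      ∫ y in F, c * (f y * inner ℝ (normal K F) e) ∂surf d := by
    have : ∀ x, c * fderiv ℝ f x e = (d * f x + fderiv ℝ f x (x - (x₀ - c • e))) -
        (d * f x + fderiv ℝ f x (x - x₀)) := by
      intro x
      have : x - (x₀ - c • e) = (x - x₀) + c • e := by abel
      rw [this, map_add, map_smul, smul_eq_mul]
      ring
    simp_rw [this]
    rw [integral_sub (hint _) (hint _), r0, r1, ← Finset.sum_sub_distrib]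
    refine Finset.sum_congr rfl fun F hF => ?_
    rw [hfin.mem_toFinset] at hF
    have hFc := 𝓣.isCompact_of_mem_faces hF.1
    have hfinF : IsFiniteMeasure ((surf d).restrict F) :=
      ⟨by simpa using (𝓣.surf_ne_top hd hΩ hF.1).lt_top⟩
    have hintF : ∀ z : Vec d, Integrable (fun y => f y * inner ℝ (normal K F) (y - z))
        ((surf d).restrict F) := by
      intro z
      have hcont : Continuous (fun y => f y * inner ℝ (normal K F) (y - z)) := by fun_prop
      obtain ⟨C, hC⟩ := hFc.exists_bound_of_continuousOn hcont.continuousOn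
      refine Integrable.of_bound hcont.aestronglyMeasurable C ?_
      filter_upwards [ae_restrict_mem hFc.measurableSet] with y hy using hC y hy
    rw [← integral_sub (hintF _) (hintF _)]
    congr 1
    ext y
    have : y - (x₀ - c • e) = (y - x₀) + c • e := by abel
    rw [this, inner_add_right, inner_smul_right]
    ring
  simp_rw [integral_const_mul, ← Finset.mul_sum] at e1
  simp_rw [integral_mul_const]
  simp_rw [integral_mul_const] at e1
  exact mul_left_cancel₀ hc0 e1

end Mesh
end HDG

namespace HDG
variable {d : ℕ}

/-! ### Weak derivatives -/

variable {U V : Set (Vec d)}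

theorem IsTest.differentiable {φ : Vec d → ℝ} (hφ : IsTest U φ) : Differentiable ℝ φ :=
  hφ.1.differentiable (by simp)

theorem IsTest.continuous_fderiv {φ : Vec d → ℝ} (hφ : IsTest U φ) : Continuous (fderiv ℝ φ) :=
  hφ.1.continuous_fderiv (by simp)

theorem IsTest.mono {φ : Vec d → ℝ} (hφ : IsTest V φ) (h : V ⊆ U) : IsTest U φ :=
  ⟨hφ.1, hφ.2.1, hφ.2.2.trans h⟩

theorem sum_smul_single (v : Vec d) : ∑ i, v i • (EuclideanSpace.single i 1 : Vec d) = v := by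
  ext j
  simp [Finset.sum_apply, Pi.single_apply]

theorem fderiv_apply_eq_sum (φ : Vec d → ℝ) (x v : Vec d) :
    fderiv ℝ φ x v = ∑ i, v i * fderiv ℝ φ x (EuclideanSpace.single i 1) := by
  conv_lhs => rw [← sum_smul_single v]
  simp [map_sum]

theorem integrable_mul_of_tsupport_subset {f ψ : Vec d → ℝ} (hf : LocallyIntegrableOn f U)
    (hψ : Continuous ψ) (hc : HasCompactSupport ψ) (hs : tsupport ψ ⊆ U) :
    Integrable (fun x => f x * ψ x) (volume.restrict U) := by
  have h1 : IntegrableOn f (tsupport ψ) := hf.integrableOn_compact_subset hs hc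
  have h2 : IntegrableOn (fun x => f x * ψ x) (tsupport ψ) := by
    obtain ⟨C, hC⟩ := hψ.bounded_above_of_compact_support hc
    exact h1.mul_bdd hψ.aestronglyMeasurable (Eventually.of_forall hC)
  have h3 : Integrable (fun x => f x * ψ x) volume := by
    rw [← integrableOn_iff_integrable_of_support_subset (s := tsupport ψ)]
    · exact h2
    · exact (Function.support_mul_subset_right _ _).trans (subset_tsupport ψ)
  exact h3.restrict

theorem IsTest.partial {φ : Vec d → ℝ} (hφ : IsTest U φ) (v : Vec d) :
    Continuous (fun x => fderiv ℝ φ x v) ∧ HasCompactSupport (fun x => fderiv ℝ φ x v) ∧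
      tsupport (fun x => fderiv ℝ φ x v) ⊆ U := by
  have hsub : Function.support (fun x => fderiv ℝ φ x v) ⊆ Function.support (fderiv ℝ φ) := by
    intro x hx h0
    rw [Function.mem_support] at hx
    exact hx (by rw [h0]; rfl)
  have hsub2 : tsupport (fun x => fderiv ℝ φ x v) ⊆ tsupport φ :=
    (closure_mono hsub).trans (tsupport_fderiv_subset ℝ)
  refine ⟨?_, hφ.2.1.of_isClosed_subset (isClosed_tsupport _) hsub2, hsub2.trans hφ.2.2⟩
  have := hφ.continuous_fderiv
  fun_prop

theorem locallyIntegrableOn_comp {q : Vec d → Vec d} (h : LocallyIntegrableOn q U) (i : Fin d) :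
    LocallyIntegrableOn (fun x => q x i) U := fun x hx => by
  obtain ⟨s, hs, hi⟩ := h x hx
  exact ⟨s, hs, (EuclideanSpace.proj (𝕜 := ℝ) i).integrable_comp hi⟩

theorem integrable_fderiv_test {q : Vec d → Vec d} (hq : LocallyIntegrableOn q U) {φ : Vec d → ℝ}
    (hφ : IsTest U φ) : Integrable (fun x => fderiv ℝ φ x (q x)) (volume.restrict U) := by
  simp_rw [fderiv_apply_eq_sum φ _ (q _)]
  refine integrable_finsetSum _ fun i _ => ?_
  obtain ⟨h1, h2, h3⟩ := hφ.partial (EuclideanSpace.single i 1)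
  exact integrable_mul_of_tsupport_subset (locallyIntegrableOn_comp hq i) h1 h2 h3

theorem ae_eq_of_integral_test {g g' : Vec d → ℝ} (hU : IsOpen U)
    (hg : LocallyIntegrableOn g U) (hg' : LocallyIntegrableOn g' U)
    (h : ∀ φ, IsTest U φ → ∫ x in U, g x * φ x = ∫ x in U, g' x * φ x) :
    g =ᵐ[volume.restrict U] g' := by
  have key := hU.ae_eq_zero_of_integral_contDiff_smul_eq_zero (f := g - g') (μ := volume)
    (hg.sub hg') fun φ h1 h2 h3 => by
      have hφ : IsTest U φ := ⟨h1, h2, h3⟩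
      have e : ∫ x in U, φ x • (g - g') x = 0 := by
        have : ∀ x, φ x • (g - g') x = g x * φ x - g' x * φ x := by
          intro x; simp; ring
        simp_rw [this]
        rw [integral_sub (integrable_mul_of_tsupport_subset hg h1.continuous h2 h3)
          (integrable_mul_of_tsupport_subset hg' h1.continuous h2 h3), h φ hφ, sub_self]
      rw [← e]
      symm
      apply setIntegral_eq_integral_of_forall_compl_eq_zero
      intro x hx
      have : φ x = 0 := by
        by_contra hne
        exact hx (h3 (subset_tsupport φ hne))
      simp [this]
  rw [EventuallyEq, ae_restrict_iff' hU.measurableSet]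
  filter_upwards [key] with x hx hxU
  exact sub_eq_zero.1 (hx hxU)

theorem HasWeakDiv.unique {q : Vec d → Vec d} {g g' : Vec d → ℝ} (hU : IsOpen U)
    (h : HasWeakDiv U q g) (h' : HasWeakDiv U q g') : g =ᵐ[volume.restrict U] g' :=
  ae_eq_of_integral_test hU h.2.1 h'.2.1 fun φ hφ => by
    have := h.2.2 φ hφ
    have := h'.2.2 φ hφ
    linarith

theorem HasWeakPartial.unique {i : Fin d} {f g g' : Vec d → ℝ} (hU : IsOpen U)
    (h : HasWeakPartial U i f g) (h' : HasWeakPartial U i f g') : g =ᵐ[volume.restrict U] g' :=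
  ae_eq_of_integral_test hU h.2.1 h'.2.1 fun φ hφ => by
    have := h.2.2 φ hφ
    have := h'.2.2 φ hφ
    linarith

theorem HasWeakPartial.weakPartial {i : Fin d} {f g : Vec d → ℝ} (h : HasWeakPartial U i f g) :
    HasWeakPartial U i f (weakPartial U i f) := by
  have hex : ∃ g, HasWeakPartial U i f g := ⟨g, h⟩
  rw [HDG.weakPartial, dif_pos hex]
  exact hex.choose_spec

theorem HasWeakPartial.weakPartial_ae_eq {i : Fin d} {f g : Vec d → ℝ} (hU : IsOpen U)
    (h : HasWeakPartial U i f g) : HDG.weakPartial U i f =ᵐ[volume.restrict U] g :=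
  h.weakPartial.unique hU h

theorem HasWeakDiv.weakDiv {q : Vec d → Vec d} {g : Vec d → ℝ} (h : HasWeakDiv U q g) :
    HasWeakDiv U q (weakDiv U q) := by
  have hex : ∃ g, HasWeakDiv U q g := ⟨g, h⟩
  rw [HDG.weakDiv, dif_pos hex]
  exact hex.choose_spec

theorem HasWeakDiv.weakDiv_ae_eq {q : Vec d → Vec d} {g : Vec d → ℝ} (hU : IsOpen U)
    (h : HasWeakDiv U q g) : HDG.weakDiv U q =ᵐ[volume.restrict U] g :=
  h.weakDiv.unique hU h

theorem locallyIntegrableOn_congr {E : Type*} [NormedAddCommGroup E] {f f' : Vec d → E}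
    (h : f =ᵐ[volume.restrict U] f') (hf : LocallyIntegrableOn f U) :
    LocallyIntegrableOn f' U := fun x hx => by
  obtain ⟨s, hs, hi⟩ := hf x hx
  refine ⟨s ∩ U, inter_mem hs self_mem_nhdsWithin, ?_⟩
  refine (hi.mono_set inter_subset_left).congr ?_
  have : (volume : Measure (Vec d)).restrict (s ∩ U) ≤ volume.restrict U :=
    Measure.restrict_mono inter_subset_right le_rfl
  exact ae_mono this h

theorem HasWeakPartial.congr {i : Fin d} {f f' g g' : Vec d → ℝ}
    (hf : f =ᵐ[volume.restrict U] f') (hg : g =ᵐ[volume.restrict U] g')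
    (h : HasWeakPartial U i f g) : HasWeakPartial U i f' g' := by
  refine ⟨locallyIntegrableOn_congr hf h.1, locallyIntegrableOn_congr hg h.2.1, fun φ hφ => ?_⟩
  have e1 : ∫ x in U, f' x * fderiv ℝ φ x (EuclideanSpace.single i 1) =
      ∫ x in U, f x * fderiv ℝ φ x (EuclideanSpace.single i 1) :=
    integral_congr_ae (by filter_upwards [hf] with x hx; rw [hx])
  have e2 : ∫ x in U, g' x * φ x = ∫ x in U, g x * φ x :=
    integral_congr_ae (by filter_upwards [hg] with x hx; rw [hx])
  rw [e1, e2, h.2.2 φ hφ]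

theorem setIntegral_eq_of_subset {f : Vec d → ℝ} (h : V ⊆ U)
    (hs : ∀ x, x ∉ V → f x = 0) : ∫ x in V, f x = ∫ x in U, f x := by
  rw [setIntegral_eq_integral_of_forall_compl_eq_zero hs,
    setIntegral_eq_integral_of_forall_compl_eq_zero fun x hx => hs x fun hxV => hx (h hxV)]

theorem IsTest.eq_zero {φ : Vec d → ℝ} (hφ : IsTest U φ) {x : Vec d} (hx : x ∉ U) :
    φ x = 0 ∧ fderiv ℝ φ x = 0 := by
  have h1 : x ∉ tsupport φ := fun h => hx (hφ.2.2 h)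
  refine ⟨image_eq_zero_of_notMem_tsupport h1, ?_⟩
  exact image_eq_zero_of_notMem_tsupport fun h => h1 (tsupport_fderiv_subset ℝ h)

theorem HasWeakPartial.mono {i : Fin d} {f g : Vec d → ℝ} (h : HasWeakPartial U i f g) (hVU : V ⊆ U) :
    HasWeakPartial V i f g := by
  refine ⟨h.1.mono_set hVU, h.2.1.mono_set hVU, fun φ hφ => ?_⟩
  rw [setIntegral_eq_of_subset hVU fun x hx => by simp [(hφ.eq_zero hx).2],
    setIntegral_eq_of_subset hVU fun x hx => by simp [(hφ.eq_zero hx).1]]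
  exact h.2.2 φ (hφ.mono hVU)

theorem HasWeakDiv.mono {q : Vec d → Vec d} {g : Vec d → ℝ} (h : HasWeakDiv U q g) (hVU : V ⊆ U) :
    HasWeakDiv V q g := by
  refine ⟨h.1.mono_set hVU, h.2.1.mono_set hVU, fun φ hφ => ?_⟩
  rw [setIntegral_eq_of_subset hVU fun x hx => by simp [(hφ.eq_zero hx).2],
    setIntegral_eq_of_subset hVU fun x hx => by simp [(hφ.eq_zero hx).1]]
  exact h.2.2 φ (hφ.mono hVU)

theorem HasWeakPartial.sub {i : Fin d} {f f' g g' : Vec d → ℝ} (h : HasWeakPartial U i f g)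
    (h' : HasWeakPartial U i f' g') :
    HasWeakPartial U i (fun x => f x - f' x) (fun x => g x - g' x) := by
  refine ⟨h.1.sub h'.1, h.2.1.sub h'.2.1, fun φ hφ => ?_⟩
  obtain ⟨h1, h2, h3⟩ := hφ.partial (EuclideanSpace.single i 1)
  simp_rw [sub_mul]
  rw [integral_sub (integrable_mul_of_tsupport_subset h.1 h1 h2 h3)
      (integrable_mul_of_tsupport_subset h'.1 h1 h2 h3),
    integral_sub (integrable_mul_of_tsupport_subset h.2.1 hφ.1.continuous hφ.2.1 hφ.2.2)
      (integrable_mul_of_tsupport_subset h'.2.1 hφ.1.continuous hφ.2.1 hφ.2.2),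
    h.2.2 φ hφ, h'.2.2 φ hφ]
  ring

theorem HasWeakPartial.of_contDiff (i : Fin d) {f : Vec d → ℝ} (hf : ContDiff ℝ 1 f) :
    HasWeakPartial U i f (fun x => fderiv ℝ f x (EuclideanSpace.single i 1)) := by
  have hdf : Continuous (fun x => fderiv ℝ f x (EuclideanSpace.single i 1)) := by
    have := hf.continuous_fderiv one_ne_zero
    fun_prop
  refine ⟨hf.continuous.locallyIntegrable.locallyIntegrableOn U,
    hdf.locallyIntegrable.locallyIntegrableOn U, fun φ hφ => ?_⟩
  obtain ⟨h1, h2, h3⟩ := hφ.partial (EuclideanSpace.single i 1)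
  rw [setIntegral_eq_integral_of_forall_compl_eq_zero fun x hx => by simp [(hφ.eq_zero hx).2],
    setIntegral_eq_integral_of_forall_compl_eq_zero fun x hx => by simp [(hφ.eq_zero hx).1]]
  apply integral_mul_fderiv_eq_neg_fderiv_mul_of_integrable
  · exact (hdf.mul hφ.1.continuous).integrable_of_hasCompactSupport hφ.2.1.mul_left
  · exact (hf.continuous.mul h1).integrable_of_hasCompactSupport h2.mul_left
  · exact (hf.continuous.mul hφ.1.continuous).integrable_of_hasCompactSupport hφ.2.1.mul_left
  · exact fun x _ => hf.differentiable one_ne_zero x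
  · exact fun x _ => hφ.differentiable x

theorem locallyIntegrableOn_of_comp {q : Vec d → Vec d}
    (h : ∀ i, LocallyIntegrableOn (fun x => q x i) U) : LocallyIntegrableOn q U := by
  have : q = fun x => ∑ i, (q x i) • (EuclideanSpace.single i 1 : Vec d) :=
    funext fun x => (sum_smul_single (q x)).symm
  intro x hx
  choose s hs hi using fun i => h i x hx
  refine ⟨⋂ i, s i, (Filter.iInter_mem).2 hs, ?_⟩
  rw [this]
  refine integrable_finsetSum _ fun i _ => ?_
  exact ((hi i).mono_set (iInter_subset s i)).smul_const _

/-- The weak divergence is the sum of the weak partial derivatives of the components. -/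
theorem HasWeakDiv.of_partial {q : Vec d → Vec d} {g : Fin d → Vec d → ℝ}
    (h : ∀ i, HasWeakPartial U i (compV q i) (g i)) : HasWeakDiv U q (fun x => ∑ i, g i x) := by
  refine ⟨locallyIntegrableOn_of_comp fun i => (h i).1, ?_, fun φ hφ => ?_⟩
  · have := fun (x : Vec d) (hx : x ∈ U) => (fun i => (h i).2.1 x hx)
    intro x hx
    choose s hs hi using this x hx
    refine ⟨⋂ i, s i, (Filter.iInter_mem).2 hs, ?_⟩
    exact integrable_finsetSum _ fun i _ => (hi i).mono_set (iInter_subset s i)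
  · simp_rw [fderiv_apply_eq_sum φ _ (q _), Finset.sum_mul]
    rw [integral_finsetSum, integral_finsetSum, ← Finset.sum_neg_distrib]
    · exact Finset.sum_congr rfl fun i _ => (h i).2.2 φ hφ
    · exact fun i _ => integrable_mul_of_tsupport_subset (h i).2.1 hφ.1.continuous hφ.2.1 hφ.2.2
    · intro i _
      obtain ⟨h1, h2, h3⟩ := hφ.partial (EuclideanSpace.single i 1)
      exact integrable_mul_of_tsupport_subset (h i).1 h1 h2 h3

theorem HasWeakPartial.hasWeakDiv_smul {i : Fin d} {f g : Vec d → ℝ} (h : HasWeakPartial U i f g) :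
    HasWeakDiv U (fun x => f x • (EuclideanSpace.single i 1 : Vec d)) g := by
  refine ⟨fun x hx => ?_, h.2.1, fun φ hφ => ?_⟩
  · obtain ⟨s, hs, hi⟩ := h.1 x hx
    exact ⟨s, hs, hi.smul_const _⟩
  · simp_rw [map_smul, smul_eq_mul]
    exact h.2.2 φ hφ

theorem weakPartial_congr {i : Fin d} {f f' : Vec d → ℝ}
    (hf : f =ᵐ[volume.restrict U] f') : weakPartial U i f = weakPartial U i f' := by
  have : HasWeakPartial U i f = HasWeakPartial U i f' := by
    ext g
    exact ⟨fun h => h.congr hf (EventuallyEq.refl _ _),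
      fun h => h.congr hf.symm (EventuallyEq.refl _ _)⟩
  have key : ∀ P Q : (Vec d → ℝ) → Prop, P = Q →
      (open Classical in if h : ∃ g, P g then h.choose else 0) =
        (open Classical in if h : ∃ g, Q g then h.choose else (0 : Vec d → ℝ)) := by
    rintro P _ rfl
    rfl
  exact key _ _ this

/-! ### Sobolev spaces of order one and below -/

/-- `f ∈ H¹(U)`: the space `MemHs U 1`, in terms of first weak derivatives. -/
def MemH1 (U : Set (Vec d)) (f : Vec d → ℝ) : Prop :=
  MemLp f 2 (volume.restrict U) ∧
    ∀ i, ∃ g, HasWeakPartial U i f g ∧ MemLp g 2 (volume.restrict U)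

theorem MemSob.memLp {θ : ℝ} {m : ℕ} {f : Vec d → ℝ} (h : MemSob U θ m f) :
    MemLp f 2 (volume.restrict U) := by
  cases m <;> exact h.1

theorem lintegral_le_sobSq (θ : ℝ) (m : ℕ) (f : Vec d → ℝ) :
    ∫⁻ x in U, ‖f x‖ₑ ^ 2 ≤ sobSq U θ m f := by
  cases m <;> exact le_self_add

theorem floor_eq_zero_of_lt {r : ℝ} (h1 : r < 1) : ⌊r⌋₊ = 0 :=
  Nat.floor_eq_zero.2 h1

theorem memHs_iff_of_lt {r : ℝ} (h0 : 0 < r) (h1 : r < 1) {f : Vec d → ℝ} :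
    MemHs U r f ↔ MemLp f 2 (volume.restrict U) ∧ gagliardoSq U r f < ⊤ := by
  have : Int.fract r = r := Int.fract_eq_self.2 ⟨h0.le, h1⟩
  simp [MemHs, floor_eq_zero_of_lt h1, MemSob, this, h0.ne']

theorem hsSq_of_lt {r : ℝ} (h0 : 0 < r) (h1 : r < 1) {f : Vec d → ℝ} :
    hsSq U r f = (∫⁻ x in U, ‖f x‖ₑ ^ 2) + gagliardoSq U r f := by
  have : Int.fract r = r := Int.fract_eq_self.2 ⟨h0.le, h1⟩
  simp [hsSq, floor_eq_zero_of_lt h1, sobSq, this, h0.ne']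

theorem MemHs.memH1 {r : ℝ} (h1 : 1 ≤ r) {f : Vec d → ℝ} (h : MemHs U r f) : MemH1 U f := by
  have hf : ⌊r⌋₊ ≠ 0 := by
    have := (Nat.one_le_floor_iff r).2 h1
    omega
  obtain ⟨m, hm⟩ := Nat.exists_eq_succ_of_ne_zero hf
  rw [MemHs, hm] at h
  exact ⟨h.1, fun i => by
    obtain ⟨g, h1, h2⟩ := h.2 i
    exact ⟨g, h1, h2.memLp⟩⟩

theorem memHs_one_iff {f : Vec d → ℝ} : MemHs U 1 f ↔ MemH1 U f := by
  simp [MemHs, MemH1, MemSob]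

theorem hsSq_one (f : Vec d → ℝ) :
    hsSq U 1 f = (∫⁻ x in U, ‖f x‖ₑ ^ 2) + ∑ i, ∫⁻ x in U, ‖weakPartial U i f x‖ₑ ^ 2 := by
  simp [hsSq, sobSq]

theorem hsSq_one_le {r : ℝ} (h1 : 1 ≤ r) (f : Vec d → ℝ) : hsSq U 1 f ≤ hsSq U r f := by
  have hf : ⌊r⌋₊ ≠ 0 := by
    have := (Nat.one_le_floor_iff r).2 h1
    omega
  obtain ⟨m, hm⟩ := Nat.exists_eq_succ_of_ne_zero hf
  rw [hsSq_one, hsSq, hm]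
  exact add_le_add le_rfl (Finset.sum_le_sum fun i _ => lintegral_le_sobSq _ _ _)

theorem MemHs.memLp {r : ℝ} {f : Vec d → ℝ} (h : MemHs U r f) :
    MemLp f 2 (volume.restrict U) := MemSob.memLp h

theorem MemHs.congr {r : ℝ} {f f' : Vec d → ℝ}
    (hf : f =ᵐ[volume.restrict U] f') (h : MemHs U r f) : MemHs U r f' := by
  unfold MemHs at h ⊢
  cases hm : ⌊r⌋₊ with
  | zero =>
    rw [hm] at h
    refine ⟨h.1.ae_eq hf, fun hθ => ?_⟩
    have := h.2 hθ
    have e : gagliardoSq U (Int.fract r) f = gagliardoSq U (Int.fract r) f' := by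
      refine lintegral_congr_ae ?_
      filter_upwards [hf] with x hx
      refine lintegral_congr_ae ?_
      filter_upwards [hf] with y hy
      rw [hx, hy]
    rwa [← e]
  | succ m =>
    rw [hm] at h
    refine ⟨h.1.ae_eq hf, fun i => ?_⟩
    obtain ⟨g, h1, h2⟩ := h.2 i
    exact ⟨g, h1.congr hf (EventuallyEq.refl _ _), h2⟩

theorem hsSq_congr {r : ℝ} {f f' : Vec d → ℝ}
    (hf : f =ᵐ[volume.restrict U] f') : hsSq U r f = hsSq U r f' := by
  have e1 : ∫⁻ x in U, ‖f x‖ₑ ^ 2 = ∫⁻ x in U, ‖f' x‖ₑ ^ 2 :=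
    lintegral_congr_ae (by filter_upwards [hf] with x hx; rw [hx])
  unfold hsSq
  cases hm : ⌊r⌋₊ with
  | zero =>
    have e : gagliardoSq U (Int.fract r) f = gagliardoSq U (Int.fract r) f' := by
      refine lintegral_congr_ae ?_
      filter_upwards [hf] with x hx
      refine lintegral_congr_ae ?_
      filter_upwards [hf] with y hy
      rw [hx, hy]
    simp only [sobSq, e1, e]
  | succ m =>
    simp only [sobSq, e1, weakPartial_congr hf]

theorem HasTrace.congr {F : Set (Vec d)} {f f' g g' : Vec d → ℝ}
    (hf : f =ᵐ[volume.restrict U] f') (hg : g =ᵐ[(surf d).restrict F] g') (h : HasTrace U F f g) :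
    HasTrace U F f' g' := by
  obtain ⟨h1, r, hr, hm, φ, hφ, ht, ht'⟩ := h
  refine ⟨h1.ae_eq hg, r, hr, hm.congr hf, φ, hφ, ht.congr fun n => hsSq_congr ?_,
    ht'.congr fun n => eLpNorm_congr_ae ?_⟩
  · filter_upwards [hf] with x hx
    rw [hx]
  · filter_upwards [hg] with x hx
    rw [hx]

theorem MemH1.mono {f : Vec d → ℝ} (h : MemH1 U f) (hVU : V ⊆ U) : MemH1 V f := by
  have hle : (volume : Measure (Vec d)).restrict V ≤ volume.restrict U :=
    Measure.restrict_mono hVU le_rfl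
  refine ⟨h.1.mono_measure hle, fun i => ?_⟩
  obtain ⟨g, h1, h2⟩ := h.2 i
  exact ⟨g, h1.mono hVU, h2.mono_measure hle⟩

theorem gagliardoSq_mono {θ : ℝ} {f : Vec d → ℝ} (hVU : V ⊆ U) :
    gagliardoSq V θ f ≤ gagliardoSq U θ f :=
  (lintegral_mono fun _ => lintegral_mono_set hVU).trans (lintegral_mono_set hVU)

/-- Traces of functions on `U` are traces of their restrictions to subsets of `U`. -/
theorem HasTrace.mono {F F' : Set (Vec d)} {f g : Vec d → ℝ} (h : HasTrace U F f g) (hU : IsOpen U)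
    (hVU : V ⊆ U) (hV : IsOpen V) (hF : F' ⊆ F) : HasTrace V F' f g := by
  obtain ⟨h1, r, hr, hm, φ, hφ, ht, ht'⟩ := h
  have hle : (surf d).restrict F' ≤ (surf d).restrict F := Measure.restrict_mono hF le_rfl
  have hle2 : (volume : Measure (Vec d)).restrict V ≤ volume.restrict U :=
    Measure.restrict_mono hVU le_rfl
  refine ⟨h1.mono_measure hle, ?_⟩
  have ht2 : Tendsto (fun n => eLpNorm (fun x => φ n x - g x) 2 ((surf d).restrict F')) atTop (𝓝 0) :=
    tendsto_of_tendsto_of_tendsto_of_le_of_le tendsto_const_nhds ht' (fun _ => zero_le)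
      (fun n => eLpNorm_mono_measure _ hle)
  rcases lt_or_ge r 1 with hr1 | hr1
  · have h0 : 0 < r := by linarith
    refine ⟨r, hr, ?_, φ, hφ, ?_, ht2⟩
    · rw [memHs_iff_of_lt h0 hr1] at hm ⊢
      exact ⟨hm.1.mono_measure hle2, (gagliardoSq_mono hVU).trans_lt hm.2⟩
    · refine tendsto_of_tendsto_of_tendsto_of_le_of_le tendsto_const_nhds ht (fun _ => zero_le)
        (fun n => ?_)
      simp only [hsSq_of_lt h0 hr1]
      exact add_le_add (lintegral_mono_set hVU) (gagliardoSq_mono hVU)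
  · have hH := hm.memH1 hr1
    refine ⟨1, by norm_num, memHs_one_iff.2 (hH.mono hVU), φ, hφ, ?_, ht2⟩
    refine tendsto_of_tendsto_of_tendsto_of_le_of_le tendsto_const_nhds ht (fun _ => zero_le)
      (fun n => (le_trans ?_ (hsSq_one_le hr1 _)))
    simp only [hsSq_one]
    refine add_le_add (lintegral_mono_set hVU) (Finset.sum_le_sum fun i _ => ?_)
    obtain ⟨g', hg', -⟩ := hH.2 i
    have hw := (HasWeakPartial.of_contDiff (U := U) i ((hφ n).of_le (by simp))).sub hg'
    have e := (hw.mono hVU).weakPartial_ae_eq hV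
    have e' := ae_mono hle2 (hw.weakPartial_ae_eq hU)
    refine le_trans (lintegral_congr_ae ?_).le (lintegral_mono_set hVU)
    filter_upwards [e, e'] with x hx hx'
    rw [hx, hx']

end HDG

namespace HDG
variable {d : ℕ}

/-! ### Averages over contractions -/

theorem eLpNorm_two_sq {α E : Type*} [MeasurableSpace α] [NormedAddCommGroup E] (μ : Measure α)
    (f : α → E) : eLpNorm f 2 μ ^ 2 = ∫⁻ x, ‖f x‖ₑ ^ 2 ∂μ := by
  have := eLpNorm_nnreal_pow_eq_lintegral (f := f) (μ := μ) (p := 2) two_ne_zero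
  simp only [NNReal.coe_ofNat, ENNReal.rpow_ofNat, ENNReal.coe_ofNat] at this
  exact this

theorem tendsto_zero_of_sq {α : Type*} {l : Filter α} {u : α → ℝ≥0∞}
    (h : Tendsto (fun a => u a ^ 2) l (𝓝 0)) : Tendsto u l (𝓝 0) := by
  have h3 := h.ennrpow_const (1 / 2)
  have e : ∀ a, (u a ^ 2) ^ (1 / 2 : ℝ) = u a := fun a => by
    rw [← ENNReal.rpow_natCast, ← ENNReal.rpow_mul]
    norm_num
  simp_rw [e] at h3
  simpa using h3

/-- Jensen's inequality for the square. It holds without integrability: otherwise the right-hand side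
is infinite. -/
theorem enorm_integral_sub_sq_le {W : Type*} [MeasurableSpace W] {P : Measure W}
    [IsProbabilityMeasure P] {h : W → ℝ} (hm : AEStronglyMeasurable h P) (a : ℝ) :
    ‖∫ w, h w ∂P - a‖ₑ ^ 2 ≤ ∫⁻ w, ‖h w - a‖ₑ ^ 2 ∂P := by
  have hm' : AEStronglyMeasurable (fun w => h w - a) P := hm.sub aestronglyMeasurable_const
  by_cases hi : Integrable h P
  · have e : ∫ w, h w ∂P - a = ∫ w, (h w - a) ∂P := by
      rw [integral_sub hi (integrable_const a)]; simp
    rw [e]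
    have h1 : ‖∫ w, (h w - a) ∂P‖ₑ ≤ eLpNorm (fun w => h w - a) 2 P := by
      refine (enorm_integral_le_lintegral_enorm _).trans ?_
      rw [← eLpNorm_one_eq_lintegral_enorm]
      exact eLpNorm_le_eLpNorm_of_exponent_le one_le_two hm'
    rw [← eLpNorm_two_sq]
    gcongr
  · have : ∫⁻ w, ‖h w - a‖ₑ ^ 2 ∂P = ⊤ := by
      by_contra hne
      apply hi
      have h2 : MemLp (fun w => h w - a) 2 P := by
        refine ⟨hm', ?_⟩
        by_contra hcon
        rw [not_lt, top_le_iff] at hcon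
        apply hne
        rw [← eLpNorm_two_sq, hcon]
        simp
      have h3 := (h2.integrable one_le_two).add (integrable_const a)
      refine h3.congr (Eventually.of_forall fun w => ?_)
      simp
    rw [this]
    exact le_top

section Average

variable {E : Type*} [NormedAddCommGroup E] [NormedSpace ℝ E] [FiniteDimensional ℝ E]
  [MeasurableSpace E] [BorelSpace E] (μ : Measure E) [μ.IsAddHaarMeasure]

theorem lintegral_comp_affine {H : E → ℝ≥0∞} (hH : Measurable H) {c : ℝ} (hc : c ≠ 0) (v : E) :
    ∫⁻ x, H (c • x + v) ∂μ = ENNReal.ofReal |(c ^ Module.finrank ℝ E)⁻¹| * ∫⁻ x, H x ∂μ := by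
  have h1 : Measurable (fun x => H (x + v)) := hH.comp (measurable_add_const v)
  have h2 : Measurable (fun x : E => c • x) := measurable_const_smul c
  calc ∫⁻ x, H (c • x + v) ∂μ = ∫⁻ x, H (x + v) ∂(Measure.map (fun x : E => c • x) μ) :=
        (lintegral_map h1 h2).symm
    _ = _ := by
        rw [Measure.map_addHaar_smul μ hc, lintegral_smul_measure, smul_eq_mul,
          lintegral_add_right_eq_self]

theorem eLpNorm_comp_affine_le (S : Set E) {h : E → ℝ} (hm : Measurable h)
    {ε : ℝ} (h1 : ε ≤ 1 / 2) (v : E) :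
    eLpNorm (fun x => h ((1 - ε) • x + v)) 2 (μ.restrict S) ≤
      2 ^ Module.finrank ℝ E * eLpNorm h 2 μ := by
  have hε : 0 < 1 - ε := by linarith
  rw [← ENNReal.pow_le_pow_left_iff (n := 2) two_ne_zero, mul_pow, eLpNorm_two_sq, eLpNorm_two_sq]
  calc ∫⁻ x in S, ‖h ((1 - ε) • x + v)‖ₑ ^ 2 ∂μ ≤ ∫⁻ x, ‖h ((1 - ε) • x + v)‖ₑ ^ 2 ∂μ :=
        setLIntegral_le_lintegral _ _
    _ = ENNReal.ofReal |((1 - ε) ^ Module.finrank ℝ E)⁻¹| * ∫⁻ x, ‖h x‖ₑ ^ 2 ∂μ :=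
        lintegral_comp_affine μ (H := fun x => ‖h x‖ₑ ^ 2) (by fun_prop) hε.ne' v
    _ ≤ _ := by
        gcongr
        have h2 : |((1 - ε) ^ Module.finrank ℝ E)⁻¹| ≤ 2 ^ Module.finrank ℝ E := by
          rw [abs_of_pos (by positivity), ← inv_pow]
          refine pow_le_pow_left₀ (by positivity) ?_ _
          rw [inv_le_comm₀ hε two_pos]
          linarith
        refine (ENNReal.ofReal_le_ofReal h2).trans ?_
        rw [ENNReal.ofReal_pow zero_le_two]
        simp only [ENNReal.ofReal_ofNat]
        have h3 : (1 : ℝ≥0∞) ≤ 2 ^ Module.finrank ℝ E := one_le_pow₀ one_le_two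
        calc (2 : ℝ≥0∞) ^ Module.finrank ℝ E = (2 ^ Module.finrank ℝ E) ^ 1 := (pow_one _).symm
          _ ≤ _ := pow_le_pow_right₀ h3 one_le_two

/-- Averages of `V` over the contractions `x ↦ (1 - ε) x + ε ℓ(w)` of a convex set converge to `V`
in `L²` as `ε → 0`. -/
theorem tendsto_average {W : Type*} [MeasurableSpace W] {P : Measure W} [IsProbabilityMeasure P]
    {S : Set E} (hS : MeasurableSet S) (hc : Convex ℝ S) (hb : Bornology.IsBounded S) {ℓ : W → E}
    (hℓ : Measurable ℓ) (hℓS : ∀ᵐ w ∂P, ℓ w ∈ S) {V : E → ℝ} (hV : Measurable V)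
    (hV2 : MemLp V 2 (μ.restrict S)) :
    Tendsto (fun ε : ℝ => ∫⁻ x in S, ‖∫ w, V ((1 - ε) • x + ε • ℓ w) ∂P - V x‖ₑ ^ 2 ∂μ)
      (𝓝[>] 0) (𝓝 0) := by
  have hμS : μ S ≠ ⊤ := hb.measure_lt_top.ne
  have : IsFiniteMeasure (μ.restrict S) := ⟨by simpa using hμS.lt_top⟩
  rw [ENNReal.tendsto_nhds_zero]
  intro η hη
  rcases eq_or_ne η ⊤ with rfl | hηtop
  · simp
  obtain ⟨σ, hσ0, hση⟩ : ∃ σ : ℝ≥0∞, σ ≠ 0 ∧ σ ^ 2 ≤ η := by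
    refine ⟨η ^ (1 / 2 : ℝ), ?_, ?_⟩
    · simp [hη.ne', hηtop]
    · rw [← ENNReal.rpow_natCast, ← ENNReal.rpow_mul]
      norm_num
  set N : ℝ≥0∞ := 2 ^ Module.finrank ℝ E with hN
  have hNtop : N + 1 ≠ ⊤ := by simp [hN]
  have hσ2 : σ / 2 ≠ 0 := (ENNReal.half_pos hσ0).ne'
  obtain ⟨κ, hκ0, hκ⟩ := ENNReal.exists_nnreal_pos_mul_lt hNtop hσ2
  have hμtop : (μ.restrict S) univ ^ (2 : ℝ≥0∞).toReal⁻¹ ≠ ⊤ :=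
    ENNReal.rpow_ne_top_of_nonneg (by simp) (measure_ne_top _ _)
  obtain ⟨ω, hω0, hω⟩ := ENNReal.exists_nnreal_pos_mul_lt hμtop hσ2
  -- approximation of `V` by a uniformly continuous function
  have hV' : MemLp (S.indicator V) 2 μ := (memLp_indicator_iff_restrict hS).2 hV2
  obtain ⟨g, hgc, hgV, hgcont, hg2⟩ := hV'.exists_hasCompactSupport_eLpNorm_sub_le (by simp)
    (ENNReal.coe_ne_zero.2 hκ0.ne')
  have huc : UniformContinuous g := hgc.uniformContinuous_of_continuous hgcont
  obtain ⟨δ, hδ, hgδ⟩ := Metric.uniformContinuous_iff.1 huc ω (by exact_mod_cast hω0)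
  obtain ⟨R, hR⟩ := hb.exists_norm_le
  have hRpos : 0 < 2 * |R| + 1 := by positivity
  have hev : ∀ᶠ ε in 𝓝[>] (0 : ℝ), ε ∈ Ioo 0 (min (1 / 2) (δ / (2 * |R| + 1))) :=
    Ioo_mem_nhdsGT (by positivity)
  filter_upwards [hev] with ε hε
  obtain ⟨hε0, hε1⟩ := hε
  have hε2 : ε ≤ 1 / 2 := (hε1.le).trans (min_le_left _ _)
  have hε3 : ε * (2 * |R| + 1) < δ := by
    rw [← lt_div_iff₀ hRpos]
    exact hε1.trans_le (min_le_right _ _)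
  have hA : ∀ s ∈ S, ∀ x ∈ S, (1 - ε) • x + ε • s ∈ S := fun s hs x hx =>
    hc hx hs (by linarith) hε0.le (by ring)
  have hjm : Measurable (fun z : E × W => V ((1 - ε) • z.1 + ε • ℓ z.2)) := by fun_prop
  have hw : ∀ s ∈ S, eLpNorm (fun x => V ((1 - ε) • x + ε • s) - V x) 2 (μ.restrict S) ≤ σ := by
    intro s hs
    have hVi : Measurable (S.indicator V) := hV.indicator hS
    have hgm := hgcont.measurable
    have e1 : eLpNorm (fun x => V ((1 - ε) • x + ε • s) - V x) 2 (μ.restrict S) =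
        eLpNorm (fun x => ((S.indicator V - g) ((1 - ε) • x + ε • s) +
          (g ((1 - ε) • x + ε • s) - g x)) - (S.indicator V - g) x) 2 (μ.restrict S) := by
      refine eLpNorm_congr_ae ?_
      filter_upwards [ae_restrict_mem hS] with x hx
      simp [indicator_of_mem hx, indicator_of_mem (hA s hs x hx)]
    rw [e1]
    have b1 : eLpNorm (fun x => (S.indicator V - g) ((1 - ε) • x + ε • s)) 2 (μ.restrict S) ≤
        N * κ := (eLpNorm_comp_affine_le μ S (hVi.sub hgm) hε2 _).trans (by gcongr)
    have b2 : eLpNorm (fun x => g ((1 - ε) • x + ε • s) - g x) 2 (μ.restrict S) ≤ σ / 2 := by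
      refine (eLpNorm_le_of_ae_bound (C := ω) ?_).trans ?_
      · filter_upwards [ae_restrict_mem hS] with x hx
        rw [← dist_eq_norm]
        refine (hgδ ?_).le
        rw [dist_eq_norm]
        have : (1 - ε) • x + ε • s - x = ε • (s - x) := by module
        rw [this, norm_smul, Real.norm_eq_abs, abs_of_pos hε0]
        refine lt_of_le_of_lt ?_ hε3
        gcongr
        have := norm_sub_le s x
        linarith [hR s hs, hR x hx, le_abs_self R]
      · rw [mul_comm]
        simpa using hω.le
    have b3 : eLpNorm (S.indicator V - g) 2 (μ.restrict S) ≤ κ :=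
      (eLpNorm_mono_measure _ Measure.restrict_le_self).trans hgV
    have m1 : AEStronglyMeasurable (fun x => (S.indicator V - g) ((1 - ε) • x + ε • s))
        (μ.restrict S) := ((hVi.sub hgm).comp (by fun_prop)).aestronglyMeasurable
    have m2 : AEStronglyMeasurable (fun x => g ((1 - ε) • x + ε • s) - g x) (μ.restrict S) := by
      apply Measurable.aestronglyMeasurable
      fun_prop
    have m3 : AEStronglyMeasurable (S.indicator V - g) (μ.restrict S) :=
      (hVi.sub hgm).aestronglyMeasurable
    calc _ ≤ eLpNorm (fun x => ((S.indicator V - g) ((1 - ε) • x + ε • s) +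
          (g ((1 - ε) • x + ε • s) - g x))) 2 (μ.restrict S) +
          eLpNorm (S.indicator V - g) 2 (μ.restrict S) := eLpNorm_sub_le (m1.add m2) m3 one_le_two
      _ ≤ (N * κ + σ / 2) + κ := by
          refine add_le_add ((eLpNorm_add_le m1 m2 one_le_two).trans (add_le_add b1 b2)) b3
      _ = κ * (N + 1) + σ / 2 := by ring
      _ ≤ σ / 2 + σ / 2 := by gcongr
      _ = σ := ENNReal.add_halves σ
  calc ∫⁻ x in S, ‖∫ w, V ((1 - ε) • x + ε • ℓ w) ∂P - V x‖ₑ ^ 2 ∂μ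
      ≤ ∫⁻ x in S, ∫⁻ w, ‖V ((1 - ε) • x + ε • ℓ w) - V x‖ₑ ^ 2 ∂P ∂μ := by
        refine lintegral_mono fun x => enorm_integral_sub_sq_le ?_ _
        exact (hjm.comp measurable_prodMk_left).aestronglyMeasurable
    _ = ∫⁻ w, ∫⁻ x in S, ‖V ((1 - ε) • x + ε • ℓ w) - V x‖ₑ ^ 2 ∂μ ∂P := by
        apply lintegral_lintegral_swap
        apply Measurable.aemeasurable
        have : Measurable (fun z : E × W => V ((1 - ε) • z.1 + ε • ℓ z.2) - V z.1) := by fun_prop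
        exact this.enorm.pow_const 2
    _ ≤ ∫⁻ w, η ∂P := by
        refine lintegral_mono_ae ?_
        filter_upwards [hℓS] with w hwS
        rw [← eLpNorm_two_sq]
        exact le_trans (by gcongr; exact hw _ hwS) hση
    _ = η := by simp

end Average

end HDG

namespace HDG
variable {d : ℕ}

/-! ### Smoothing by averaged contractions -/

/-- The probability measure whose density is a normalized bump function. -/
noncomputable def avg {x₀ : Vec d} (b : ContDiffBump x₀) : Measure (Vec d) :=
  volume.withDensity fun w => ENNReal.ofReal (b.normed volume w)

/-- The average of `f` over the contractions `x ↦ (1 - ε) x + ε w` of a convex set `U`, the centre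
`w` being distributed according to `avg b`. Values of `f` outside `U` are ignored. -/
noncomputable def smoothing (U : Set (Vec d)) {x₀ : Vec d} (b : ContDiffBump x₀) (ε : ℝ)
    (f : Vec d → ℝ) (x : Vec d) : ℝ :=
  ∫ w, U.indicator f ((1 - ε) • x + ε • w) ∂avg b

/-- The kernel of the smoothing operator, as a function of `(1 - ε) x - y`. -/
noncomputable def kernel {x₀ : Vec d} (b : ContDiffBump x₀) (ε : ℝ) (z : Vec d) : ℝ :=
  |(ε ^ d)⁻¹| * b.normed volume (-(ε⁻¹ • z))

variable {U : Set (Vec d)} {x₀ : Vec d} (b : ContDiffBump x₀) {ε : ℝ} {f : Vec d → ℝ}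

theorem measurable_density : Measurable fun w => ENNReal.ofReal (b.normed volume w) :=
  ENNReal.measurable_ofReal.comp b.continuous_normed.measurable

instance isProbabilityMeasure_avg : IsProbabilityMeasure (avg b) := by
  constructor
  rw [avg, withDensity_apply _ MeasurableSet.univ, Measure.restrict_univ,
    ← ofReal_integral_eq_lintegral_ofReal b.integrable_normed
      (Eventually.of_forall fun x => b.nonneg_normed x), b.integral_normed, ENNReal.ofReal_one]

/-- The density of `avg b` is bounded. -/
theorem avg_le : ∃ M : ℝ≥0∞, M ≠ ⊤ ∧ avg b ≤ M • volume := by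
  obtain ⟨C, hC⟩ := b.continuous_normed.bounded_above_of_compact_support
    (b.hasCompactSupport_normed (μ := volume))
  refine ⟨ENNReal.ofReal C, ENNReal.ofReal_ne_top, ?_⟩
  rw [avg, ← withDensity_const]
  refine withDensity_mono (Eventually.of_forall fun w => ENNReal.ofReal_le_ofReal ?_)
  exact (le_abs_self _).trans (hC w)

theorem ae_avg_mem (hb : Metric.closedBall x₀ b.rOut ⊆ U) : ∀ᵐ w ∂avg b, w ∈ U := by
  rw [avg, ae_withDensity_iff (measurable_density b)]
  refine Eventually.of_forall fun w hw => hb (Metric.ball_subset_closedBall ?_)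
  rw [← b.support_normed_eq (μ := volume)]
  intro h0
  exact hw (by rw [h0]; simp)

theorem contraction_mem (hUc : Convex ℝ U) {x w : Vec d} (hx : x ∈ U) (hw : w ∈ U)
    (h0 : 0 ≤ ε) (h1 : ε ≤ 1) : (1 - ε) • x + ε • w ∈ U :=
  hUc hx hw (by linarith) h0 (by ring)

theorem integrable_avg_comp (hU : MeasurableSet U) (hf : IntegrableOn f U) (h0 : ε ≠ 0) (v : Vec d) :
    Integrable (fun w => U.indicator f (v + ε • w)) (avg b) := by
  obtain ⟨M, hM, hle⟩ := avg_le b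
  have h1 : Integrable (U.indicator f) volume := (integrable_indicator_iff hU).2 hf
  have h2 : Integrable (fun w => U.indicator f (v + ε • w)) volume :=
    (h1.comp_add_left v).comp_smul h0
  exact (h2.smul_measure hM).mono_measure hle

theorem smoothing_eq_integral (hU : MeasurableSet U) (h0 : 0 < ε) (x : Vec d) :
    smoothing U b ε f x = ∫ y in U, f y * kernel b ε ((1 - ε) • x - y) := by
  set v := (1 - ε) • x with hv
  rw [smoothing, avg, integral_withDensity_eq_integral_toReal_smul (measurable_density b)
    (Eventually.of_forall fun _ => ENNReal.ofReal_lt_top), ← integral_indicator hU]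
  let H : Vec d → ℝ := fun y => b.normed volume (ε⁻¹ • (y - v)) * U.indicator f y
  have e1 : ∀ w, (ENNReal.ofReal (b.normed volume w)).toReal • U.indicator f (v + ε • w) =
      H (v + ε • w) := by
    intro w
    rw [ENNReal.toReal_ofReal (b.nonneg_normed w)]
    simp [H, smul_smul, inv_mul_cancel₀ h0.ne']
  rw [integral_congr_ae (Eventually.of_forall e1)]
  rw [Measure.integral_comp_smul volume (fun y => H (v + y)) ε, integral_add_left_eq_self H v,
    smul_eq_mul, ← integral_const_mul]
  refine integral_congr_ae (Eventually.of_forall fun y => ?_)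
  by_cases hy : y ∈ U
  · simp only [H, indicator_of_mem hy, kernel]
    have : -(ε⁻¹ • (v - y)) = ε⁻¹ • (y - v) := by module
    rw [this]
    simp
    ring
  · simp [H, indicator_of_notMem hy]

theorem contDiff_kernel (ε : ℝ) : ContDiff ℝ (⊤ : ℕ∞) (kernel b ε) := by
  unfold kernel
  have := b.contDiff_normed (μ := volume) (n := ⊤)
  exact contDiff_const.mul (this.comp (by fun_prop))

theorem hasCompactSupport_kernel (h0 : 0 < ε) : HasCompactSupport (kernel b ε) := by
  have h1 : HasCompactSupport (fun z : Vec d => b.normed volume (-(ε⁻¹ • z))) := by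
    have h2 : ε⁻¹ ≠ 0 := inv_ne_zero h0.ne'
    have := (b.hasCompactSupport_normed (μ := volume)).comp_homeomorph
      ((Homeomorph.smulOfNeZero ε⁻¹ h2).trans (Homeomorph.neg (Vec d)))
    exact this
  exact h1.mul_left

theorem smoothing_eq_convolution (hU : MeasurableSet U) (h0 : 0 < ε) :
    smoothing U b ε f = fun x => (convolution (U.indicator f) (kernel b ε)
      (ContinuousLinearMap.mul ℝ ℝ) volume) ((1 - ε) • x) := by
  ext x
  rw [smoothing_eq_integral b hU h0, convolution_def, ← integral_indicator hU]
  refine integral_congr_ae (Eventually.of_forall fun y => ?_)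
  by_cases hy : y ∈ U
  · simp [indicator_of_mem hy]
  · simp [indicator_of_notMem hy]

theorem contDiff_smoothing (hU : MeasurableSet U) (hf : IntegrableOn f U) (h0 : 0 < ε) :
    ContDiff ℝ (⊤ : ℕ∞) (smoothing U b ε f) := by
  rw [smoothing_eq_convolution b hU h0]
  have h1 : Integrable (U.indicator f) volume := (integrable_indicator_iff hU).2 hf
  have := (hasCompactSupport_kernel b h0).contDiff_convolution_right
    (ContinuousLinearMap.mul ℝ ℝ) h1.locallyIntegrable (contDiff_kernel b ε)
  exact this.comp (by fun_prop)

theorem fderiv_smoothing (hU : MeasurableSet U) (hf : IntegrableOn f U) (h0 : 0 < ε) (x v : Vec d) :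
    fderiv ℝ (smoothing U b ε f) x v =
      (1 - ε) * ∫ y in U, f y * fderiv ℝ (kernel b ε) ((1 - ε) • x - y) v := by
  rw [smoothing_eq_convolution b hU h0]
  have h1 : Integrable (U.indicator f) volume := (integrable_indicator_iff hU).2 hf
  have hk : ContDiff ℝ 1 (kernel b ε) := (contDiff_kernel b ε).of_le (by simp)
  have hd := (hasCompactSupport_kernel b h0).hasFDerivAt_convolution_right
    (ContinuousLinearMap.mul ℝ ℝ) h1.locallyIntegrable hk ((1 - ε) • x)
  have hs : HasFDerivAt (fun x : Vec d => (1 - ε) • x) ((1 - ε) • ContinuousLinearMap.id ℝ (Vec d)) x :=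
    ((1 - ε) • ContinuousLinearMap.id ℝ (Vec d)).hasFDerivAt
  have hcomp := hd.comp x hs
  have e := hcomp.fderiv
  simp only [Function.comp_def] at e
  rw [e, ContinuousLinearMap.comp_apply]
  simp only [smul_apply, ContinuousLinearMap.id_apply, map_smul, smul_eq_mul]
  congr 1
  rw [convolution_precompR_apply (ContinuousLinearMap.mul ℝ ℝ) h1.locallyIntegrable
    ((hasCompactSupport_kernel b h0).fderiv ℝ) (hk.continuous_fderiv one_ne_zero),
    convolution_def, ← integral_indicator hU]
  refine integral_congr_ae (Eventually.of_forall fun y => ?_)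
  by_cases hy : y ∈ U
  · simp [indicator_of_mem hy]
  · simp [indicator_of_notMem hy]

/-- At points of `U` the kernel is a test function in the variable of integration. -/
theorem isTest_kernel (hUc : Convex ℝ U) (hb : Metric.closedBall x₀ b.rOut ⊆ U) (h0 : 0 < ε)
    (h1 : ε ≤ 1) {x : Vec d} (hx : x ∈ U) :
    IsTest U (fun y => kernel b ε ((1 - ε) • x - y)) := by
  let T : Set (Vec d) := (fun w => (1 - ε) • x + ε • w) '' Metric.closedBall x₀ b.rOut
  have hT : IsCompact T := (isCompact_closedBall x₀ b.rOut).image (by fun_prop)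
  have hsub : tsupport (fun y => kernel b ε ((1 - ε) • x - y)) ⊆ T := by
    refine closure_minimal (fun y hy => ?_) hT.isClosed
    have h2 : b.normed volume (-(ε⁻¹ • ((1 - ε) • x - y))) ≠ 0 := by
      intro h
      apply hy
      simp [kernel, h]
    have h3 : -(ε⁻¹ • ((1 - ε) • x - y)) ∈ Metric.ball x₀ b.rOut := by
      rw [← b.support_normed_eq (μ := volume)]
      exact h2
    refine ⟨_, Metric.ball_subset_closedBall h3, ?_⟩
    simp only [smul_neg, smul_smul, mul_inv_cancel₀ h0.ne']
    module
  refine ⟨(contDiff_kernel b ε).comp (by fun_prop), hT.of_isClosed_subset (isClosed_tsupport _) hsub,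
    hsub.trans ?_⟩
  rintro _ ⟨w, hw, rfl⟩
  exact contraction_mem hUc hx (hb hw) h0.le h1

theorem integral_fderiv_kernel (hUo : IsOpen U) (hUc : Convex ℝ U)
    (hb : Metric.closedBall x₀ b.rOut ⊆ U) (h0 : 0 < ε) (h1 : ε ≤ 1) {q : Vec d → Vec d}
    {g : Vec d → ℝ} (hq : HasWeakDiv U q g) {x : Vec d} (hx : x ∈ U) :
    ∫ y in U, fderiv ℝ (kernel b ε) ((1 - ε) • x - y) (q y) = smoothing U b ε g x := by
  have ht := isTest_kernel b hUc hb h0 h1 hx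
  have h2 := hq.2.2 _ ht
  have e : ∀ y, fderiv ℝ (fun y => kernel b ε ((1 - ε) • x - y)) y =
      -fderiv ℝ (kernel b ε) ((1 - ε) • x - y) := by
    intro y
    have hk : DifferentiableAt ℝ (kernel b ε) ((1 - ε) • x - y) :=
      (contDiff_kernel b ε).differentiable (by simp) _
    have := hk.hasFDerivAt.comp y ((hasFDerivAt_id y).const_sub ((1 - ε) • x))
    rw [show (fun y => kernel b ε ((1 - ε) • x - y)) = kernel b ε ∘ fun y => (1 - ε) • x - y from rfl,
      HasFDerivAt.fderiv this]
    ext v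
    simp
  rw [smoothing_eq_integral b hUo.measurableSet h0, ← neg_inj, ← h2, ← integral_neg]
  simp [e]

/-- Smoothing commutes with the weak divergence, up to the factor `1 - ε`. -/
theorem div_smoothing (hUo : IsOpen U) (hUc : Convex ℝ U)
    (hb : Metric.closedBall x₀ b.rOut ⊆ U) (h0 : 0 < ε) (h1 : ε ≤ 1) {q : Vec d → Vec d}
    {g : Vec d → ℝ} (hq : HasWeakDiv U q g) (hqi : ∀ i, IntegrableOn (compV q i) U)
    {x : Vec d} (hx : x ∈ U) :
    ∑ i, fderiv ℝ (smoothing U b ε (compV q i)) x (EuclideanSpace.single i 1) =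
      (1 - ε) * smoothing U b ε g x := by
  rw [← integral_fderiv_kernel b hUo hUc hb h0 h1 hq hx]
  simp_rw [fun i => fderiv_smoothing b hUo.measurableSet (hqi i) h0 x (EuclideanSpace.single i 1)]
  rw [← Finset.mul_sum, ← integral_finsetSum]
  · congr 1
    refine integral_congr_ae (Eventually.of_forall fun y => ?_)
    exact (fderiv_apply_eq_sum (kernel b ε) _ (q y)).symm
  · intro i _
    have hk : ContDiff ℝ 1 (kernel b ε) := (contDiff_kernel b ε).of_le (by simp)
    have hc : Continuous (fun z => fderiv ℝ (kernel b ε) z (EuclideanSpace.single i 1)) := by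
      have := hk.continuous_fderiv one_ne_zero
      fun_prop
    obtain ⟨C, hC⟩ := hc.bounded_above_of_compact_support
      ((hasCompactSupport_kernel b h0).fderiv_apply ℝ (EuclideanSpace.single i 1))
    refine Integrable.mul_bdd (hqi i) (c := C) ?_ (Eventually.of_forall fun y => hC _)
    exact (hc.comp (by fun_prop : Continuous fun y => (1 - ε) • x - y)).aestronglyMeasurable

/-- Smoothing commutes with weak partial derivatives, up to the factor `1 - ε`. -/
theorem partial_smoothing (hUo : IsOpen U) (hUc : Convex ℝ U)
    (hb : Metric.closedBall x₀ b.rOut ⊆ U) (h0 : 0 < ε) (h1 : ε ≤ 1) {i : Fin d}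
    {g : Vec d → ℝ} (hf : HasWeakPartial U i f g) (hfi : IntegrableOn f U) {x : Vec d} (hx : x ∈ U) :
    fderiv ℝ (smoothing U b ε f) x (EuclideanSpace.single i 1) = (1 - ε) * smoothing U b ε g x := by
  rw [← integral_fderiv_kernel b hUo hUc hb h0 h1 hf.hasWeakDiv_smul hx,
    fderiv_smoothing b hUo.measurableSet hfi h0]
  simp only [map_smul, smul_eq_mul]

theorem smoothing_sub (hU : MeasurableSet U) {g : Vec d → ℝ} (hf : IntegrableOn f U)
    (hg : IntegrableOn g U) (h0 : ε ≠ 0) (x : Vec d) :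
    smoothing U b ε (fun y => f y - g y) x = smoothing U b ε f x - smoothing U b ε g x := by
  rw [smoothing, smoothing, smoothing, ← integral_sub (integrable_avg_comp b hU hf h0 _)
    (integrable_avg_comp b hU hg h0 _)]
  refine integral_congr_ae (Eventually.of_forall fun w => ?_)
  by_cases h : (1 - ε) • x + ε • w ∈ U
  · simp [indicator_of_mem h]
  · simp [indicator_of_notMem h]

theorem smoothing_congr (hU : MeasurableSet U) {f' : Vec d → ℝ} (hf : f =ᵐ[volume.restrict U] f')
    (h0 : 0 < ε) : smoothing U b ε f = smoothing U b ε f' := by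
  ext x
  rw [smoothing_eq_integral b hU h0, smoothing_eq_integral b hU h0]
  refine integral_congr_ae ?_
  filter_upwards [hf] with y hy
  rw [hy]

/-- `L²` convergence of the smoothing operators. -/
theorem tendsto_smoothing (hUo : IsOpen U) (hUc : Convex ℝ U) (hUb : Bornology.IsBounded U)
    (hb : Metric.closedBall x₀ b.rOut ⊆ U) (hf : Measurable f) (hf2 : MemLp f 2 (volume.restrict U)) :
    Tendsto (fun ε => eLpNorm (fun x => smoothing U b ε f x - f x) 2 (volume.restrict U))
      (𝓝[>] 0) (𝓝 0) := by
  have hUm := hUo.measurableSet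
  have h1 : MemLp (U.indicator f) 2 (volume.restrict U) := by
    refine hf2.ae_eq ?_
    filter_upwards [ae_restrict_mem hUm] with x hx
    rw [indicator_of_mem hx]
  have h := tendsto_average (P := avg b) volume hUm hUc hUb measurable_id (ae_avg_mem b hb)
    (hf.indicator hUm) h1
  have h2 : ∀ ε, ∫⁻ x in U, ‖∫ w, U.indicator f ((1 - ε) • x + ε • id w) ∂avg b -
      U.indicator f x‖ₑ ^ 2 = eLpNorm (fun x => smoothing U b ε f x - f x) 2 (volume.restrict U) ^ 2 := by
    intro ε
    rw [eLpNorm_two_sq]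
    refine lintegral_congr_ae ?_
    filter_upwards [ae_restrict_mem hUm] with x hx
    rw [indicator_of_mem hx]
    rfl
  simp_rw [h2] at h
  exact tendsto_zero_of_sq h

/-- `H¹` convergence of the smoothing operators. -/
theorem tendsto_hsSq_one_smoothing (hUo : IsOpen U) (hUc : Convex ℝ U) (hUb : Bornology.IsBounded U)
    (hb : Metric.closedBall x₀ b.rOut ⊆ U) (hf : Measurable f) (hf1 : MemH1 U f) :
    Tendsto (fun ε => hsSq U 1 (fun x => smoothing U b ε f x - f x)) (𝓝[>] 0) (𝓝 0) := by
  have hUm := hUo.measurableSet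
  have hfin : IsFiniteMeasure ((volume : Measure (Vec d)).restrict U) :=
    ⟨by simpa using hUb.measure_lt_top⟩
  have hfi : IntegrableOn f U := hf1.1.integrable one_le_two
  simp only [hsSq_one]
  have hzero : (0 : ℝ≥0∞) = 0 + ∑ i : Fin d, 0 := by simp
  rw [hzero]
  refine Tendsto.add ?_ (tendsto_finsetSum _ fun i _ => ?_)
  · have := ENNReal.Tendsto.pow (n := 2) (tendsto_smoothing b hUo hUc hUb hb hf hf1.1)
    simpa only [eLpNorm_two_sq, ne_eq, OfNat.ofNat_ne_zero, not_false_eq_true, zero_pow] using this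
  · obtain ⟨g₀, hg₀, hg₀2⟩ := hf1.2 i
    -- pass to a measurable representative of the derivative
    set g := hg₀2.1.mk g₀ with hgdef
    have hgm : Measurable g := hg₀2.1.stronglyMeasurable_mk.measurable
    have hge : g₀ =ᵐ[volume.restrict U] g := hg₀2.1.ae_eq_mk
    have hg : HasWeakPartial U i f g := hg₀.congr (EventuallyEq.refl _ _) hge
    have hg2 : MemLp g 2 (volume.restrict U) := hg₀2.ae_eq hge
    have hgi : IntegrableOn g U := hg2.integrable one_le_two
    have key : ∀ᶠ ε in 𝓝[>] (0 : ℝ), ∫⁻ x in U,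
        ‖weakPartial U i (fun x => smoothing U b ε f x - f x) x‖ₑ ^ 2 ≤
        (eLpNorm (fun x => smoothing U b ε g x - g x) 2 (volume.restrict U) +
          ENNReal.ofReal ε * eLpNorm g 2 (volume.restrict U)) ^ 2 := by
      filter_upwards [Ioo_mem_nhdsGT (zero_lt_one' ℝ)] with ε hε
      have hsm := contDiff_smoothing b hUm hfi hε.1
      have hsg := contDiff_smoothing b hUm hgi hε.1
      have hw := (HasWeakPartial.of_contDiff (U := U) i (hsm.of_le (by simp))).sub hg
      have hae : weakPartial U i (fun x => smoothing U b ε f x - f x) =ᵐ[volume.restrict U]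
          fun x => (1 - ε) * (smoothing U b ε g x - g x) - ε * g x := by
        filter_upwards [hw.weakPartial_ae_eq hUo, ae_restrict_mem hUm] with x hx hxU
        rw [hx, partial_smoothing b hUo hUc hb hε.1 hε.2.le hg hfi hxU]
        ring
      rw [← eLpNorm_two_sq, eLpNorm_congr_ae hae]
      gcongr
      have m1 : AEStronglyMeasurable (fun x => smoothing U b ε g x - g x) (volume.restrict U) :=
        (hsg.continuous.measurable.sub hgm).aestronglyMeasurable
      refine (eLpNorm_sub_le (m1.const_mul _) (hgm.aestronglyMeasurable.const_mul _)
        one_le_two).trans (add_le_add ?_ ?_)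
      · refine eLpNorm_mono fun x => ?_
        rw [norm_mul, Real.norm_eq_abs, abs_of_nonneg (by linarith [hε.2])]
        exact mul_le_of_le_one_left (norm_nonneg _) (by linarith [hε.1])
      · have : (fun x => ε * g x) = ε • g := rfl
        rw [this, eLpNorm_const_smul, Real.enorm_of_nonneg hε.1.le]
    refine tendsto_of_tendsto_of_tendsto_of_le_of_le' tendsto_const_nhds ?_
      (Eventually.of_forall fun _ => zero_le) key
    have t1 := tendsto_smoothing b hUo hUc hUb hb hgm hg2
    have t2 : Tendsto (fun ε : ℝ => ENNReal.ofReal ε * eLpNorm g 2 (volume.restrict U)) (𝓝[>] 0) (𝓝 0) := by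
      have : Tendsto (fun ε : ℝ => ENNReal.ofReal ε) (𝓝[>] 0) (𝓝 0) := by
        have := (ENNReal.continuous_ofReal.tendsto 0).mono_left (nhdsWithin_le_nhds (s := Ioi 0))
        simpa using this
      simpa using ENNReal.Tendsto.mul_const this (Or.inr hg2.2.ne)
    simpa using ENNReal.Tendsto.pow (n := 2) (t1.add t2)

end HDG

namespace HDG
variable {d : ℕ}

/-! ### Mean oscillation of Sobolev functions -/

/-- The integral of `|f x - f x'|²` over the pairs of points of `U` of distance at most `δ`. -/
noncomputable def osc (U : Set (Vec d)) (δ : ℝ) (f : Vec d → ℝ) : ℝ≥0∞ :=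
  ∫⁻ x in U, ∫⁻ y in U, if dist x y ≤ δ then ‖f x - f y‖ₑ ^ 2 else 0

variable {U : Set (Vec d)} {f : Vec d → ℝ}

theorem osc_le_gagliardoSq {θ : ℝ} (hθ : 0 < θ) (f : Vec d → ℝ) (δ : ℝ) :
    osc U δ f ≤ ENNReal.ofReal δ ^ ((d : ℝ) + 2 * θ) * gagliardoSq U θ f := by
  have hs : 0 < (d : ℝ) + 2 * θ := by positivity
  have hne : ENNReal.ofReal δ ^ ((d : ℝ) + 2 * θ) ≠ ⊤ :=
    ENNReal.rpow_ne_top_of_nonneg hs.le ENNReal.ofReal_ne_top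
  rw [osc, gagliardoSq, ← lintegral_const_mul' _ _ hne]
  refine lintegral_mono fun x => ?_
  rw [← lintegral_const_mul' _ _ hne]
  refine lintegral_mono fun y => ?_
  split_ifs with h
  · rcases eq_or_ne x y with rfl | hxy
    · simp
    · have h0 : ‖x - y‖ₑ ^ ((d : ℝ) + 2 * θ) ≠ 0 := by
        simp [ENNReal.rpow_eq_zero_iff, sub_eq_zero, hxy, hs.not_gt]
      have h1 : ‖x - y‖ₑ ^ ((d : ℝ) + 2 * θ) ≠ ⊤ := ENNReal.rpow_ne_top_of_nonneg hs.le enorm_ne_top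
      have h2 : ‖x - y‖ₑ ^ ((d : ℝ) + 2 * θ) ≤ ENNReal.ofReal δ ^ ((d : ℝ) + 2 * θ) := by
        refine ENNReal.rpow_le_rpow ?_ hs.le
        rw [← ofReal_norm, ← dist_eq_norm]
        exact ENNReal.ofReal_le_ofReal h
      calc ‖f x - f y‖ₑ ^ 2 = ‖x - y‖ₑ ^ ((d : ℝ) + 2 * θ) *
            (‖f x - f y‖ₑ ^ 2 / ‖x - y‖ₑ ^ ((d : ℝ) + 2 * θ)) := (ENNReal.mul_div_cancel h0 h1).symm
        _ ≤ _ := by gcongr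
  · exact zero_le

theorem add_sq_le (a b : ℝ≥0∞) : (a + b) ^ 2 ≤ 2 * (a ^ 2 + b ^ 2) := by
  have := ENNReal.rpow_add_le_mul_rpow_add_rpow a b (p := 2) (by norm_num)
  norm_num at this
  exact this

theorem enorm_sub_sq_le (a b : ℝ) : ‖a - b‖ₑ ^ 2 ≤ 2 * (‖a‖ₑ ^ 2 + ‖b‖ₑ ^ 2) :=
  le_trans (by gcongr; exact enorm_sub_le) (add_sq_le _ _)

theorem enorm_add_sq_le (a b : ℝ) : ‖a + b‖ₑ ^ 2 ≤ 2 * (‖a‖ₑ ^ 2 + ‖b‖ₑ ^ 2) :=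
  le_trans (by gcongr; exact enorm_add_le _ _) (add_sq_le _ _)

theorem osc_le_lintegral (hf : Measurable f) (δ : ℝ) :
    osc U δ f ≤ 4 * volume U * ∫⁻ x in U, ‖f x‖ₑ ^ 2 := by
  have hm : Measurable fun x => ‖f x‖ₑ ^ 2 := by fun_prop
  calc osc U δ f ≤ ∫⁻ x in U, ∫⁻ y in U, 2 * (‖f x‖ₑ ^ 2 + ‖f y‖ₑ ^ 2) := by
        refine lintegral_mono fun x => lintegral_mono fun y => ?_
        dsimp only
        split_ifs
        · exact enorm_sub_sq_le _ _
        · exact zero_le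
    _ = _ := by
        have e : ∀ x, ∫⁻ y in U, 2 * (‖f x‖ₑ ^ 2 + ‖f y‖ₑ ^ 2) =
            2 * (‖f x‖ₑ ^ 2 * volume U + ∫⁻ y in U, ‖f y‖ₑ ^ 2) := fun x => by
          rw [lintegral_const_mul' _ _ (by simp), lintegral_add_left measurable_const,
            lintegral_const, Measure.restrict_apply_univ]
        simp_rw [e]
        rw [lintegral_const_mul' _ _ (by simp), lintegral_add_left (hm.mul_const _),
          lintegral_const, Measure.restrict_apply_univ, lintegral_mul_const _ hm]
        ring

theorem measurable_osc_integrand (hf : Measurable f) (δ : ℝ) :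
    Measurable fun z : Vec d × Vec d => if dist z.1 z.2 ≤ δ then ‖f z.1 - f z.2‖ₑ ^ 2 else 0 := by
  refine Measurable.ite (measurableSet_le (by fun_prop) (by fun_prop)) (by fun_prop) (by fun_prop)

theorem osc_le_add {g : Vec d → ℝ} (hf : Measurable f) (hg : Measurable g) (δ : ℝ) :
    osc U δ f ≤ 2 * (osc U δ (fun x => g x - f x) + osc U δ g) := by
  have h1 : Measurable fun z : Vec d × Vec d =>
      if dist z.1 z.2 ≤ δ then ‖(g z.1 - f z.1) - (g z.2 - f z.2)‖ₑ ^ 2 else 0 :=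
    measurable_osc_integrand (hg.sub hf) δ
  have e : ∀ x, ∫⁻ y in U, ((if dist x y ≤ δ then ‖(g x - f x) - (g y - f y)‖ₑ ^ 2 else 0) +
      (if dist x y ≤ δ then ‖g x - g y‖ₑ ^ 2 else 0)) =
      (∫⁻ y in U, (if dist x y ≤ δ then ‖(g x - f x) - (g y - f y)‖ₑ ^ 2 else 0)) +
      ∫⁻ y in U, (if dist x y ≤ δ then ‖g x - g y‖ₑ ^ 2 else 0) := fun x =>
    lintegral_add_left (h1.comp measurable_prodMk_left) _
  rw [osc, osc, osc, ← lintegral_add_left (h1.lintegral_prod_right')]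
  simp_rw [← e]
  rw [← lintegral_const_mul' 2 _ (by simp)]
  refine lintegral_mono fun x => ?_
  rw [← lintegral_const_mul' 2 _ (by simp)]
  refine lintegral_mono fun y => ?_
  split_ifs
  · have : f x - f y = (g x - g y) - ((g x - f x) - (g y - f y)) := by ring
    rw [this, add_comm (_ ^ 2)]
    exact enorm_sub_sq_le _ _
  · simp

theorem enorm_fderiv_sq_le {φ : Vec d → ℝ} (x z : Vec d) :
    ‖fderiv ℝ φ x z‖ₑ ^ 2 ≤ ‖z‖ₑ ^ 2 *
      ∑ i, ‖fderiv ℝ φ x (EuclideanSpace.single i 1)‖ₑ ^ 2 := by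
  have e : ∀ a : ℝ, ‖a‖ₑ ^ 2 = ENNReal.ofReal (a ^ 2) := fun a => by
    rw [Real.enorm_eq_ofReal_abs, ← ENNReal.ofReal_pow (abs_nonneg a), sq_abs]
  simp_rw [e]
  rw [← ENNReal.ofReal_sum_of_nonneg (fun i _ => sq_nonneg _), ← ofReal_norm,
    ← ENNReal.ofReal_pow (norm_nonneg z), ← ENNReal.ofReal_mul (by positivity)]
  refine ENNReal.ofReal_le_ofReal ?_
  rw [fderiv_apply_eq_sum, EuclideanSpace.norm_sq_eq]
  simp only [Real.norm_eq_abs, sq_abs]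
  exact Finset.sum_mul_sq_le_sq_mul_sq _ _ _

/-- The rate `δ^(d + 2)`, which corresponds to `r = 1`, holds for continuously differentiable functions. -/
theorem osc_le_of_contDiff (hUm : MeasurableSet U) (hUc : Convex ℝ U) {φ : Vec d → ℝ} (hφ : ContDiff ℝ 1 φ) {δ : ℝ}
    (hδ : 0 ≤ δ) :
    osc U δ φ ≤ ENNReal.ofReal δ ^ (d + 2) * volume (Metric.ball (0 : Vec d) 1) *
      ∫⁻ x in U, ∑ i, ‖fderiv ℝ φ x (EuclideanSpace.single i 1)‖ₑ ^ 2 := by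
  set G : Vec d → ℝ≥0∞ := U.indicator fun x =>
    ∑ i, ‖fderiv ℝ φ x (EuclideanSpace.single i 1)‖ₑ ^ 2 with hG
  have hcf := hφ.continuous_fderiv one_ne_zero
  have hGm : Measurable G := by
    refine Measurable.indicator ?_ hUm
    fun_prop
  have hP : IsProbabilityMeasure ((volume : Measure ℝ).restrict (Ioc 0 1)) := ⟨by simp⟩
  -- the fundamental theorem of calculus along the segment from `x` to `x + z`
  have key : ∀ x ∈ U, ∀ z, x + z ∈ U → ‖φ x - φ (x + z)‖ₑ ^ 2 ≤
      ‖z‖ₑ ^ 2 * ∫⁻ t in Ioc (0 : ℝ) 1, G (x + t • z) := by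
    intro x hx z hz
    have hder : ∀ t : ℝ, HasDerivAt (fun t : ℝ => φ (x + t • z)) (fderiv ℝ φ (x + t • z) z) t := by
      intro t
      have h1 : HasFDerivAt φ (fderiv ℝ φ (x + t • z)) (x + t • z) :=
        (hφ.differentiable one_ne_zero _).hasFDerivAt
      have h2 : HasDerivAt (fun t : ℝ => x + t • z) z t := by
        simpa using ((hasDerivAt_id t).smul_const z).const_add x
      exact h1.comp_hasDerivAt t h2
    have hcont : Continuous fun t : ℝ => fderiv ℝ φ (x + t • z) z := by fun_prop
    have hftc := intervalIntegral.integral_eq_sub_of_hasDerivAt (a := 0) (b := 1) (fun t _ => hder t)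
      (hcont.intervalIntegrable 0 1)
    rw [intervalIntegral.integral_of_le zero_le_one] at hftc
    simp only [one_smul, zero_smul, add_zero] at hftc
    have h3 := enorm_integral_sub_sq_le (P := (volume : Measure ℝ).restrict (Ioc 0 1))
      hcont.aestronglyMeasurable 0
    simp only [sub_zero] at h3
    rw [hftc] at h3
    rw [← enorm_neg, neg_sub]
    refine h3.trans ?_
    rw [← lintegral_const_mul' _ _ (by simp)]
    refine setLIntegral_mono_ae' measurableSet_Ioc (Eventually.of_forall fun t ht => ?_)
    have hmem : x + t • z ∈ U := by
      have := hUc hx hz (by linarith [ht.2] : 0 ≤ 1 - t) ht.1.le (by ring)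
      convert this using 1
      module
    rw [hG, indicator_of_mem hmem]
    exact enorm_fderiv_sq_le _ _
  calc osc U δ φ ≤ ∫⁻ x, ∫⁻ y, ENNReal.ofReal δ ^ 2 *
        ∫⁻ t in Ioc (0 : ℝ) 1, (Metric.closedBall (0 : Vec d) δ).indicator (fun _ => 1) (y - x) *
          G (x + t • (y - x)) := by
        rw [osc, ← lintegral_indicator hUm]
        refine lintegral_mono fun x => ?_
        by_cases hx : x ∈ U
        · rw [indicator_of_mem hx, ← lintegral_indicator hUm]
          refine lintegral_mono fun y => ?_
          by_cases hy : y ∈ U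
          · rw [indicator_of_mem hy]
            split_ifs with h
            · have hmem : y - x ∈ Metric.closedBall (0 : Vec d) δ := by
                rw [mem_closedBall_zero_iff, ← dist_eq_norm, dist_comm]
                exact h
              have := key x hx (y - x) (by simpa using hy)
              simp only [indicator_of_mem hmem, one_mul]
              rw [add_sub_cancel] at this
              refine this.trans ?_
              gcongr
              rw [← ofReal_norm]
              exact ENNReal.ofReal_le_ofReal (mem_closedBall_zero_iff.1 hmem)
            · exact zero_le
          · rw [indicator_of_notMem hy]
            exact zero_le
        · rw [indicator_of_notMem hx]
          exact zero_le
    _ = ∫⁻ x, ∫⁻ z, ENNReal.ofReal δ ^ 2 *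
        ∫⁻ t in Ioc (0 : ℝ) 1, (Metric.closedBall (0 : Vec d) δ).indicator (fun _ => 1) z *
          G (x + t • z) := by
        refine lintegral_congr fun x => ?_
        exact lintegral_sub_right_eq_self (μ := volume) (fun z => ENNReal.ofReal δ ^ 2 *
          ∫⁻ t in Ioc (0 : ℝ) 1, (Metric.closedBall (0 : Vec d) δ).indicator (fun _ => 1) z *
          G (x + t • z)) x
    _ = ENNReal.ofReal δ ^ 2 * ∫⁻ z, ∫⁻ t in Ioc (0 : ℝ) 1, ∫⁻ x,
        (Metric.closedBall (0 : Vec d) δ).indicator (fun _ => 1) z * G (x + t • z) := by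
        have hind : Measurable ((Metric.closedBall (0 : Vec d) δ).indicator fun _ => (1 : ℝ≥0∞)) :=
          measurable_const.indicator measurableSet_closedBall
        have hm3 : Measurable fun q : (Vec d × Vec d) × ℝ =>
            (Metric.closedBall (0 : Vec d) δ).indicator (fun _ => (1 : ℝ≥0∞)) q.1.2 * G (q.1.1 + q.2 • q.1.2) := by
          fun_prop
        rw [lintegral_lintegral_swap]
        · rw [← lintegral_const_mul']
          · refine lintegral_congr fun z => ?_
            rw [lintegral_const_mul' _ _ (by simp)]
            congr 1
            rw [lintegral_lintegral_swap]
            apply Measurable.aemeasurable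
            exact hm3.comp (f := fun q : Vec d × ℝ => ((q.1, z), q.2)) (by fun_prop)
          · simp
        · apply Measurable.aemeasurable
          exact (hm3.lintegral_prod_right').const_mul _
    _ = ENNReal.ofReal δ ^ 2 * ∫⁻ z, (Metric.closedBall (0 : Vec d) δ).indicator (fun _ => 1) z *
        ∫⁻ x, G x := by
        congr 1
        refine lintegral_congr fun z => ?_
        have : ∀ t : ℝ, ∫⁻ x, (Metric.closedBall (0 : Vec d) δ).indicator (fun _ => 1) z *
            G (x + t • z) = (Metric.closedBall (0 : Vec d) δ).indicator (fun _ => 1) z * ∫⁻ x, G x := by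
          intro t
          rw [lintegral_const_mul _ (by fun_prop), lintegral_add_right_eq_self]
        simp [this]
    _ = _ := by
        rw [lintegral_mul_const _ (measurable_const.indicator measurableSet_closedBall),
          lintegral_indicator_const measurableSet_closedBall, one_mul,
          Measure.addHaar_closedBall _ _ hδ, hG, lintegral_indicator hUm]
        simp only [finrank_euclideanSpace, Fintype.card_fin]
        rw [ENNReal.ofReal_pow hδ]
        ring

end HDG

namespace HDG
variable {d : ℕ} {U : Set (Vec d)} {f : Vec d → ℝ}

/-! ### Convergence of the smoothing operators in fractional order spaces -/

/-- The difference quotient whose squared `L²(U × U)` norm is the squared Gagliardo seminorm. -/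
noncomputable def diffQuot (θ : ℝ) (f : Vec d → ℝ) (z : Vec d × Vec d) : ℝ :=
  (f z.1 - f z.2) / ‖z.1 - z.2‖ ^ (((d : ℝ) + 2 * θ) / 2)

theorem enorm_diffQuot_sq (θ : ℝ) (f : Vec d → ℝ) (x y : Vec d) :
    ‖diffQuot θ f (x, y)‖ₑ ^ 2 = ‖f x - f y‖ₑ ^ 2 / ‖x - y‖ₑ ^ ((d : ℝ) + 2 * θ) := by
  rcases eq_or_ne x y with rfl | hxy
  · simp [diffQuot]
  · have h0 : 0 < ‖x - y‖ := norm_pos_iff.2 (sub_ne_zero.2 hxy)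
    have h1 : 0 < ‖x - y‖ ^ (((d : ℝ) + 2 * θ) / 2) := Real.rpow_pos_of_pos h0 _
    have h2 : ‖x - y‖ ^ ((d : ℝ) + 2 * θ) = (‖x - y‖ ^ (((d : ℝ) + 2 * θ) / 2)) ^ 2 := by
      rw [← Real.rpow_natCast, ← Real.rpow_mul h0.le]
      norm_num
    rw [← ofReal_norm (x - y), ENNReal.ofReal_rpow_of_pos h0, h2, diffQuot, Real.enorm_eq_ofReal_abs,
      Real.enorm_eq_ofReal_abs, ← ENNReal.ofReal_pow (abs_nonneg _), ← ENNReal.ofReal_pow (abs_nonneg _),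
      ← ENNReal.ofReal_div_of_pos (by positivity), abs_div, div_pow, abs_of_pos h1]

theorem measurable_diffQuot (θ : ℝ) (hf : Measurable f) : Measurable (diffQuot θ f) := by
  unfold diffQuot
  fun_prop

theorem gagliardoSq_eq_lintegral (θ : ℝ) (hf : Measurable f) :
    gagliardoSq U θ f = ∫⁻ z in U ×ˢ U, ‖diffQuot θ f z‖ₑ ^ 2 := by
  have hm := measurable_diffQuot θ hf
  rw [Measure.volume_eq_prod, ← Measure.prod_restrict, lintegral_prod _ (by fun_prop)]
  simp_rw [enorm_diffQuot_sq]
  rfl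

variable {x₀ : Vec d} (b : ContDiffBump x₀)

/-- Since contractions scale distances by `1 - ε`, the difference quotient of a smoothing is, up to a
power of `1 - ε`, the average of the difference quotient of `f` over contractions of `U × U` towards
diagonal points. -/
theorem diffQuot_smoothing (hUm : MeasurableSet U) (hUc : Convex ℝ U)
    (hb : Metric.closedBall x₀ b.rOut ⊆ U) (hf : IntegrableOn f U) {θ ε : ℝ} (h0 : 0 < ε) (h1 : ε < 1)
    {z : Vec d × Vec d} (hz : z ∈ U ×ˢ U) :
    diffQuot θ (fun x => smoothing U b ε f x - f x) z =
      (1 - ε) ^ (((d : ℝ) + 2 * θ) / 2) *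
        (∫ w, diffQuot θ f ((1 - ε) • z + ε • (w, w)) ∂avg b - diffQuot θ f z) +
      ((1 - ε) ^ (((d : ℝ) + 2 * θ) / 2) - 1) * diffQuot θ f z := by
  obtain ⟨x, y⟩ := z
  obtain ⟨hx, hy⟩ := hz
  set s := ((d : ℝ) + 2 * θ) / 2 with hs
  have hpos : 0 < 1 - ε := by linarith
  have e : ∫ w, diffQuot θ f ((1 - ε) • (x, y) + ε • (w, w)) ∂avg b =
      (smoothing U b ε f x - smoothing U b ε f y) / ((1 - ε) ^ s * ‖x - y‖ ^ s) := by
    rw [smoothing, smoothing, ← integral_sub (integrable_avg_comp b hUm hf h0.ne' _)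
      (integrable_avg_comp b hUm hf h0.ne' _), ← integral_div]
    refine integral_congr_ae ?_
    filter_upwards [ae_avg_mem b hb] with w hw
    rw [indicator_of_mem (contraction_mem hUc hx hw h0.le h1.le),
      indicator_of_mem (contraction_mem hUc hy hw h0.le h1.le), diffQuot]
    have e1 : ((1 - ε) • (x, y) + ε • (w, w)).1 - ((1 - ε) • (x, y) + ε • (w, w)).2 =
        (1 - ε) • (x - y) := by
      simp only [Prod.fst_add, Prod.smul_fst, Prod.snd_add, Prod.smul_snd]
      module
    rw [e1, norm_smul, Real.norm_of_nonneg hpos.le, Real.mul_rpow hpos.le (norm_nonneg _)]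
    rfl
  rw [e]
  have h2 : (1 - ε) ^ s ≠ 0 := (Real.rpow_pos_of_pos hpos s).ne'
  simp only [diffQuot, ← hs]
  rcases eq_or_ne (‖x - y‖ ^ s) 0 with h3 | h3
  · simp [h3]
  · field_simp
    ring

/-- Convergence of the smoothing operators in the Gagliardo seminorm. -/
theorem tendsto_gagliardoSq_smoothing (hUo : IsOpen U) (hUc : Convex ℝ U)
    (hUb : Bornology.IsBounded U) (hb : Metric.closedBall x₀ b.rOut ⊆ U) (hf : Measurable f)
    (hfi : IntegrableOn f U) {θ : ℝ} (hθ : 0 < θ) (hfin : gagliardoSq U θ f < ⊤) :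
    Tendsto (fun ε => gagliardoSq U θ (fun x => smoothing U b ε f x - f x)) (𝓝[>] 0) (𝓝 0) := by
  have hUm := hUo.measurableSet
  have hV := measurable_diffQuot θ hf
  rw [gagliardoSq_eq_lintegral θ hf] at hfin
  have hV2 : MemLp (diffQuot θ f) 2 (volume.restrict (U ×ˢ U)) := by
    refine ⟨hV.aestronglyMeasurable, ?_⟩
    rw [← eLpNorm_two_sq] at hfin
    by_contra h
    rw [not_lt, top_le_iff] at h
    simp [h] at hfin
  set s := ((d : ℝ) + 2 * θ) / 2 with hs
  have hhaar : (volume : Measure (Vec d × Vec d)).IsAddHaarMeasure := by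
    rw [Measure.volume_eq_prod]
    infer_instance
  have h := tendsto_average (P := avg b) (volume : Measure (Vec d × Vec d)) (hUm.prod hUm)
    (hUc.prod hUc) (hUb.prod hUb) (ℓ := fun w : Vec d => (w, w)) (by fun_prop)
    ((ae_avg_mem b hb).mono fun w hw => ⟨hw, hw⟩) hV hV2
  have hc : Tendsto (fun ε : ℝ => ‖(1 - ε) ^ s - 1‖ₑ ^ 2) (𝓝[>] 0) (𝓝 0) := by
    have hcont : ContinuousAt (fun ε : ℝ => ‖(1 - ε) ^ s - 1‖ₑ) 0 :=
      ((ContinuousAt.rpow_const (by fun_prop) (Or.inl (by norm_num))).sub continuousAt_const).enorm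
    have := ENNReal.Tendsto.pow (n := 2) (hcont.tendsto.mono_left (nhdsWithin_le_nhds (s := Ioi 0)))
    simpa using this
  have key : ∀ᶠ ε in 𝓝[>] (0 : ℝ), gagliardoSq U θ (fun x => smoothing U b ε f x - f x) ≤
      2 * ((∫⁻ z in U ×ˢ U,
        ‖∫ w, diffQuot θ f ((1 - ε) • z + ε • (w, w)) ∂avg b - diffQuot θ f z‖ₑ ^ 2) +
      ‖(1 - ε) ^ s - 1‖ₑ ^ 2 * ∫⁻ z in U ×ˢ U, ‖diffQuot θ f z‖ₑ ^ 2) := by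
    filter_upwards [Ioo_mem_nhdsGT (zero_lt_one' ℝ)] with ε hε
    have hsm := (contDiff_smoothing b hUm hfi hε.1).continuous.measurable
    have hle : ‖(1 - ε) ^ s‖ₑ ≤ 1 := by
      rw [Real.enorm_eq_ofReal_abs, ← ENNReal.ofReal_one]
      refine ENNReal.ofReal_le_ofReal ?_
      rw [abs_of_nonneg (Real.rpow_nonneg (by linarith [hε.2]) _)]
      exact Real.rpow_le_one (by linarith [hε.2]) (by linarith [hε.1]) (by positivity)
    have hsub : Measurable fun x => smoothing U b ε f x - f x := hsm.sub hf
    rw [gagliardoSq_eq_lintegral θ hsub, ← lintegral_const_mul _ (by fun_prop),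
      ← lintegral_add_right _ (by fun_prop), ← lintegral_const_mul' _ _ (by simp)]
    refine setLIntegral_mono_ae' (hUm.prod hUm) (Eventually.of_forall fun z hz => ?_)
    rw [diffQuot_smoothing b hUm hUc hb hfi hε.1 hε.2 hz]
    refine (enorm_add_sq_le _ _).trans ?_
    rw [enorm_mul, enorm_mul, mul_pow, mul_pow]
    gcongr
    exact mul_le_of_le_one_left' (pow_le_one₀ zero_le hle)
  refine tendsto_of_tendsto_of_tendsto_of_le_of_le' tendsto_const_nhds ?_
    (Eventually.of_forall fun _ => zero_le) key
  have t := ENNReal.Tendsto.const_mul (a := 2)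
    (h.add (ENNReal.Tendsto.mul_const hc (Or.inr hfin.ne))) (Or.inr (by simp))
  simpa using t

/-- Convergence of the smoothing operators in the norm of `H^r(U)`, `0 < r ≤ 1`. -/
theorem tendsto_hsSq_smoothing (hUo : IsOpen U) (hUc : Convex ℝ U) (hUb : Bornology.IsBounded U)
    (hb : Metric.closedBall x₀ b.rOut ⊆ U) (hf : Measurable f) {r : ℝ} (h0 : 0 < r) (h1 : r ≤ 1)
    (hfr : MemHs U r f) :
    Tendsto (fun ε => hsSq U r (fun x => smoothing U b ε f x - f x)) (𝓝[>] 0) (𝓝 0) := by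
  have hfin : IsFiniteMeasure ((volume : Measure (Vec d)).restrict U) :=
    ⟨by simpa using hUb.measure_lt_top⟩
  rcases h1.lt_or_eq with h1 | rfl
  · simp only [hsSq_of_lt h0 h1]
    have hf2 := (memHs_iff_of_lt h0 h1).1 hfr
    have t1 := ENNReal.Tendsto.pow (n := 2) (tendsto_smoothing b hUo hUc hUb hb hf hf2.1)
    simp only [eLpNorm_two_sq] at t1
    have t2 := tendsto_gagliardoSq_smoothing b hUo hUc hUb hb hf (hf2.1.integrable one_le_two) h0 hf2.2
    simpa using t1.add t2
  · exact tendsto_hsSq_one_smoothing b hUo hUc hUb hb hf (memHs_one_iff.1 hfr)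

/-- The mean oscillation of a function of `H^r(U)` over distances `δ` is of the order `δ^(d + 2 r)`. -/
theorem exists_osc_le (hUo : IsOpen U) (hUc : Convex ℝ U) (hUb : Bornology.IsBounded U)
    (hb : Metric.closedBall x₀ b.rOut ⊆ U) {r : ℝ} (h0 : 0 < r) (h1 : r ≤ 1) :
    ∃ C : ℝ≥0∞, C ≠ ⊤ ∧ ∀ f : Vec d → ℝ, Measurable f → MemHs U r f → ∀ δ : ℝ, 0 < δ →
      osc U δ f ≤ C * ENNReal.ofReal δ ^ ((d : ℝ) + 2 * r) * hsSq U r f := by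
  have hUm := hUo.measurableSet
  have hfin : IsFiniteMeasure ((volume : Measure (Vec d)).restrict U) :=
    ⟨by simpa using hUb.measure_lt_top⟩
  rcases h1.lt_or_eq with h1 | rfl
  · refine ⟨1, by simp, fun f hf hfr δ hδ => (osc_le_gagliardoSq h0 f δ).trans ?_⟩
    rw [one_mul, hsSq_of_lt h0 h1]
    gcongr
    exact le_add_self
  · refine ⟨4 * volume (Metric.ball (0 : Vec d) 1),
      ENNReal.mul_ne_top (by simp) measure_ball_lt_top.ne, fun f hf hfr δ hδ => ?_⟩
    have hf1 := memHs_one_iff.1 hfr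
    have hfi : IntegrableOn f U := hf1.1.integrable one_le_two
    have t := tendsto_hsSq_smoothing b hUo hUc hUb hb hf h0 le_rfl hfr
    have hpow : ENNReal.ofReal δ ^ ((d : ℝ) + 2 * 1) = ENNReal.ofReal δ ^ (d + 2) := by
      rw [← ENNReal.rpow_natCast]
      norm_num
    rw [hpow]
    set B := volume (Metric.ball (0 : Vec d) 1) with hB
    have hBtop : B ≠ ⊤ := measure_ball_lt_top.ne
    -- for `r = 1`, pass to the limit in the bound for the smoothings of `f`
    have key : ∀ᶠ ε in 𝓝[>] (0 : ℝ), osc U δ f ≤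
        2 * (4 * volume U * hsSq U 1 (fun x => smoothing U b ε f x - f x) +
          ENNReal.ofReal δ ^ (d + 2) * B *
          (2 * (hsSq U 1 (fun x => smoothing U b ε f x - f x) + hsSq U 1 f))) := by
      filter_upwards [Ioo_mem_nhdsGT (zero_lt_one' ℝ)] with ε hε
      have hsm : ContDiff ℝ 1 (smoothing U b ε f) :=
        (contDiff_smoothing b hUm hfi hε.1).of_le (by simp)
      have hsmm := hsm.continuous.measurable
      refine (osc_le_add hf hsmm δ).trans ?_
      gcongr
      · refine (osc_le_lintegral (hsmm.sub hf) δ).trans ?_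
        gcongr
        rw [hsSq_one]
        exact le_self_add
      · refine (osc_le_of_contDiff hUm hUc hsm hδ.le).trans ?_
        gcongr
        have hcf := hsm.continuous_fderiv one_ne_zero
        rw [lintegral_finsetSum _ (fun i _ => by fun_prop)]
        have hi : ∀ i, ∫⁻ x in U, ‖fderiv ℝ (smoothing U b ε f) x (EuclideanSpace.single i 1)‖ₑ ^ 2 ≤
            2 * ((∫⁻ x in U, ‖weakPartial U i (fun x => smoothing U b ε f x - f x) x‖ₑ ^ 2) +
              ∫⁻ x in U, ‖weakPartial U i f x‖ₑ ^ 2) := by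
          intro i
          obtain ⟨g, hg, hg2⟩ := hf1.2 i
          have hd := HasWeakPartial.of_contDiff (U := U) i hsm
          have a1 := hg.weakPartial_ae_eq hUo
          have a2 := (hd.sub hg).weakPartial_ae_eq hUo
          have hm : AEMeasurable (fun x => ‖weakPartial U i f x‖ₑ ^ 2) (volume.restrict U) :=
            ((hg2.1.aemeasurable.congr a1.symm).enorm).pow_const 2
          rw [← lintegral_add_right' _ hm, ← lintegral_const_mul' _ _ (by simp)]
          refine lintegral_mono_ae ?_
          filter_upwards [a1, a2] with x hx1 hx2
          rw [hx1, hx2]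
          have : fderiv ℝ (smoothing U b ε f) x (EuclideanSpace.single i 1) =
            (fderiv ℝ (smoothing U b ε f) x (EuclideanSpace.single i 1) - g x) + g x := by ring
          conv_lhs => rw [this]
          exact enorm_add_sq_le _ _
        refine (Finset.sum_le_sum fun i _ => hi i).trans ?_
        rw [← Finset.mul_sum, Finset.sum_add_distrib, hsSq_one, hsSq_one]
        gcongr
        · exact le_add_self
        · exact le_add_self
    have hUtop : volume U ≠ ⊤ := hUb.measure_lt_top.ne
    have lim : Tendsto (fun ε => 2 * (4 * volume U * hsSq U 1 (fun x => smoothing U b ε f x - f x) +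
          ENNReal.ofReal δ ^ (d + 2) * B *
          (2 * (hsSq U 1 (fun x => smoothing U b ε f x - f x) + hsSq U 1 f)))) (𝓝[>] 0)
        (𝓝 (2 * (4 * volume U * 0 + ENNReal.ofReal δ ^ (d + 2) * B * (2 * (0 + hsSq U 1 f))))) := by
      refine ENNReal.Tendsto.const_mul (Tendsto.add ?_ ?_) (Or.inr (by simp))
      · exact ENNReal.Tendsto.const_mul t (Or.inr (ENNReal.mul_ne_top (by simp) hUtop))
      · refine ENNReal.Tendsto.const_mul (ENNReal.Tendsto.const_mul (t.add tendsto_const_nhds)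
          (Or.inr (by simp))) (Or.inr (ENNReal.mul_ne_top (by simp) hBtop))
    refine (ge_of_tendsto lim key).trans (le_of_eq ?_)
    ring

end HDG

namespace HDG
variable {d : ℕ} {U F : Set (Vec d)} {f : Vec d → ℝ} {x₀ : Vec d} {b : ContDiffBump x₀}

/-! ### Convergence of the smoothed functions on the boundary -/

/-- A bounded open convex set `U` that contains the support of the bump function `b`, together with
an upper `(d - 1)`-regular subset `F` of its closure. -/
structure IsTraceSet (U F : Set (Vec d)) {x₀ : Vec d} (b : ContDiffBump x₀) : Prop where
  isOpen : IsOpen U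
  convex : Convex ℝ U
  isBounded : Bornology.IsBounded U
  ball_subset : Metric.closedBall x₀ b.rOut ⊆ U
  measurableSet : MeasurableSet F
  subset_closure : F ⊆ closure U
  regular : ∃ C : ℝ≥0∞, C ≠ ⊤ ∧
    ∀ x ρ, 0 ≤ ρ → surf d (F ∩ Metric.closedBall x ρ) ≤ C * ENNReal.ofReal (ρ ^ (d - 1))

theorem IsTraceSet.exists_dist_le (h : IsTraceSet U F b) :
    ∃ D : ℝ, 0 < D ∧ ∀ x ∈ closure U, ∀ y ∈ closure U, dist x y ≤ D :=
  ⟨Metric.diam (closure U) + 1, by positivity, fun x hx y hy =>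
    (Metric.dist_le_diam_of_mem h.isBounded.closure hx hy).trans (by linarith)⟩

theorem IsTraceSet.surf_ne_top (h : IsTraceSet U F b) : surf d F ≠ ⊤ := by
  obtain ⟨C, hC, hr⟩ := h.regular
  obtain ⟨D, hD, hdist⟩ := h.exists_dist_le
  have hx : x₀ ∈ closure U := _root_.subset_closure (h.ball_subset (by simp [b.rOut_pos.le]))
  have h1 := hr x₀ D hD.le
  have hsub : F ⊆ Metric.closedBall x₀ D := fun y hy => hdist y (h.subset_closure hy) x₀ hx
  rw [inter_eq_left.2 hsub] at h1
  exact (h1.trans_lt (ENNReal.mul_lt_top hC.lt_top ENNReal.ofReal_lt_top)).ne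

theorem IsTraceSet.isFiniteMeasure (h : IsTraceSet U F b) : IsFiniteMeasure ((surf d).restrict F) :=
  ⟨by simpa using h.surf_ne_top.lt_top⟩

theorem IsTraceSet.contraction_mem (h : IsTraceSet U F b) {y w : Vec d} (hy : y ∈ closure U)
    (hw : w ∈ U) {ε : ℝ} (h0 : 0 < ε) (h1 : ε ≤ 1) : (1 - ε) • y + ε • w ∈ U := by
  have := h.convex.combo_closure_interior_mem_interior hy (by rwa [h.isOpen.interior_eq])
    (by linarith : 0 ≤ 1 - ε) h0 (by ring)
  rwa [h.isOpen.interior_eq] at this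

theorem lintegral_avg_comp_le {H : Vec d → ℝ≥0∞} (hH : Measurable H) {M : ℝ≥0∞}
    (hle : avg b ≤ M • volume) {ε : ℝ} (h0 : ε ≠ 0) (v : Vec d) :
    ∫⁻ w, H (v + ε • w) ∂avg b ≤ M * ENNReal.ofReal |(ε ^ d)⁻¹| * ∫⁻ x, H x := by
  calc ∫⁻ w, H (v + ε • w) ∂avg b ≤ ∫⁻ w, H (v + ε • w) ∂(M • volume) := lintegral_mono' hle le_rfl
    _ = M * ∫⁻ w, H (ε • w + v) := by
        rw [lintegral_smul_measure, smul_eq_mul]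
        simp_rw [add_comm v]
    _ = _ := by
        rw [lintegral_comp_affine volume hH h0, finrank_euclideanSpace, Fintype.card_fin, mul_assoc]

/-- Two smoothings of the same function differ on `F` by at most its mean oscillation: at a point
`y` of `F` their difference is an average of `f x - f x'`, where `x` and `x'` are at distance
comparable to `ε` from `y`. -/
theorem IsTraceSet.lintegral_smoothing_sub_le (h : IsTraceSet U F b) {D : ℝ} (hD : 0 < D)
    (hdist : ∀ x ∈ closure U, ∀ y ∈ closure U, dist x y ≤ D) {M C : ℝ≥0∞} (hle : avg b ≤ M • volume)
    (hC : ∀ x ρ, 0 ≤ ρ → surf d (F ∩ Metric.closedBall x ρ) ≤ C * ENNReal.ofReal (ρ ^ (d - 1)))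
    (hf : Measurable f) {ε ε' : ℝ} (h0 : 0 < ε') (hεε : ε' ≤ ε) (h1 : ε ≤ 1) :
    ∫⁻ y in F, ‖smoothing U b ε f y - smoothing U b ε' f y‖ₑ ^ 2 ∂surf d ≤
      M * ENNReal.ofReal |(ε' ^ d)⁻¹| * (M * ENNReal.ofReal |(ε ^ d)⁻¹|) *
        (C * ENNReal.ofReal ((ε * D) ^ (d - 1)) * osc U (2 * D * ε) f) := by
  have h0' : 0 < ε := h0.trans_le hεε
  have hUm := h.isOpen.measurableSet
  have hfin := h.isFiniteMeasure
  set G : Vec d → Vec d → ℝ≥0∞ := fun x' x => U.indicator (fun x' => U.indicator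
    (fun x => if dist x' x ≤ 2 * D * ε then ‖f x' - f x‖ₑ ^ 2 else 0) x) x' with hG
  have hGosc : ∫⁻ x', ∫⁻ x, G x' x = osc U (2 * D * ε) f := by
    rw [osc, ← lintegral_indicator hUm]
    refine lintegral_congr fun x' => ?_
    by_cases hx : x' ∈ U
    · simp only [hG, indicator_of_mem hx]
      exact lintegral_indicator hUm _
    · simp [hG, indicator_of_notMem hx]
  have hGm : Measurable fun z : Vec d × Vec d => G z.1 z.2 := by
    have e : (fun z : Vec d × Vec d => G z.1 z.2) = (U ×ˢ U).indicator
        (fun z => if dist z.1 z.2 ≤ 2 * D * ε then ‖f z.1 - f z.2‖ₑ ^ 2 else 0) := by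
      ext z
      by_cases h1 : z.1 ∈ U <;> by_cases h2 : z.2 ∈ U <;> simp [hG, h1, h2, indicator]
    rw [e]
    exact (measurable_osc_integrand hf _).indicator (hUm.prod hUm)
  -- the restriction `dist y x ≤ ε D` keeps the localization when `y` is integrated over `F`
  let K : Vec d → Vec d → Vec d → ℝ≥0∞ := fun y x' x => if dist y x ≤ ε * D then G x' x else 0
  have hKm : Measurable fun z : Vec d × Vec d × Vec d => K z.1 z.2.1 z.2.2 :=
    Measurable.ite (measurableSet_le (by fun_prop) (by fun_prop)) (hGm.comp measurable_snd)
      measurable_const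
  set cM := M * ENNReal.ofReal |(ε ^ d)⁻¹|
  set cM' := M * ENNReal.ofReal |(ε' ^ d)⁻¹|
  have hpt : ∀ y ∈ F, ‖smoothing U b ε f y - smoothing U b ε' f y‖ₑ ^ 2 ≤
      cM' * (cM * ∫⁻ x', ∫⁻ x, K y x' x) := by
    intro y hy
    have hyU := h.subset_closure hy
    have hm : ∀ ε : ℝ, Measurable fun w => U.indicator f ((1 - ε) • y + ε • w) := fun ε =>
      (hf.indicator hUm).comp (by fun_prop)
    calc ‖smoothing U b ε f y - smoothing U b ε' f y‖ₑ ^ 2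
        = ‖smoothing U b ε' f y - smoothing U b ε f y‖ₑ ^ 2 := by rw [enorm_sub_rev]
      _ ≤ ∫⁻ w', ‖U.indicator f ((1 - ε') • y + ε' • w') - smoothing U b ε f y‖ₑ ^ 2 ∂avg b :=
          enorm_integral_sub_sq_le (hm ε').aestronglyMeasurable _
      _ ≤ ∫⁻ w', ∫⁻ w, ‖U.indicator f ((1 - ε) • y + ε • w) -
            U.indicator f ((1 - ε') • y + ε' • w')‖ₑ ^ 2 ∂avg b ∂avg b := by
          refine lintegral_mono fun w' => ?_
          rw [enorm_sub_rev]
          exact enorm_integral_sub_sq_le (hm ε).aestronglyMeasurable _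
      _ ≤ ∫⁻ w', ∫⁻ w, K y ((1 - ε') • y + ε' • w') ((1 - ε) • y + ε • w) ∂avg b ∂avg b := by
          refine lintegral_mono_ae ?_
          filter_upwards [ae_avg_mem b h.ball_subset] with w' hw'
          refine lintegral_mono_ae ?_
          filter_upwards [ae_avg_mem b h.ball_subset] with w hw
          have m1 := h.contraction_mem hyU hw h0' h1
          have m2 := h.contraction_mem hyU hw' h0 (hεε.trans h1)
          have d1 : dist y ((1 - ε) • y + ε • w) ≤ ε * D := by
            rw [dist_eq_norm]
            have : y - ((1 - ε) • y + ε • w) = ε • (y - w) := by module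
            rw [this, norm_smul, Real.norm_of_nonneg h0'.le, ← dist_eq_norm]
            gcongr
            exact hdist y hyU w (_root_.subset_closure hw)
          have d2 : dist ((1 - ε') • y + ε' • w') y ≤ ε * D := by
            rw [dist_eq_norm]
            have : ((1 - ε') • y + ε' • w') - y = ε' • (w' - y) := by module
            rw [this, norm_smul, Real.norm_of_nonneg h0.le, ← dist_eq_norm]
            gcongr
            exact hdist w' (_root_.subset_closure hw') y hyU
          have d3 : dist ((1 - ε') • y + ε' • w') ((1 - ε) • y + ε • w) ≤ 2 * D * ε :=
            (dist_triangle _ y _).trans (by linarith)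
          simp only [K, hG, if_pos d1, indicator_of_mem m1, indicator_of_mem m2, if_pos d3]
          rw [enorm_sub_rev]
      _ ≤ ∫⁻ w', (cM * ∫⁻ x, K y ((1 - ε') • y + ε' • w') x) ∂avg b := by
          refine lintegral_mono fun w' => ?_
          exact lintegral_avg_comp_le (H := fun x => K y ((1 - ε') • y + ε' • w') x)
            (hKm.comp (f := fun x => (y, _, x)) (by fun_prop)) hle h0'.ne' _
      _ ≤ cM' * ∫⁻ x', cM * ∫⁻ x, K y x' x := by
          refine lintegral_avg_comp_le (H := fun x' => cM * ∫⁻ x, K y x' x) ?_ hle h0.ne' _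
          refine Measurable.const_mul ?_ _
          exact Measurable.lintegral_prod_right' (f := fun z : Vec d × Vec d => K y z.1 z.2)
            (hKm.comp (f := fun z : Vec d × Vec d => (y, z.1, z.2)) (by fun_prop))
      _ = _ := by
          rw [lintegral_const_mul]
          exact Measurable.lintegral_prod_right' (f := fun z : Vec d × Vec d => K y z.1 z.2)
            (hKm.comp (f := fun z : Vec d × Vec d => (y, z.1, z.2)) (by fun_prop))
  have hI1 : Measurable fun z : Vec d × Vec d => ∫⁻ x, K z.1 z.2 x :=
    Measurable.lintegral_prod_right' (f := fun q : (Vec d × Vec d) × Vec d => K q.1.1 q.1.2 q.2)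
      (hKm.comp (f := fun q : (Vec d × Vec d) × Vec d => (q.1.1, q.1.2, q.2)) (by fun_prop))
  calc ∫⁻ y in F, ‖smoothing U b ε f y - smoothing U b ε' f y‖ₑ ^ 2 ∂surf d
      ≤ ∫⁻ y in F, (cM' * (cM * ∫⁻ x', ∫⁻ x, K y x' x)) ∂surf d :=
        setLIntegral_mono_ae' h.measurableSet (Eventually.of_forall hpt)
    _ = cM' * cM * ∫⁻ y in F, (∫⁻ x', ∫⁻ x, K y x' x) ∂surf d := by
        simp_rw [← mul_assoc]
        rw [lintegral_const_mul _ hI1.lintegral_prod_right']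
    _ = cM' * cM * ∫⁻ x', ∫⁻ x, ∫⁻ y in F, K y x' x ∂surf d := by
        congr 1
        rw [lintegral_lintegral_swap hI1.aemeasurable]
        refine lintegral_congr fun x' => ?_
        rw [lintegral_lintegral_swap]
        exact (hKm.comp (f := fun z : Vec d × Vec d => (z.1, x', z.2)) (by fun_prop)).aemeasurable
    _ ≤ cM' * cM * ∫⁻ x', ∫⁻ x, C * ENNReal.ofReal ((ε * D) ^ (d - 1)) * G x' x := by
        gcongr with x' x
        have e : ∀ y, K y x' x = (Metric.closedBall x (ε * D)).indicator (fun _ => G x' x) y := by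
          intro y
          simp only [K, indicator, Metric.mem_closedBall]
        simp_rw [e]
        rw [lintegral_indicator_const measurableSet_closedBall,
          Measure.restrict_apply measurableSet_closedBall, mul_comm, inter_comm]
        gcongr
        exact hC x _ (by positivity)
    _ = _ := by
        have e : ∀ x', ∫⁻ x, C * ENNReal.ofReal ((ε * D) ^ (d - 1)) * G x' x =
            C * ENNReal.ofReal ((ε * D) ^ (d - 1)) * ∫⁻ x, G x' x := fun x' =>
          lintegral_const_mul _ (hGm.comp measurable_prodMk_left)
        simp_rw [e]
        rw [lintegral_const_mul _ hGm.lintegral_prod_right', hGosc]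

/-- A fixed smoothing is bounded from `L²(U)` to `L²(F)`. -/
theorem IsTraceSet.exists_lintegral_smoothing_le (h : IsTraceSet U F b) {ε : ℝ} (h0 : 0 < ε) :
    ∃ A : ℝ≥0∞, A ≠ ⊤ ∧ ∀ f : Vec d → ℝ, Measurable f →
      ∫⁻ y in F, ‖smoothing U b ε f y‖ₑ ^ 2 ∂surf d ≤ A * ∫⁻ x in U, ‖f x‖ₑ ^ 2 := by
  obtain ⟨M, hM, hle⟩ := avg_le b
  have hUm := h.isOpen.measurableSet
  refine ⟨M * ENNReal.ofReal |(ε ^ d)⁻¹| * surf d F, ENNReal.mul_ne_top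
    (ENNReal.mul_ne_top hM ENNReal.ofReal_ne_top) h.surf_ne_top, fun f hf => ?_⟩
  have hpt : ∀ y, ‖smoothing U b ε f y‖ₑ ^ 2 ≤
      M * ENNReal.ofReal |(ε ^ d)⁻¹| * ∫⁻ x in U, ‖f x‖ₑ ^ 2 := by
    intro y
    have hfm := hf.indicator hUm
    have h1 := enorm_integral_sub_sq_le (P := avg b) (h := fun w => U.indicator f ((1 - ε) • y + ε • w))
      (hfm.comp (by fun_prop)).aestronglyMeasurable 0
    simp only [sub_zero] at h1
    refine h1.trans ((lintegral_avg_comp_le (H := fun x => ‖U.indicator f x‖ₑ ^ 2) (by fun_prop) hle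
      h0.ne' _).trans (le_of_eq ?_))
    congr 1
    rw [← lintegral_indicator hUm]
    refine lintegral_congr fun x => ?_
    by_cases hx : x ∈ U <;> simp [hx]
  refine (lintegral_mono hpt).trans (le_of_eq ?_)
  rw [lintegral_const, Measure.restrict_apply_univ]
  ring

end HDG

namespace HDG
variable {d : ℕ} {U F : Set (Vec d)} {f : Vec d → ℝ} {x₀ : Vec d} {b : ContDiffBump x₀}

/-! ### The trace as the limit of smoothed functions -/

/-- The smoothing parameters `2^(-(j+1))`. -/
noncomputable def dyadic (j : ℕ) : ℝ := (1 / 2) ^ (j + 1)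

theorem dyadic_pos (j : ℕ) : 0 < dyadic j := by unfold dyadic; positivity

theorem dyadic_le_one (j : ℕ) : dyadic j ≤ 1 := pow_le_one₀ (by norm_num) (by norm_num)

theorem dyadic_succ (j : ℕ) : dyadic (j + 1) = dyadic j / 2 := by
  unfold dyadic
  ring

theorem tendsto_dyadic : Tendsto dyadic atTop (𝓝[>] 0) := by
  refine tendsto_nhdsWithin_iff.2 ⟨?_, Eventually.of_forall dyadic_pos⟩
  exact (tendsto_add_atTop_iff_nat 1).2
    (tendsto_pow_atTop_nhds_zero_of_lt_one (by norm_num : (0 : ℝ) ≤ 1 / 2) (by norm_num))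

theorem le_rpow_half_of_sq_le {a b : ℝ≥0∞} (h : a ^ 2 ≤ b) : a ≤ b ^ (1 / 2 : ℝ) := by
  have := ENNReal.rpow_le_rpow h (by norm_num : (0 : ℝ) ≤ 1 / 2)
  rwa [← ENNReal.rpow_natCast, ← ENNReal.rpow_mul, (by norm_num : ((2 : ℕ) : ℝ) * (1 / 2) = 1),
    ENNReal.rpow_one] at this

/-- Powers of `ε` in the distance of two consecutive smoothings: the bound `ε^(-d)` of both averaging
densities, the surface measure `ε^(d - 1)` of a ball and the mean oscillation `ε^(d + 2 r)`
leave `ε^(2 r - 1)`. -/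
theorem density_mul_regularity_mul_osc_rate (hd : 0 < d) {ε D r : ℝ} (hε : 0 < ε) (hD : 0 < D) :
    |((ε / 2) ^ d)⁻¹| * |(ε ^ d)⁻¹| * (ε * D) ^ (d - 1) * (2 * D * ε) ^ ((d : ℝ) + 2 * r) =
      2 ^ d * D ^ (d - 1) * (2 * D) ^ ((d : ℝ) + 2 * r) * ε ^ (2 * r - 1) := by
  rw [abs_of_pos (by positivity), abs_of_pos (by positivity), Real.mul_rpow (by positivity) hε.le,
    Real.rpow_add hε, Real.rpow_natCast, Real.rpow_sub hε, Real.rpow_one, mul_pow, div_pow,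
    ← pow_sub_one_mul hd.ne' ε]
  field_simp

/-- Consecutive smoothings are close in `L²(F)`: this is where `r > 1/2` enters. -/
theorem IsTraceSet.exists_eLpNorm_smoothing_sub_le (h : IsTraceSet U F b) (hd : 0 < d) {r : ℝ}
    (h0 : 1 / 2 < r) (h1 : r ≤ 1) :
    ∃ A B : ℝ≥0∞, A ≠ ⊤ ∧ B < 1 ∧ ∀ f : Vec d → ℝ, Measurable f → MemHs U r f → ∀ j : ℕ,
      eLpNorm (fun x => smoothing U b (dyadic j) f x - smoothing U b (dyadic (j + 1)) f x) 2
        ((surf d).restrict F) ≤ (A * hsSq U r f) ^ (1 / 2 : ℝ) * B ^ j := by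
  obtain ⟨M, hM, hle⟩ := avg_le b
  obtain ⟨C, hC, hr⟩ := h.regular
  obtain ⟨D, hD, hdist⟩ := h.exists_dist_le
  obtain ⟨C₂, hC₂, hosc⟩ := exists_osc_le b h.isOpen h.convex h.isBounded h.ball_subset
    (by linarith : 0 < r) h1
  set c : ℝ := 2 ^ d * D ^ (d - 1) * (2 * D) ^ ((d : ℝ) + 2 * r) with hc
  set q : ℝ := (1 / 2) ^ (r - 1 / 2) with hq
  have hq0 : 0 < q := Real.rpow_pos_of_pos (by norm_num) _
  have hq1 : q < 1 := Real.rpow_lt_one (by norm_num) (by norm_num) (by linarith)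
  have hq2 : ∀ j : ℕ, dyadic j ^ (2 * r - 1) ≤ (q ^ j) ^ 2 := by
    intro j
    have e : dyadic j ^ (2 * r - 1) = (q ^ (j + 1)) ^ 2 := by
      rw [dyadic, hq, ← Real.rpow_natCast, ← Real.rpow_natCast, ← Real.rpow_natCast,
        ← Real.rpow_mul (by positivity), ← Real.rpow_mul (by positivity), ← Real.rpow_mul (by positivity)]
      congr 1
      push_cast
      ring
    rw [e]
    have : q ^ (j + 1) ≤ q ^ j := pow_le_pow_of_le_one hq0.le hq1.le (Nat.le_succ j)
    gcongr
  refine ⟨M * M * C * C₂ * ENNReal.ofReal c, ENNReal.ofReal q, ?_, by simpa using hq1,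
    fun f hf hfr j => ?_⟩
  · exact ENNReal.mul_ne_top (ENNReal.mul_ne_top (ENNReal.mul_ne_top (ENNReal.mul_ne_top hM hM) hC) hC₂)
      ENNReal.ofReal_ne_top
  set ε := dyadic j with hε
  have hε0 : 0 < ε := dyadic_pos j
  have key := h.lintegral_smoothing_sub_le hD hdist hle hr hf (half_pos hε0) (half_le_self hε0.le)
    (dyadic_le_one j)
  have hpos : 0 < 2 * D * ε := by positivity
  have key2 : ∫⁻ y in F, ‖smoothing U b ε f y - smoothing U b (ε / 2) f y‖ₑ ^ 2 ∂surf d ≤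
      M * M * C * C₂ * ENNReal.ofReal c * hsSq U r f * (ENNReal.ofReal q ^ j) ^ 2 := by
    calc _ ≤ _ := key
      _ ≤ M * ENNReal.ofReal |((ε / 2) ^ d)⁻¹| * (M * ENNReal.ofReal |(ε ^ d)⁻¹|) *
          (C * ENNReal.ofReal ((ε * D) ^ (d - 1)) *
            (C₂ * ENNReal.ofReal (2 * D * ε) ^ ((d : ℝ) + 2 * r) * hsSq U r f)) := by
          gcongr
          exact hosc f hf hfr _ hpos
      _ = M * M * C * C₂ * hsSq U r f * ENNReal.ofReal (c * ε ^ (2 * r - 1)) := by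
          rw [hc, ← density_mul_regularity_mul_osc_rate hd hε0 hD, ENNReal.ofReal_rpow_of_pos hpos,
            ENNReal.ofReal_mul (by positivity), ENNReal.ofReal_mul (by positivity),
            ENNReal.ofReal_mul (by positivity)]
          ring
      _ ≤ M * M * C * C₂ * hsSq U r f * ENNReal.ofReal (c * (q ^ j) ^ 2) := by
          gcongr
          exact hq2 j
      _ = _ := by
          rw [ENNReal.ofReal_mul (by positivity), ENNReal.ofReal_pow (by positivity),
            ENNReal.ofReal_pow hq0.le]
          ring
  rw [dyadic_succ, ← hε]
  rw [← eLpNorm_two_sq] at key2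
  refine (le_rpow_half_of_sq_le key2).trans (le_of_eq ?_)
  rw [ENNReal.mul_rpow_of_nonneg _ _ (by norm_num : (0 : ℝ) ≤ 1 / 2), ← ENNReal.rpow_natCast (_ ^ j) 2,
    ← ENNReal.rpow_mul (ENNReal.ofReal q ^ j), (by norm_num : ((2 : ℕ) : ℝ) * (1 / 2) = 1),
    ENNReal.rpow_one]

theorem hsSq_lt_top (hU : IsOpen U) {r : ℝ} (h0 : 0 < r) (h1 : r ≤ 1) (hf : MemHs U r f) :
    hsSq U r f < ⊤ := by
  have hsq : ∀ g : Vec d → ℝ, MemLp g 2 (volume.restrict U) → ∫⁻ x in U, ‖g x‖ₑ ^ 2 < ⊤ := by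
    intro g hg
    rw [← eLpNorm_two_sq]
    exact ENNReal.pow_lt_top hg.2
  rcases h1.lt_or_eq with h1 | rfl
  · have := (memHs_iff_of_lt h0 h1).1 hf
    rw [hsSq_of_lt h0 h1]
    exact ENNReal.add_lt_top.2 ⟨hsq f this.1, this.2⟩
  · obtain ⟨h2, h3⟩ := memHs_one_iff.1 hf
    rw [hsSq_one]
    refine ENNReal.add_lt_top.2 ⟨hsq f h2, ENNReal.sum_lt_top.2 fun i _ => hsq _ ?_⟩
    obtain ⟨g, hg, hg2⟩ := h3 i
    exact hg2.ae_eq (hg.weakPartial_ae_eq hU).symm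

theorem lintegral_sq_le_hsSq (r : ℝ) (f : Vec d → ℝ) : ∫⁻ x in U, ‖f x‖ₑ ^ 2 ≤ hsSq U r f :=
  lintegral_le_sobSq _ _ _

theorem IsTraceSet.memLp_of_continuous (h : IsTraceSet U F b) {g : Vec d → ℝ} (hg : Continuous g) :
    MemLp g 2 ((surf d).restrict F) := by
  have hfin := h.isFiniteMeasure
  have hcomp : IsCompact (closure U) := h.isBounded.isCompact_closure
  obtain ⟨C, hC⟩ := hcomp.exists_bound_of_continuousOn hg.continuousOn
  refine MemLp.of_bound hg.aestronglyMeasurable C ?_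
  filter_upwards [ae_restrict_mem h.measurableSet] with x hx
  exact hC x (h.subset_closure hx)

/-- Existence of the trace as the limit of the smoothed functions, with the trace inequality. -/
theorem IsTraceSet.exists_limit (h : IsTraceSet U F b) (hd : 0 < d) {r : ℝ} (h0 : 1 / 2 < r)
    (h1 : r ≤ 1) :
    ∃ A : ℝ≥0∞, A ≠ ⊤ ∧ ∀ f : Vec d → ℝ, Measurable f → MemHs U r f →
      ∃ g, MemLp g 2 ((surf d).restrict F) ∧
        Tendsto (fun j => eLpNorm (fun x => smoothing U b (dyadic j) f x - g x) 2
          ((surf d).restrict F)) atTop (𝓝 0) ∧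
        eLpNorm g 2 ((surf d).restrict F) ≤ (A * hsSq U r f) ^ (1 / 2 : ℝ) := by
  obtain ⟨A, B, hA, hB, hAB⟩ := h.exists_eLpNorm_smoothing_sub_le hd h0 h1
  obtain ⟨A₀, hA₀, hle⟩ := h.exists_lintegral_smoothing_le (dyadic_pos 0)
  have hUm := h.isOpen.measurableSet
  have hfin : IsFiniteMeasure ((volume : Measure (Vec d)).restrict U) :=
    ⟨by simpa using h.isBounded.measure_lt_top⟩
  set R : ℝ≥0∞ := A₀ ^ (1 / 2 : ℝ) + A ^ (1 / 2 : ℝ) / (1 - B) with hR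
  have h1B : 1 - B ≠ 0 := (tsub_pos_of_lt hB).ne'
  have hRtop : R ≠ ⊤ := ENNReal.add_ne_top.2 ⟨ENNReal.rpow_ne_top_of_nonneg (by norm_num) hA₀,
    ENNReal.div_ne_top (ENNReal.rpow_ne_top_of_nonneg (by norm_num) hA) h1B⟩
  refine ⟨R ^ 2, ENNReal.pow_ne_top hRtop, fun f hf hfr => ?_⟩
  have hfi : IntegrableOn f U := hfr.memLp.integrable one_le_two
  have hsm : ∀ j, MemLp (smoothing U b (dyadic j) f) 2 ((surf d).restrict F) := fun j =>
    h.memLp_of_continuous (contDiff_smoothing b hUm hfi (dyadic_pos j)).continuous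
  let s : ℕ → Lp ℝ 2 ((surf d).restrict F) := fun j => (hsm j).toLp _
  have hstep : ∀ j, edist (s j) (s (j + 1)) ≤ (A * hsSq U r f) ^ (1 / 2 : ℝ) * B ^ j := by
    intro j
    rw [Lp.edist_toLp_toLp]
    exact hAB f hf hfr j
  have hctop : (A * hsSq U r f) ^ (1 / 2 : ℝ) ≠ ⊤ := ENNReal.rpow_ne_top_of_nonneg (by norm_num)
    (ENNReal.mul_ne_top hA (hsSq_lt_top h.isOpen (by linarith) h1 hfr).ne)
  obtain ⟨g, hg⟩ := cauchySeq_tendsto_of_complete (cauchySeq_of_edist_le_geometric B _ hB hctop hstep)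
  have e : ∀ j, edist (s j) g =
      eLpNorm (fun x => smoothing U b (dyadic j) f x - g x) 2 ((surf d).restrict F) := by
    intro j
    rw [Lp.edist_def]
    refine eLpNorm_congr_ae ?_
    filter_upwards [(hsm j).coeFn_toLp] with x hx
    simp [s, hx]
  refine ⟨g, Lp.memLp g, ?_, ?_⟩
  · simp_rw [← e]
    exact tendsto_iff_edist_tendsto_0.1 hg
  · have h2 := edist_le_of_edist_le_geometric_of_tendsto₀ B _ hstep hg
    rw [e] at h2
    have h3 : eLpNorm (smoothing U b (dyadic 0) f) 2 ((surf d).restrict F) ≤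
        (A₀ * hsSq U r f) ^ (1 / 2 : ℝ) := by
      refine le_rpow_half_of_sq_le ?_
      rw [eLpNorm_two_sq]
      refine (hle f hf).trans ?_
      gcongr
      exact lintegral_sq_le_hsSq r f
    have h4 : eLpNorm g 2 ((surf d).restrict F) ≤
        eLpNorm (smoothing U b (dyadic 0) f) 2 ((surf d).restrict F) +
        eLpNorm (fun x => smoothing U b (dyadic 0) f x - g x) 2 ((surf d).restrict F) := by
      have := eLpNorm_sub_le (f := smoothing U b (dyadic 0) f)
        (g := fun x => smoothing U b (dyadic 0) f x - g x) (p := 2) (hsm 0).1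
        ((hsm 0).1.sub (Lp.memLp g).1) one_le_two
      refine le_trans (le_of_eq (congrArg (fun w => eLpNorm w 2 _) ?_)) this
      ext x
      simp
    refine (h4.trans (add_le_add h3 h2)).trans (le_of_eq ?_)
    have hhalf : (0 : ℝ) ≤ 1 / 2 := by norm_num
    rw [ENNReal.mul_rpow_of_nonneg _ _ hhalf, ENNReal.mul_rpow_of_nonneg _ _ hhalf,
      ENNReal.mul_rpow_of_nonneg _ _ hhalf, ← ENNReal.rpow_natCast R 2, ← ENNReal.rpow_mul,
      (by norm_num : ((2 : ℕ) : ℝ) * (1 / 2) = 1), ENNReal.rpow_one, hR]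
    simp only [div_eq_mul_inv]
    ring

/-- Smoothings of a continuous function converge to it on the closure of `U`. -/
theorem IsTraceSet.tendsto_smoothing_of_continuous (h : IsTraceSet U F b) {φ : Vec d → ℝ}
    (hφ : Continuous φ) :
    Tendsto (fun j => eLpNorm (fun x => smoothing U b (dyadic j) φ x - φ x) 2
      ((surf d).restrict F)) atTop (𝓝 0) := by
  have hfin := h.isFiniteMeasure
  have hUm := h.isOpen.measurableSet
  have hcomp : IsCompact (closure U) := h.isBounded.isCompact_closure
  have hφi : IntegrableOn φ U :=
    (hφ.continuousOn.integrableOn_compact hcomp).mono_set _root_.subset_closure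
  obtain ⟨D, hD, hdist⟩ := h.exists_dist_le
  rw [ENNReal.tendsto_nhds_zero]
  intro η hη
  have hμtop : ((surf d).restrict F) univ ^ (2 : ℝ≥0∞).toReal⁻¹ ≠ ⊤ :=
    ENNReal.rpow_ne_top_of_nonneg (by simp) (measure_ne_top _ _)
  obtain ⟨ω, hω0, hω⟩ := ENNReal.exists_nnreal_pos_mul_lt hμtop hη.ne'
  obtain ⟨δ, hδ, hφδ⟩ := Metric.uniformContinuousOn_iff.1
    (hcomp.uniformContinuousOn_of_continuous hφ.continuousOn) ω (by exact_mod_cast hω0)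
  have hev := tendsto_dyadic.eventually (Ioo_mem_nhdsGT (div_pos hδ hD))
  filter_upwards [hev] with j hj
  set ε := dyadic j
  refine (eLpNorm_le_of_ae_bound (C := ω) ?_).trans (by rw [mul_comm]; simpa using hω.le)
  filter_upwards [ae_restrict_mem h.measurableSet] with y hy
  have hyU := h.subset_closure hy
  have e : smoothing U b ε φ y - φ y =
      ∫ w, (U.indicator φ ((1 - ε) • y + ε • w) - φ y) ∂avg b := by
    rw [integral_sub (integrable_avg_comp b hUm hφi hj.1.ne' _) (integrable_const _)]
    simp [smoothing]
  rw [e]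
  refine (norm_integral_le_of_norm_le_const (C := ω) ?_).trans (by simp)
  filter_upwards [ae_avg_mem b h.ball_subset] with w hw
  have hm := h.contraction_mem hyU hw hj.1 (dyadic_le_one j)
  rw [indicator_of_mem hm, ← dist_eq_norm]
  refine (hφδ _ (_root_.subset_closure hm) _ hyU ?_).le
  rw [dist_eq_norm]
  have : (1 - ε) • y + ε • w - y = ε • (w - y) := by module
  rw [this, norm_smul, Real.norm_of_nonneg hj.1.le, ← dist_eq_norm]
  have h2 := hdist w (_root_.subset_closure hw) y hyU
  calc ε * dist w y ≤ ε * D := by gcongr; exact hj.1.le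
    _ < δ := by
      rw [← lt_div_iff₀ hD]
      exact hj.2

end HDG

namespace HDG
variable {d : ℕ} {U F : Set (Vec d)} {f : Vec d → ℝ} {x₀ : Vec d} {b : ContDiffBump x₀}

/-! ### Existence and uniqueness of traces -/

theorem ae_eq_of_tendsto_eLpNorm {α ι : Type*} [MeasurableSpace α] {μ : Measure α} {l : Filter ι} [l.NeBot]
    {s : ι → α → ℝ} {a b : α → ℝ} (hs : ∀ᶠ i in l, AEStronglyMeasurable (s i) μ)
    (ha : AEStronglyMeasurable a μ) (hb : AEStronglyMeasurable b μ)
    (h1 : Tendsto (fun i => eLpNorm (fun x => s i x - a x) 2 μ) l (𝓝 0))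
    (h2 : Tendsto (fun i => eLpNorm (fun x => s i x - b x) 2 μ) l (𝓝 0)) : a =ᵐ[μ] b := by
  have h3 := h1.add h2
  rw [add_zero] at h3
  have h4 : eLpNorm (fun x => a x - b x) 2 μ ≤ 0 := by
    refine ge_of_tendsto h3 ?_
    filter_upwards [hs] with i hi
    have := eLpNorm_sub_le (p := 2) (hi.sub hb) (hi.sub ha) one_le_two
    refine (le_of_eq (congrArg (fun w => eLpNorm w 2 μ) ?_)).trans (this.trans (le_of_eq (add_comm _ _)))
    ext x
    simp
  have h5 := (eLpNorm_eq_zero_iff (ha.sub hb) (by simp)).1 (nonpos_iff_eq_zero.1 h4)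
  filter_upwards [h5] with x hx
  exact sub_eq_zero.1 hx

/-- Reduction to `r ≤ 1`. -/
theorem MemHs.exists_le_one {r : ℝ} (hr : 1 / 2 < r) (hf : MemHs U r f) :
    ∃ r', 1 / 2 < r' ∧ r' ≤ 1 ∧ MemHs U r' f ∧ ∀ g : Vec d → ℝ, hsSq U r' g ≤ hsSq U r g := by
  rcases lt_or_ge r 1 with h | h
  · exact ⟨r, hr, h.le, hf, fun g => le_rfl⟩
  · exact ⟨1, by norm_num, le_rfl, memHs_one_iff.2 (hf.memH1 h), hsSq_one_le h⟩

theorem IsTraceSet.memLp_volume (h : IsTraceSet U F b) {g : Vec d → ℝ} (hg : Continuous g) :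
    MemLp g 2 (volume.restrict U) := by
  have hfin : IsFiniteMeasure ((volume : Measure (Vec d)).restrict U) :=
    ⟨by simpa using h.isBounded.measure_lt_top⟩
  obtain ⟨C, hC⟩ := h.isBounded.isCompact_closure.exists_bound_of_continuousOn hg.continuousOn
  refine MemLp.of_bound hg.aestronglyMeasurable C ?_
  filter_upwards [ae_restrict_mem h.isOpen.measurableSet] with x hx
  exact hC x (_root_.subset_closure hx)

theorem IsTraceSet.memH1_of_contDiff (h : IsTraceSet U F b) {g : Vec d → ℝ} (hg : ContDiff ℝ 1 g) :
    MemH1 U g := by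
  refine ⟨h.memLp_volume hg.continuous, fun i => ⟨_, HasWeakPartial.of_contDiff i hg, h.memLp_volume ?_⟩⟩
  have := hg.continuous_fderiv one_ne_zero
  fun_prop

theorem IsTraceSet.tendsto_of_hasTrace_of_measurable (h : IsTraceSet U F b) (hd : 0 < d)
    {g : Vec d → ℝ} (hf : Measurable f) (ht : HasTrace U F f g) :
    Tendsto (fun j => eLpNorm (fun x => smoothing U b (dyadic j) f x - g x) 2
      ((surf d).restrict F)) atTop (𝓝 0) := by
  have hUm := h.isOpen.measurableSet
  have hfin : IsFiniteMeasure ((volume : Measure (Vec d)).restrict U) :=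
    ⟨by simpa using h.isBounded.measure_lt_top⟩
  obtain ⟨hg, r, hr, hfr, φ, hφ, hφf, hφg⟩ := ht
  obtain ⟨r', hr', hr1, hfr', hle⟩ := hfr.exists_le_one hr
  have hr0 : 0 < r' := by linarith
  obtain ⟨A, hA, hT⟩ := h.exists_limit hd hr' hr1
  obtain ⟨Tf, hTf, hTf1, -⟩ := hT f hf hfr'
  have hfi : IntegrableOn f U := hfr'.memLp.integrable one_le_two
  have hφf' : Tendsto (fun n => hsSq U r' (fun x => φ n x - f x)) atTop (𝓝 0) :=
    tendsto_of_tendsto_of_tendsto_of_le_of_le tendsto_const_nhds hφf (fun _ => zero_le) fun n => hle _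
  have hmem : ∀ᶠ n in atTop, MemHs U r' (fun x => φ n x - f x) := by
    filter_upwards [hφf'.eventually_lt_const ENNReal.zero_lt_top] with n hn
    have h2 : MemLp (fun x => φ n x - f x) 2 (volume.restrict U) :=
      (h.memLp_volume (hφ n).continuous).sub hfr'.memLp
    rcases hr1.lt_or_eq with h1 | rfl
    · refine (memHs_iff_of_lt hr0 h1).2 ⟨h2, ?_⟩
      rw [hsSq_of_lt hr0 h1] at hn
      exact (le_add_self).trans_lt hn
    · have a1 := h.memH1_of_contDiff ((hφ n).of_le (by simp))
      have a2 := memHs_one_iff.1 hfr'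
      refine memHs_one_iff.2 ⟨h2, fun i => ?_⟩
      obtain ⟨g1, hg1, hg1'⟩ := a1.2 i
      obtain ⟨g2, hg2, hg2'⟩ := a2.2 i
      exact ⟨_, hg1.sub hg2, hg1'.sub hg2'⟩
  have hsmm : ∀ (j : ℕ) {ψ : Vec d → ℝ}, IntegrableOn ψ U →
      AEStronglyMeasurable (smoothing U b (dyadic j) ψ) ((surf d).restrict F) := fun j ψ hψ =>
    (contDiff_smoothing b hUm hψ (dyadic_pos j)).continuous.aestronglyMeasurable
  -- the limit of the smoothings of `φ n - f` is `φ n - Tf`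
  have hbound : ∀ᶠ n in atTop, eLpNorm (fun x => φ n x - Tf x) 2 ((surf d).restrict F) ≤
      (A * hsSq U r' (fun x => φ n x - f x)) ^ (1 / 2 : ℝ) := by
    filter_upwards [hmem] with n hn
    obtain ⟨Th, hTh, hTh1, hTh2⟩ := hT _ ((hφ n).continuous.measurable.sub hf) hn
    have hφi : IntegrableOn (φ n) U := (h.memLp_volume (hφ n).continuous).integrable one_le_two
    have hc := h.tendsto_smoothing_of_continuous (hφ n).continuous
    have h3 : Tendsto (fun j => eLpNorm (fun x => smoothing U b (dyadic j) (fun x => φ n x - f x) x -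
        (φ n x - Tf x)) 2 ((surf d).restrict F)) atTop (𝓝 0) := by
      have hsum := hc.add hTf1
      rw [add_zero] at hsum
      refine tendsto_of_tendsto_of_tendsto_of_le_of_le tendsto_const_nhds hsum (fun _ => zero_le)
        fun j => ?_
      have := eLpNorm_sub_le (p := 2) ((hsmm j hφi).sub (hφ n).continuous.aestronglyMeasurable)
        ((hsmm j hfi).sub hTf.1) one_le_two
      refine le_trans (le_of_eq (congrArg (fun w => eLpNorm w 2 _) ?_)) this
      ext x
      rw [smoothing_sub b hUm hφi hfi (dyadic_pos j).ne']
      simp only [Pi.sub_apply]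
      ring
    have hae := ae_eq_of_tendsto_eLpNorm (Eventually.of_forall fun j =>
      hsmm j (ψ := fun x => φ n x - f x) (hφi.sub hfi)) hTh.1
      ((hφ n).continuous.aestronglyMeasurable.sub hTf.1) hTh1 h3
    rw [← eLpNorm_congr_ae (f := Th) (g := fun x => φ n x - Tf x) hae]
    exact hTh2
  have hTf0 : Tendsto (fun n => eLpNorm (fun x => φ n x - Tf x) 2 ((surf d).restrict F)) atTop (𝓝 0) := by
    refine tendsto_of_tendsto_of_tendsto_of_le_of_le' tendsto_const_nhds ?_
      (Eventually.of_forall fun _ => zero_le) hbound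
    have h1 := ENNReal.Tendsto.const_mul (a := A) hφf' (Or.inr hA)
    have h2 := h1.ennrpow_const (1 / 2)
    simpa using h2
  have hae : Tf =ᵐ[(surf d).restrict F] g := ae_eq_of_tendsto_eLpNorm
    (Eventually.of_forall fun n => (hφ n).continuous.aestronglyMeasurable) hTf.1 hg.1 hTf0 hφg
  refine hTf1.congr fun j => eLpNorm_congr_ae ?_
  filter_upwards [hae] with x hx
  rw [hx]

/-- Every trace is the limit of the smoothed functions. In particular, traces are unique and do not
depend on the order `r` and the approximating sequence in the definition of `HasTrace`. -/
theorem IsTraceSet.tendsto_of_hasTrace (h : IsTraceSet U F b) (hd : 0 < d)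
    {g : Vec d → ℝ} (ht : HasTrace U F f g) :
    Tendsto (fun j => eLpNorm (fun x => smoothing U b (dyadic j) f x - g x) 2
      ((surf d).restrict F)) atTop (𝓝 0) := by
  have hm : AEStronglyMeasurable f (volume.restrict U) := by
    obtain ⟨-, r, -, hfr, -⟩ := ht
    exact hfr.memLp.1
  have := h.tendsto_of_hasTrace_of_measurable hd hm.stronglyMeasurable_mk.measurable
    (ht.congr hm.ae_eq_mk (EventuallyEq.refl _ g))
  refine this.congr fun j => ?_
  rw [smoothing_congr b h.isOpen.measurableSet hm.ae_eq_mk (dyadic_pos j)]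

/-- Smoothings serve as the approximating smooth functions in the definition of the trace. -/
theorem IsTraceSet.exists_hasTrace (h : IsTraceSet U F b) (hd : 0 < d) {r : ℝ} (hr : 1 / 2 < r)
    (hf : MemHs U r f) : ∃ g, HasTrace U F f g := by
  have hfin : IsFiniteMeasure ((volume : Measure (Vec d)).restrict U) :=
    ⟨by simpa using h.isBounded.measure_lt_top⟩
  have hm : AEStronglyMeasurable f (volume.restrict U) := hf.memLp.1
  set f' := hm.mk f
  have hf' : Measurable f' := hm.stronglyMeasurable_mk.measurable
  have hff' : f =ᵐ[volume.restrict U] f' := hm.ae_eq_mk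
  obtain ⟨r', hr', hr1, hfr', -⟩ := (hf.congr hff').exists_le_one hr
  obtain ⟨A, hA, hT⟩ := h.exists_limit hd hr' hr1
  obtain ⟨g, hg, hg1, -⟩ := hT f' hf' hfr'
  refine ⟨g, HasTrace.congr hff'.symm (EventuallyEq.refl _ g) ⟨hg, r', hr', hfr',
    fun j => smoothing U b (dyadic j) f', fun j => ?_, ?_, hg1⟩⟩
  · exact contDiff_smoothing b h.isOpen.measurableSet (hfr'.memLp.integrable one_le_two) (dyadic_pos j)
  · exact (tendsto_hsSq_smoothing b h.isOpen h.convex h.isBounded h.ball_subset hf' (by linarith) hr1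
      hfr').comp tendsto_dyadic

theorem IsTraceSet.hasTrace_unique (h : IsTraceSet U F b) (hd : 0 < d) {g g' : Vec d → ℝ}
    (ht : HasTrace U F f g) (ht' : HasTrace U F f g') : g =ᵐ[(surf d).restrict F] g' := by
  have hfin : IsFiniteMeasure ((volume : Measure (Vec d)).restrict U) :=
    ⟨by simpa using h.isBounded.measure_lt_top⟩
  have hfi : IntegrableOn f U := by
    obtain ⟨-, r, -, hfr, -⟩ := ht
    exact hfr.memLp.integrable one_le_two
  exact ae_eq_of_tendsto_eLpNorm (Eventually.of_forall fun j =>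
    (contDiff_smoothing b h.isOpen.measurableSet hfi (dyadic_pos j)).continuous.aestronglyMeasurable)
    ht.1.1 ht'.1.1 (h.tendsto_of_hasTrace hd ht) (h.tendsto_of_hasTrace hd ht')

theorem HasTrace.trace {g : Vec d → ℝ} (ht : HasTrace U F f g) : HasTrace U F f (trace U F f) := by
  have hex : ∃ g, HasTrace U F f g := ⟨g, ht⟩
  rw [HDG.trace, dif_pos hex]
  exact hex.choose_spec

theorem IsTraceSet.hasTrace_of_contDiff (h : IsTraceSet U F b) {φ : Vec d → ℝ}
    (hφ : ContDiff ℝ (⊤ : ℕ∞) φ) : HasTrace U F φ φ := by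
  refine ⟨h.memLp_of_continuous hφ.continuous, 1, by norm_num,
    memHs_one_iff.2 (h.memH1_of_contDiff (hφ.of_le (by simp))), fun _ => φ, fun _ => hφ, ?_, ?_⟩
  · have e : hsSq U 1 (fun _ => (0 : ℝ)) = 0 := by
      have hw : ∀ i, weakPartial U i (fun _ => (0 : ℝ)) =ᵐ[volume.restrict U] 0 := fun i => by
        have := (HasWeakPartial.of_contDiff (U := U) i
          (contDiff_const (c := (0 : ℝ)))).weakPartial_ae_eq h.isOpen
        simpa [Pi.zero_def] using this
      rw [hsSq_one]
      have : ∀ i, ∫⁻ x in U, ‖weakPartial U i (fun _ => (0 : ℝ)) x‖ₑ ^ 2 = 0 := fun i => by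
        rw [lintegral_congr_ae (g := 0) (by filter_upwards [hw i] with x hx; simp [hx])]
        simp
      simp [this]
    simp only [sub_self, e]
    exact tendsto_const_nhds
  · simp

/-- The faces of a mesh element satisfy the hypotheses of the trace theorem. -/
theorem Mesh.exists_isTraceSet {Ω : Set (Vec d)} (𝓣 : Mesh Ω) (hd : 0 < d) (hΩ : IsPolyDomain Ω)
    {K : Set (Vec d)} (hK : K ∈ 𝓣.elems) :
    ∃ (x₀ : Vec d) (b : ContDiffBump x₀), Metric.closedBall x₀ b.rOut ⊆ interior K ∧
      ∀ F ∈ 𝓣.facesOf K, IsTraceSet (interior K) F b := by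
  have hel := 𝓣.isElement K hK
  obtain ⟨x₀, hx₀⟩ := hel.nonempty_interior
  obtain ⟨ρ, hρ, hball⟩ := Metric.isOpen_iff.1 isOpen_interior x₀ hx₀
  let b : ContDiffBump x₀ := ⟨ρ / 4, ρ / 2, by positivity, by linarith⟩
  have hb : Metric.closedBall x₀ b.rOut ⊆ interior K :=
    (Metric.closedBall_subset_ball (by change ρ / 2 < ρ; linarith)).trans hball
  refine ⟨x₀, b, hb, fun F hF => ⟨isOpen_interior, hel.convex.interior,
    hel.isCompact.isBounded.subset _root_.interior_subset, hb,
    (𝓣.isCompact_of_mem_faces hF.1).isClosed.measurableSet, ?_, ?_⟩⟩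
  · rw [hel.convex.closure_interior_eq_closure_of_nonempty_interior hel.nonempty_interior,
      hel.isCompact.isClosed.closure_eq]
    exact hF.2
  · obtain ⟨a, ha, -⟩ := 𝓣.exists_normal_flat hd hΩ hK hF
    obtain ⟨C, hC, h⟩ := surf_flat_inter_closedBall_le hd (𝓣.normal_spec hd hΩ hK hF).1 a
    exact ⟨C, hC, fun x ρ hρ => (measure_mono (inter_subset_inter_left _ ha)).trans (h x ρ hρ)⟩

end HDG

namespace HDG
variable {d : ℕ} {U F : Set (Vec d)} {f : Vec d → ℝ} {x₀ : Vec d} {b : ContDiffBump x₀}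

/-! ### Integration by parts for fields with weak divergence -/

theorem tendsto_integral_mul {α : Type*} [MeasurableSpace α] {μ : Measure α} {s : ℕ → α → ℝ}
    {a w : α → ℝ} (hs : ∀ j, MemLp (s j) 2 μ) (ha : MemLp a 2 μ) (hw : MemLp w 2 μ)
    (h : Tendsto (fun j => eLpNorm (fun x => s j x - a x) 2 μ) atTop (𝓝 0)) :
    Tendsto (fun j => ∫ x, w x * s j x ∂μ) atTop (𝓝 (∫ x, w x * a x ∂μ)) := by
  refine tendsto_integral_of_L1' _ (hw.integrable_mul ha).1
    (Eventually.of_forall fun j => hw.integrable_mul (hs j)) ?_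
  have h1 := ENNReal.Tendsto.const_mul (a := eLpNorm w 2 μ) h (Or.inr hw.2.ne)
  rw [mul_zero] at h1
  refine tendsto_of_tendsto_of_tendsto_of_le_of_le tendsto_const_nhds h1 (fun _ => zero_le) fun j => ?_
  have := eLpNorm_smul_le_mul_eLpNorm (r := 1) (p := 2) (q := 2) ((hs j).sub ha).1 hw.1
  refine le_trans (le_of_eq (congrArg (fun w => eLpNorm w 1 μ) ?_)) this
  ext x
  simp [mul_sub]

theorem tendsto_smoothing_dyadic (hUo : IsOpen U) (hUc : Convex ℝ U) (hUb : Bornology.IsBounded U)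
    (hb : Metric.closedBall x₀ b.rOut ⊆ U) (hf2 : MemLp f 2 (volume.restrict U)) :
    Tendsto (fun j => eLpNorm (fun x => smoothing U b (dyadic j) f x - f x) 2 (volume.restrict U))
      atTop (𝓝 0) := by
  have hff' := hf2.1.ae_eq_mk
  have h := (tendsto_smoothing b hUo hUc hUb hb hf2.1.stronglyMeasurable_mk.measurable
    (hf2.ae_eq hff')).comp tendsto_dyadic
  refine h.congr fun j => eLpNorm_congr_ae ?_
  filter_upwards [hff'] with x hx
  rw [smoothing_congr b hUo.measurableSet hff' (dyadic_pos j), hx]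

theorem memLp_restrict_of_continuous {K : Set (Vec d)} (hU : Bornology.IsBounded K)
    (hK : MeasurableSet K) {g : Vec d → ℝ} (hg : Continuous g) : MemLp g 2 (volume.restrict K) := by
  have hfin : IsFiniteMeasure ((volume : Measure (Vec d)).restrict K) :=
    ⟨by simpa using hU.measure_lt_top⟩
  obtain ⟨C, hC⟩ := hU.isCompact_closure.exists_bound_of_continuousOn hg.continuousOn
  refine MemLp.of_bound hg.aestronglyMeasurable C ?_
  filter_upwards [ae_restrict_mem hK] with x hx
  exact hC x (_root_.subset_closure hx)

namespace Mesh

variable {Ω : Set (Vec d)} (𝓣 : Mesh Ω) {K K' : Set (Vec d)}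

/-- Integration by parts on a mesh element, for fields with square integrable weak divergence whose
components have traces on the faces. -/
theorem integral_weakDiv_mul (hd : 0 < d) (hΩ : IsPolyDomain Ω) (hK : K ∈ 𝓣.elems) {q : Vec d → Vec d}
    {g : Vec d → ℝ} (hq : ∀ i, MemLp (compV q i) 2 (volume.restrict (interior K)))
    (hg : MemLp g 2 (volume.restrict (interior K))) (hqg : HasWeakDiv (interior K) q g)
    {t : Set (Vec d) → Fin d → Vec d → ℝ}
    (ht : ∀ F ∈ 𝓣.facesOf K, ∀ i, HasTrace (interior K) F (compV q i) (t F i))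
    {v : Vec d → ℝ} (hv : ContDiff ℝ (⊤ : ℕ∞) v) :
    (∑ i, ∫ x in K, fderiv ℝ v x (EuclideanSpace.single i 1) * q x i) + ∫ x in K, v x * g x =
      ∑ᶠ F ∈ 𝓣.facesOf K, ∑ i, ∫ x in F, v x * normal K F i * t F i x ∂surf d := by
  obtain ⟨x₀, b, hb, hT⟩ := 𝓣.exists_isTraceSet hd hΩ hK
  have hel := 𝓣.isElement K hK
  have hUo : IsOpen (interior K) := isOpen_interior
  have hUm := hUo.measurableSet
  have hUc := hel.convex.interior
  have hUb : Bornology.IsBounded (interior K) := hel.isCompact.isBounded.subset _root_.interior_subset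
  have hfin : IsFiniteMeasure ((volume : Measure (Vec d)).restrict (interior K)) :=
    ⟨by simpa using hUb.measure_lt_top⟩
  have hqi : ∀ i, IntegrableOn (compV q i) (interior K) := fun i => (hq i).integrable one_le_two
  have hgi : IntegrableOn g (interior K) := hg.integrable one_le_two
  have hv1 : ContDiff ℝ 1 v := hv.of_le (by simp)
  have hcv := hv1.continuous_fderiv one_ne_zero
  let s : ℕ → Fin d → Vec d → ℝ := fun j i => smoothing (interior K) b (dyadic j) (compV q i)
  have hs : ∀ j i, ContDiff ℝ (⊤ : ℕ∞) (s j i) := fun j i =>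
    contDiff_smoothing b hUm (hqi i) (dyadic_pos j)
  let sg : ℕ → Vec d → ℝ := fun j => smoothing (interior K) b (dyadic j) g
  have hsg : ∀ j, ContDiff ℝ (⊤ : ℕ∞) (sg j) := fun j => contDiff_smoothing b hUm hgi (dyadic_pos j)
  have hL : ∀ {w : Vec d → ℝ}, Continuous w → MemLp w 2 (volume.restrict (interior K)) := fun hw =>
    memLp_restrict_of_continuous hUb hUm hw
  rw [← 𝓣.restrict_interior hK]
  -- the identity for the smoothed field
  have hj : ∀ j, (∑ i, ∫ x in interior K, fderiv ℝ v x (EuclideanSpace.single i 1) * s j i x) +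
      (1 - dyadic j) * ∫ x in interior K, v x * sg j x =
      ∑ᶠ F ∈ 𝓣.facesOf K, ∑ i, ∫ x in F, v x * normal K F i * s j i x ∂surf d := by
    intro j
    have hgauss : ∀ i, ∫ x in interior K, fderiv ℝ (fun x => v x * s j i x) x (EuclideanSpace.single i 1) =
        ∑ᶠ F ∈ 𝓣.facesOf K, ∫ x in F, v x * normal K F i * s j i x ∂surf d := by
      intro i
      rw [𝓣.restrict_interior hK, 𝓣.integral_fderiv hd hΩ hK
        ((hv.mul (hs j i)).of_le (by simp)) (EuclideanSpace.single i 1)]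
      refine finsum_mem_congr rfl fun F hF => integral_congr_ae (Eventually.of_forall fun x => ?_)
      simp only [EuclideanSpace.inner_single_right, one_mul, conj_trivial]
      ring
    have hsum : ∑ i, ∫ x in interior K, fderiv ℝ (fun x => v x * s j i x) x (EuclideanSpace.single i 1) =
        (∑ i, ∫ x in interior K, fderiv ℝ v x (EuclideanSpace.single i 1) * s j i x) +
        (1 - dyadic j) * ∫ x in interior K, v x * sg j x := by
      have hder : ∀ i x, fderiv ℝ (fun x => v x * s j i x) x (EuclideanSpace.single i 1) =
          fderiv ℝ v x (EuclideanSpace.single i 1) * s j i x +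
          v x * fderiv ℝ (s j i) x (EuclideanSpace.single i 1) := by
        intro i x
        rw [fderiv_fun_mul (hv.differentiable (by simp) x) ((hs j i).differentiable (by simp) x)]
        simp
        ring
      have hcs : ∀ i, Continuous fun x => fderiv ℝ (s j i) x (EuclideanSpace.single i 1) := fun i => by
        have := ((hs j i).of_le (m := 1) (by simp)).continuous_fderiv one_ne_zero
        fun_prop
      have hcv' : ∀ i, Continuous fun x => fderiv ℝ v x (EuclideanSpace.single i 1) := fun i => by
        fun_prop
      have hi1 : ∀ i, IntegrableOn (fun x => fderiv ℝ v x (EuclideanSpace.single i 1) * s j i x)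
        (interior K) := fun i => (hL (hcv' i)).integrable_mul (hL (hs j i).continuous)
      have hi2 : ∀ i, IntegrableOn (fun x => v x * fderiv ℝ (s j i) x (EuclideanSpace.single i 1))
        (interior K) := fun i => (hL hv.continuous).integrable_mul (hL (hcs i))
      simp_rw [hder]
      rw [Finset.sum_congr rfl fun i _ => integral_add (hi1 i) (hi2 i), Finset.sum_add_distrib,
        ← integral_finsetSum _ (fun i _ => hi2 i), ← integral_const_mul]
      congr 1
      refine setIntegral_congr_fun hUm fun x hx => ?_
      rw [← Finset.mul_sum, div_smoothing b hUo hUc hb (dyadic_pos j) (dyadic_le_one j) hqg hqi hx]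
      ring
    rw [← hsum, Finset.sum_congr rfl fun i _ => hgauss i]
    simp_rw [finsum_mem_eq_finite_toFinset_sum _ 𝓣.finite_facesOf]
    rw [Finset.sum_comm]
  have hlim1 : Tendsto (fun j => (∑ i, ∫ x in interior K,
      fderiv ℝ v x (EuclideanSpace.single i 1) * s j i x) +
      (1 - dyadic j) * ∫ x in interior K, v x * sg j x) atTop
      (𝓝 ((∑ i, ∫ x in interior K, fderiv ℝ v x (EuclideanSpace.single i 1) * compV q i x) +
      (1 - 0) * ∫ x in interior K, v x * g x)) := by
    refine Tendsto.add (tendsto_finsetSum _ fun i _ => ?_) (Tendsto.mul ?_ ?_)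
    · refine tendsto_integral_mul (fun j => hL (hs j i).continuous) (hq i) (hL (by fun_prop)) ?_
      exact tendsto_smoothing_dyadic hUo hUc hUb hb (hq i)
    · exact tendsto_const_nhds.sub (tendsto_dyadic.mono_right nhdsWithin_le_nhds)
    · refine tendsto_integral_mul (fun j => hL (hsg j).continuous) hg (hL hv.continuous) ?_
      exact tendsto_smoothing_dyadic hUo hUc hUb hb hg
  have hlim2 : Tendsto (fun j => ∑ᶠ F ∈ 𝓣.facesOf K, ∑ i,
      ∫ x in F, v x * normal K F i * s j i x ∂surf d) atTop
      (𝓝 (∑ᶠ F ∈ 𝓣.facesOf K, ∑ i, ∫ x in F, v x * normal K F i * t F i x ∂surf d)) := by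
    simp_rw [finsum_mem_eq_finite_toFinset_sum _ 𝓣.finite_facesOf]
    refine tendsto_finsetSum _ fun F hF => tendsto_finsetSum _ fun i _ => ?_
    have hF' : F ∈ 𝓣.facesOf K := (Set.Finite.mem_toFinset _).1 hF
    refine tendsto_integral_mul (fun j => (hT F hF').memLp_of_continuous (hs j i).continuous)
      (ht F hF' i).1 ((hT F hF').memLp_of_continuous (by have := hv.continuous; fun_prop)) ?_
    exact (hT F hF').tendsto_of_hasTrace hd (ht F hF' i)
  have := tendsto_nhds_unique hlim1 (hlim2.congr fun j => (hj j).symm)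
  rw [sub_zero, one_mul] at this
  exact this

/-- A test function supported in the interior of `K ∪ K'` vanishes a.e. on the faces of `K` other than
`K ∩ K'`. -/
theorem setIntegral_eq_zero_of_test (hd : 0 < d) (hΩ : IsPolyDomain Ω) (hK : K ∈ 𝓣.elems)
    (hK' : K' ∈ 𝓣.elems) (hF : K ∩ K' ∈ 𝓣.facesOf K) (hF' : F ∈ 𝓣.facesOf K) (hne : F ≠ K ∩ K')
    {φ : Vec d → ℝ} (hφ : IsTest (interior (K ∪ K')) φ) (w : Vec d → ℝ) :
    ∫ x in F, φ x * w x ∂surf d = 0 := by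
  refine setIntegral_eq_zero_of_ae_eq_zero ?_
  have h0 := 𝓣.surf_inter_facesOf hd hΩ hK hF' hF hne
  rw [ae_iff]
  refine measure_mono_null (fun x hx => ?_) h0
  simp only [Classical.not_imp] at hx
  obtain ⟨hxF, hx0⟩ := hx
  refine ⟨hxF, hF'.2 hxF, ?_⟩
  have hxW : x ∈ interior (K ∪ K') := by
    by_contra hcon
    exact hx0 (by rw [(hφ.eq_zero hcon).1, zero_mul])
  by_contra hcon
  have hfr := 𝓣.facesOf_subset_frontier hd hΩ hK hF' hxF
  have hcl : IsClosed K' := (𝓣.isElement K' hK').isCompact.isClosed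
  refine hfr.2 (mem_interior_iff_mem_nhds.2 ?_)
  filter_upwards [isOpen_interior.mem_nhds hxW, hcl.isOpen_compl.mem_nhds hcon] with y hy hy'
  exact (_root_.interior_subset hy).resolve_right hy'

/-- The normal component of a field with square integrable weak divergence does not jump across
interior faces: integrate by parts on both elements against test functions supported in the interior
of their union. -/
theorem normal_trace_add_eq_zero (hd : 0 < d) (hΩ : IsPolyDomain Ω) (hK : K ∈ 𝓣.elems)
    (hK' : K' ∈ 𝓣.elems) (hne : K ≠ K') (hF : K ∩ K' ∈ 𝓣.facesOf K) {q : Vec d → Vec d} {g : Vec d → ℝ}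
    (hq : ∀ i, MemLp (compV q i) 2 (volume.restrict Ω)) (hg : MemLp g 2 (volume.restrict Ω))
    (hqg : HasWeakDiv Ω q g) {t : Set (Vec d) → Set (Vec d) → Fin d → Vec d → ℝ}
    (ht : ∀ K ∈ 𝓣.elems, ∀ F ∈ 𝓣.facesOf K, ∀ i, HasTrace (interior K) F (compV q i) (t K F i)) :
    ∀ᵐ x ∂(surf d).restrict (K ∩ K'),
      (∑ i, normal K (K ∩ K') i * t K (K ∩ K') i x) + ∑ i, normal K' (K ∩ K') i * t K' (K ∩ K') i x = 0 := by
  have hF' : K ∩ K' ∈ 𝓣.facesOf K' := ⟨hF.1, inter_subset_right⟩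
  have hsub : ∀ {K}, K ∈ 𝓣.elems → (volume : Measure (Vec d)).restrict (interior K) ≤ volume.restrict Ω :=
    fun hK => Measure.restrict_mono (𝓣.interior_subset hΩ hK) le_rfl
  have hfinF : IsFiniteMeasure ((surf d).restrict (K ∩ K')) :=
    ⟨by simpa using (𝓣.surf_ne_top hd hΩ hF.1).lt_top⟩
  have hWΩ := 𝓣.interior_union_subset hΩ hK hK'
  set W := interior (K ∪ K') with hW
  set w : Vec d → ℝ := fun x => (∑ i, normal K (K ∩ K') i * t K (K ∩ K') i x) +
    ∑ i, normal K' (K ∩ K') i * t K' (K ∩ K') i x with hw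
  have hmem : ∀ L, L ∈ 𝓣.elems → K ∩ K' ∈ 𝓣.facesOf L → ∀ i,
      MemLp (fun x => normal L (K ∩ K') i * t L (K ∩ K') i x) 2 ((surf d).restrict (K ∩ K')) :=
    fun L hL hFL i => (ht L hL _ hFL i).1.const_mul _
  have hw2 : MemLp w 2 ((surf d).restrict (K ∩ K')) :=
    (memLp_finsetSum _ fun i _ => hmem K hK hF i).add (memLp_finsetSum _ fun i _ => hmem K' hK' hF' i)
  have hwi : Integrable w ((surf d).restrict (K ∩ K')) := hw2.integrable one_le_two
  have key := isOpen_interior.ae_eq_zero_of_integral_contDiff_smul_eq_zero (U := W)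
    (μ := (surf d).restrict (K ∩ K')) (hwi.locallyIntegrable.locallyIntegrableOn W) ?_
  · have hnull : ∀ᵐ x ∂(surf d).restrict (K ∩ K'), x ∈ W := by
      have h0 := surf_inter_diff_interior_union hd (𝓣.isElement K hK).convex (𝓣.isElement K' hK').convex
        (𝓣.isElement K hK).nonempty_interior (𝓣.isElement K' hK').nonempty_interior
        (𝓣.disjoint K hK K' hK' hne)
      have hm : MeasurableSet (K ∩ K') := (𝓣.isCompact_of_mem_faces hF.1).isClosed.measurableSet
      rw [ae_restrict_iff' hm, ae_iff]
      refine measure_mono_null (fun x hx => ?_) h0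
      simp only [Classical.not_imp] at hx
      exact hx
    filter_upwards [key, hnull] with x h1 h2
    exact h1 h2
  · intro φ h1 h2 h3
    have hφ : IsTest W φ := ⟨h1, h2, h3⟩
    -- integrate by parts on both elements
    have hL : ∀ L ∈ 𝓣.elems, (∑ i, ∫ x in L, fderiv ℝ φ x (EuclideanSpace.single i 1) * q x i) +
        ∫ x in L, φ x * g x = ∫ x in L, (fderiv ℝ φ x (q x) + g x * φ x) := by
      intro L hL
      have hqL : LocallyIntegrableOn q Ω := hqg.1
      have hi : ∀ i, IntegrableOn (fun x => fderiv ℝ φ x (EuclideanSpace.single i 1) * q x i) L := by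
        intro i
        have h4 := (hφ.mono hWΩ).partial (EuclideanSpace.single i 1)
        have h5 := integrable_mul_of_tsupport_subset (locallyIntegrableOn_comp hqL i) h4.1 h4.2.1 h4.2.2
        have h6 := h5.mono_measure (hsub hL)
        rw [𝓣.restrict_interior hL] at h6
        refine h6.congr (Eventually.of_forall fun x => ?_)
        exact mul_comm _ _
      have hgφ : IntegrableOn (fun x => φ x * g x) L := by
        have h5 := integrable_mul_of_tsupport_subset hqg.2.1 h1.continuous h2 (h3.trans hWΩ)
        have h6 := h5.mono_measure (hsub hL)
        rw [𝓣.restrict_interior hL] at h6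
        refine h6.congr (Eventually.of_forall fun x => ?_)
        exact mul_comm _ _
      rw [← integral_finsetSum _ (fun i _ => hi i), ← integral_add (integrable_finsetSum _ fun i _ => hi i) hgφ]
      refine integral_congr_ae (Eventually.of_forall fun x => ?_)
      simp only [fderiv_apply_eq_sum φ x (q x), mul_comm]
    have hgreen : ∀ L ∈ 𝓣.elems, K ∩ K' ∈ 𝓣.facesOf L →
        (∀ F ∈ 𝓣.facesOf L, F ≠ K ∩ K' → ∀ u : Vec d → ℝ, ∫ x in F, φ x * u x ∂surf d = 0) →
        ∫ x in L, (fderiv ℝ φ x (q x) + g x * φ x) =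
          ∫ x in K ∩ K', φ x * ∑ i, normal L (K ∩ K') i * t L (K ∩ K') i x ∂surf d := by
      intro L hLm hFL hz
      rw [← hL L hLm, 𝓣.integral_weakDiv_mul hd hΩ hLm (fun i => (hq i).mono_measure (hsub hLm))
        (hg.mono_measure (hsub hLm)) (hqg.mono (𝓣.interior_subset hΩ hLm)) (ht L hLm) h1,
        finsum_mem_eq_finite_toFinset_sum _ 𝓣.finite_facesOf,
        Finset.sum_eq_single_of_mem (K ∩ K') ((Set.Finite.mem_toFinset _).2 hFL)]
      · simp_rw [Finset.mul_sum]
        rw [integral_finsetSum]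
        · refine Finset.sum_congr rfl fun i _ => integral_congr_ae (Eventually.of_forall fun x => ?_)
          simp only [mul_assoc]
        · intro i _
          obtain ⟨x₀, b, hb, hT⟩ := 𝓣.exists_isTraceSet hd hΩ hLm
          exact ((hT _ hFL).memLp_of_continuous h1.continuous).integrable_mul (hmem L hLm hFL i)
      · intro F₁ hF₁ hne₁
        refine Finset.sum_eq_zero fun i _ => ?_
        simp_rw [mul_assoc]
        exact hz F₁ ((Set.Finite.mem_toFinset _).1 hF₁) hne₁ _
    have hsumΩ : ∫ x in Ω, (fderiv ℝ φ x (q x) + g x * φ x) = 0 := by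
      rw [integral_add (integrable_fderiv_test hqg.1 (hφ.mono hWΩ))
        (integrable_mul_of_tsupport_subset hqg.2.1 h1.continuous h2 (h3.trans hWΩ)), hqg.2.2 φ (hφ.mono hWΩ)]
      ring
    have hzero : ∀ x, x ∉ K ∪ K' → fderiv ℝ φ x (q x) + g x * φ x = 0 := by
      intro x hx
      have h0 := hφ.eq_zero fun h => hx (_root_.interior_subset h)
      simp [h0.1, h0.2]
    have hint : Integrable (fun x => fderiv ℝ φ x (q x) + g x * φ x) (volume.restrict Ω) :=
      (integrable_fderiv_test hqg.1 (hφ.mono hWΩ)).add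
        (integrable_mul_of_tsupport_subset hqg.2.1 h1.continuous h2 (h3.trans hWΩ))
    have hsplit : ∫ x in Ω, (fderiv ℝ φ x (q x) + g x * φ x) =
        (∫ x in K, (fderiv ℝ φ x (q x) + g x * φ x)) + ∫ x in K', (fderiv ℝ φ x (q x) + g x * φ x) := by
      rw [𝓣.integral_eq_volSum hΩ hint, volSum]
      classical
      rw [← Finset.add_sum_erase _ _ hK, ← Finset.add_sum_erase _ _
        (Finset.mem_erase.2 ⟨hne.symm, hK'⟩), Finset.sum_eq_zero, add_zero]
      intro L hLmem
      simp only [Finset.mem_erase] at hLmem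
      obtain ⟨hL1, hL2, hL3⟩ := hLmem
      have hLm : MeasurableSet L := (𝓣.isElement L hL3).isCompact.isClosed.measurableSet
      refine setIntegral_eq_zero_of_ae_eq_zero ?_
      rw [ae_iff]
      refine measure_mono_null (fun x hx => ?_)
        (measure_union_null (𝓣.aedisjoint hL3 hK hL2) (𝓣.aedisjoint hL3 hK' hL1))
      simp only [Classical.not_imp] at hx
      obtain ⟨hxL, hx0⟩ := hx
      by_contra hcon
      refine hx0 (hzero x fun h => hcon ?_)
      exact h.imp (fun h => ⟨hxL, h⟩) fun h => ⟨hxL, h⟩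
    have hA := hgreen K hK hF fun F hF1 hne1 u =>
      𝓣.setIntegral_eq_zero_of_test hd hΩ hK hK' hF hF1 hne1 hφ u
    have hB := hgreen K' hK' hF' fun F hF1 hne1 u => by
      refine 𝓣.setIntegral_eq_zero_of_test (K := K') (K' := K) hd hΩ hK' hK ?_ hF1 ?_ ?_ u
      · rwa [inter_comm]
      · rwa [inter_comm]
      · rwa [union_comm]
    have hti : ∀ L, L ∈ 𝓣.elems → K ∩ K' ∈ 𝓣.facesOf L → Integrable
        (fun x => φ x * ∑ i, normal L (K ∩ K') i * t L (K ∩ K') i x) ((surf d).restrict (K ∩ K')) := by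
      intro L hLm hFL
      obtain ⟨x₀, b, hb, hT⟩ := 𝓣.exists_isTraceSet hd hΩ hLm
      exact ((hT _ hFL).memLp_of_continuous h1.continuous).integrable_mul
        (memLp_finsetSum _ fun i _ => hmem L hLm hFL i)
    have e : ∀ x, φ x • w x = φ x * (∑ i, normal K (K ∩ K') i * t K (K ∩ K') i x) +
        φ x * ∑ i, normal K' (K ∩ K') i * t K' (K ∩ K') i x := fun x => by
      simp only [hw, smul_eq_mul, mul_add]
    simp_rw [e]
    rw [integral_add (hti K hK hF) (hti K' hK' hF'), ← hA, ← hB, ← hsplit, hsumΩ]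

end Mesh
end HDG

namespace HDG
variable {d : ℕ} {f : Vec d → ℝ}

namespace Mesh

variable {Ω : Set (Vec d)} (𝓣 : Mesh Ω) {K K' F : Set (Vec d)}

/-! ### Traces of functions of the energy spaces on the skeleton -/

theorem mem_facesOf_inter (hF : F ∈ 𝓣.faces) (hb : F ∉ boundaryFaces Ω 𝓣.elems) :
    ∃ K ∈ 𝓣.elems, ∃ K' ∈ 𝓣.elems, K ≠ K' ∧ F = K ∩ K' := by
  rcases hF with ⟨-, h⟩ | h
  · exact h
  · exact absurd h hb

/-- A face is contained in at most two elements. -/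
theorem eq_or_eq_of_face_subset (hd : 0 < d) {K₁ K₂ K₃ : Set (Vec d)} (h₁ : K₁ ∈ 𝓣.elems)
    (h₂ : K₂ ∈ 𝓣.elems) (h₃ : K₃ ∈ 𝓣.elems) (hF : F ∈ 𝓣.faces) (hF₁ : F ⊆ K₁) (hF₂ : F ⊆ K₂)
    (hF₃ : F ⊆ K₃) (h₁₂ : K₁ ≠ K₂) : K₃ = K₁ ∨ K₃ = K₂ := by
  by_contra hcon
  push Not at hcon
  exact (𝓣.surf_pos_of_mem_faces hF).ne' (measure_mono_null
    (subset_inter (subset_inter hF₁ hF₂) hF₃)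
    (𝓣.surf_inter_inter hd h₁ h₂ h₃ h₁₂ hcon.1.symm hcon.2.symm))

/-- Contributions that vanish on boundary faces and are opposite from the two sides of interior faces
sum up to zero. -/
theorem sum_facesOf_eq_zero (hd : 0 < d) (a : Set (Vec d) → Set (Vec d) → ℝ)
    (hb : ∀ K ∈ 𝓣.elems, ∀ F ∈ 𝓣.facesOf K, F ∈ boundaryFaces Ω 𝓣.elems → a K F = 0)
    (hi : ∀ K ∈ 𝓣.elems, ∀ K' ∈ 𝓣.elems, K ≠ K' → K ∩ K' ∈ 𝓣.faces →
      a K (K ∩ K') + a K' (K ∩ K') = 0) :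
    ∑ K ∈ 𝓣.elems, ∑ᶠ F ∈ 𝓣.facesOf K, a K F = 0 := by
  classical
  simp_rw [finsum_mem_eq_finite_toFinset_sum _ 𝓣.finite_facesOf]
  rw [Finset.sum_comm' (t' := 𝓣.finite_faces.toFinset) (s' := fun F => 𝓣.elems.filter (F ⊆ ·))]
  · refine Finset.sum_eq_zero fun F hF => ?_
    rw [Set.Finite.mem_toFinset] at hF
    by_cases hFb : F ∈ boundaryFaces Ω 𝓣.elems
    · refine Finset.sum_eq_zero fun K hK => ?_
      rw [Finset.mem_filter] at hK
      exact hb K hK.1 F ⟨hF, hK.2⟩ hFb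
    · obtain ⟨K, hK, K', hK', hne, rfl⟩ := 𝓣.mem_facesOf_inter hF hFb
      have e : 𝓣.elems.filter (K ∩ K' ⊆ ·) = {K, K'} := by
        ext L
        simp only [Finset.mem_filter, Finset.mem_insert, Finset.mem_singleton]
        constructor
        · rintro ⟨hL, hs⟩
          exact 𝓣.eq_or_eq_of_face_subset hd hK hK' hL hF inter_subset_left inter_subset_right hs hne
        · rintro (rfl | rfl)
          · exact ⟨hK, inter_subset_left⟩
          · exact ⟨hK', inter_subset_right⟩
      rw [e, Finset.sum_pair hne]
      exact hi K hK K' hK' hne hF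
  · intro K F
    simp only [Set.Finite.mem_toFinset, Finset.mem_filter, facesOf, mem_sep_iff]
    tauto

theorem hasTrace_unique (hd : 0 < d) (hΩ : IsPolyDomain Ω) (hK : K ∈ 𝓣.elems) (hF : F ∈ 𝓣.facesOf K)
    {g g' : Vec d → ℝ} (h : HasTrace (interior K) F f g) (h' : HasTrace (interior K) F f g') :
    g =ᵐ[(surf d).restrict F] g' := by
  obtain ⟨x₀, b, hb, hT⟩ := 𝓣.exists_isTraceSet hd hΩ hK
  exact (hT F hF).hasTrace_unique hd h h'

theorem trace_ae_eq (hd : 0 < d) (hΩ : IsPolyDomain Ω) (hK : K ∈ 𝓣.elems) (hF : F ∈ 𝓣.facesOf K)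
    {g : Vec d → ℝ} (h : HasTrace (interior K) F f g) :
    trace (interior K) F f =ᵐ[(surf d).restrict F] g :=
  𝓣.hasTrace_unique hd hΩ hK hF h.trace h

theorem exists_hasTrace (hd : 0 < d) (hΩ : IsPolyDomain Ω) (hK : K ∈ 𝓣.elems) (hF : F ∈ 𝓣.facesOf K)
    {r : ℝ} (hr : 1 / 2 < r) (hf : MemHs (interior K) r f) : ∃ g, HasTrace (interior K) F f g := by
  obtain ⟨x₀, b, hb, hT⟩ := 𝓣.exists_isTraceSet hd hΩ hK
  exact (hT F hF).exists_hasTrace hd hr hf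

theorem hasTrace_of_contDiff (hd : 0 < d) (hΩ : IsPolyDomain Ω) (hK : K ∈ 𝓣.elems)
    (hF : F ∈ 𝓣.facesOf K) (hf : ContDiff ℝ (⊤ : ℕ∞) f) : HasTrace (interior K) F f f := by
  obtain ⟨x₀, b, hb, hT⟩ := 𝓣.exists_isTraceSet hd hΩ hK
  exact (hT F hF).hasTrace_of_contDiff hf

/-- `H¹` functions on the domain have traces from every element, since `1 > 1/2`. -/
theorem exists_hasTrace_of_memH1 (hd : 0 < d) (hΩ : IsPolyDomain Ω) (hK : K ∈ 𝓣.elems)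
    (hF : F ∈ 𝓣.facesOf K) (hf : MemH1 Ω f) : ∃ g, HasTrace (interior K) F f g :=
  𝓣.exists_hasTrace hd hΩ hK hF (by norm_num : (1 : ℝ) / 2 < 1)
    (memHs_one_iff.2 (hf.mono (𝓣.interior_subset hΩ hK)))

theorem subset_frontier_of_mem_boundaryFaces (hF : F ∈ boundaryFaces Ω 𝓣.elems) : F ⊆ frontier Ω := by
  obtain ⟨-, K, -, G, -, rfl⟩ := hF
  exact inter_subset_right

/-- Functions with zero trace on the boundary of the domain have zero trace on boundary faces. -/
theorem trace_ae_eq_zero (hd : 0 < d) (hΩ : IsPolyDomain Ω) (hK : K ∈ 𝓣.elems) (hF : F ∈ 𝓣.facesOf K)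
    (hb : F ∈ boundaryFaces Ω 𝓣.elems) (hf : HasTrace Ω (frontier Ω) f 0) {g : Vec d → ℝ}
    (hg : HasTrace (interior K) F f g) : g =ᵐ[(surf d).restrict F] 0 :=
  𝓣.hasTrace_unique hd hΩ hK hF hg (hf.mono hΩ.isOpen (𝓣.interior_subset hΩ hK) isOpen_interior
    (𝓣.subset_frontier_of_mem_boundaryFaces hb))

theorem compV_smul_single (f : Vec d → ℝ) (i j : Fin d) :
    compV (fun x => f x • (EuclideanSpace.single i 1 : Vec d)) j = if j = i then f else fun _ => 0 := by
  ext x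
  split_ifs with h
  · subst h
    simp [compV]
  · simp [compV, h]

theorem hasTrace_smul_single (hd : 0 < d) (hΩ : IsPolyDomain Ω) (hK : K ∈ 𝓣.elems)
    (hF : F ∈ 𝓣.facesOf K) {g : Vec d → ℝ} (h : HasTrace (interior K) F f g) (i j : Fin d) :
    HasTrace (interior K) F (compV (fun x => f x • (EuclideanSpace.single i 1 : Vec d)) j)
      (if j = i then g else fun _ => 0) := by
  rw [compV_smul_single]
  split_ifs
  · exact h
  · exact 𝓣.hasTrace_of_contDiff hd hΩ hK hF contDiff_const

theorem memLp_smul_single {μ : Measure (Vec d)} (hf : MemLp f 2 μ) (i j : Fin d) :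
    MemLp (compV (fun x => f x • (EuclideanSpace.single i 1 : Vec d)) j) 2 μ := by
  rw [compV_smul_single]
  split_ifs
  · exact hf
  · exact MemLp.zero'

/-- The traces of an `H¹` function from both sides of an interior face coincide: apply
`normal_trace_add_eq_zero` to the fields `f • eᵢ`, for an `i` with `nᵢ ≠ 0`. -/
theorem trace_eq_of_memH1 (hd : 0 < d) (hΩ : IsPolyDomain Ω) (hK : K ∈ 𝓣.elems)
    (hK' : K' ∈ 𝓣.elems) (hne : K ≠ K') (hF : K ∩ K' ∈ 𝓣.facesOf K) (hf : MemH1 Ω f)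
    {g g' : Vec d → ℝ} (hg : HasTrace (interior K) (K ∩ K') f g)
    (hg' : HasTrace (interior K') (K ∩ K') f g') : g =ᵐ[(surf d).restrict (K ∩ K')] g' := by
  have hF' : K ∩ K' ∈ 𝓣.facesOf K' := ⟨hF.1, inter_subset_right⟩
  have hex : ∀ L ∈ 𝓣.elems, ∀ F ∈ 𝓣.facesOf L, HasTrace (interior L) F f (trace (interior L) F f) := by
    intro L hL F hFL
    obtain ⟨g, hg⟩ := 𝓣.exists_hasTrace_of_memH1 hd hΩ hL hFL hf
    exact hg.trace
  have hi : ∀ i, ∀ᵐ x ∂(surf d).restrict (K ∩ K'), normal K (K ∩ K') i *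
      (trace (interior K) (K ∩ K') f x - trace (interior K') (K ∩ K') f x) = 0 := by
    intro i
    obtain ⟨g₁, hg₁, hg₁2⟩ := hf.2 i
    have key := 𝓣.normal_trace_add_eq_zero hd hΩ hK hK' hne hF (fun j => memLp_smul_single hf.1 i j) hg₁2
      hg₁.hasWeakDiv_smul (t := fun L F j => if j = i then trace (interior L) F f else fun _ => 0)
      (fun L hL F hFL j => 𝓣.hasTrace_smul_single hd hΩ hL hFL (hex L hL F hFL) i j)
    filter_upwards [key] with x hx
    rw [Finset.sum_eq_single_of_mem i (Finset.mem_univ i), Finset.sum_eq_single_of_mem i (Finset.mem_univ i),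
      𝓣.normal_eq_neg hd hΩ hK hK' hne hF hF'] at hx
    · simp only [if_true, PiLp.neg_apply] at hx
      linarith
    · intro j _ hj
      simp [hj]
    · intro j _ hj
      simp [hj]
  have hn := (𝓣.normal_spec hd hΩ hK hF).1
  obtain ⟨i, hni⟩ : ∃ i, normal K (K ∩ K') i ≠ 0 := by
    by_contra! hcon
    have h0 : normal K (K ∩ K') = 0 := by
      ext i
      exact hcon i
    rw [h0] at hn
    simp at hn
  filter_upwards [hi i, 𝓣.trace_ae_eq hd hΩ hK hF hg, 𝓣.trace_ae_eq hd hΩ hK' hF' hg'] with x h1 h2 h3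
  rw [← h2, ← h3]
  have := (mul_eq_zero.1 h1).resolve_left hni
  linarith

/-- Functions of `H¹₀` have single-valued traces on the skeleton that vanish on boundary faces. -/
theorem exists_isFaceTrace (hd : 0 < d) (hΩ : IsPolyDomain Ω) {u : Vec d → Vec d}
    (hu : ∀ i, MemH1D Ω (compV u i)) :
    ∃ uh, 𝓣.IsFaceTrace u uh ∧ ∀ F ∈ boundaryFaces Ω 𝓣.elems, ∀ᵐ x ∂(surf d).restrict F, uh F x = 0 := by
  classical
  have hH1 : ∀ i, MemH1 Ω (compV u i) := fun i => memHs_one_iff.1 (hu i).1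
  have hex : ∀ F : Set (Vec d), ∃ K, F ∈ 𝓣.faces → K ∈ 𝓣.elems ∧ F ⊆ K := fun F => by
    by_cases hF : F ∈ 𝓣.faces
    · obtain ⟨K, h⟩ := 𝓣.exists_subset_of_mem_faces hF
      exact ⟨K, fun _ => h⟩
    · exact ⟨∅, fun h => absurd h hF⟩
  choose elt helt using hex
  have htr : ∀ F ∈ 𝓣.faces, ∀ i, HasTrace (interior (elt F)) F (compV u i)
      (trace (interior (elt F)) F (compV u i)) := by
    intro F hF i
    obtain ⟨g, hg⟩ := 𝓣.exists_hasTrace_of_memH1 hd hΩ (helt F hF).1 ⟨hF, (helt F hF).2⟩ (hH1 i)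
    exact hg.trace
  refine ⟨fun F => traceV (interior (elt F)) F u, fun K hK F hF i => ?_, fun F hF => ?_⟩
  · obtain ⟨hL, hFL⟩ := helt F hF.1
    change HasTrace (interior K) F (compV u i) (trace (interior (elt F)) F (compV u i))
    rcases eq_or_ne K (elt F) with h | h
    · have := htr F hF.1 i
      rwa [← h] at this ⊢
    · obtain ⟨g, hg⟩ := 𝓣.exists_hasTrace_of_memH1 hd hΩ hK hF (hH1 i)
      obtain ⟨e, -⟩ := 𝓣.eq_inter_of_subset hd hΩ hF.1 hK hL h hF.2 hFL
      have h2 := htr F hF.1 i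
      refine hg.congr (EventuallyEq.refl _ _) ?_
      have key := 𝓣.trace_eq_of_memH1 (f := compV u i) (g := g)
        (g' := trace (interior (elt F)) F (compV u i)) hd hΩ hK hL h (e ▸ hF) (hH1 i)
        (by rw [← e]; exact hg) (by rw [← e]; exact h2)
      rw [← e] at key
      exact key
  · have hFf : F ∈ 𝓣.faces := Or.inr hF
    obtain ⟨hL, hFL⟩ := helt F hFf
    have := fun i => 𝓣.trace_ae_eq_zero hd hΩ hL ⟨hFf, hFL⟩ hF (hu i).2 (htr F hFf i)
    filter_upwards [ae_all_iff.2 this] with x hx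
    ext i
    exact hx i

/-! ### Piecewise polynomials -/

theorem PolyOn.exists_contDiff {𝓣 : Mesh Ω} {n m : ℕ} {D S : Set (Vec d)} (h : 𝓣.PolyOn n m D S f) :
    ∃ φ : Vec d → ℝ, ContDiff ℝ (⊤ : ℕ∞) φ ∧ ∀ x ∈ S, f x = φ x := by
  have hcoord : ∀ A : Vec d ≃ᵃ[ℝ] Vec d, ContDiff ℝ (⊤ : ℕ∞) A := fun A => by
    let B : Vec d →ᴬ[ℝ] Vec d := ⟨A.toAffineMap, A.toAffineMap.continuous_of_finiteDimensional⟩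
    exact B.contDiff
  have hpoly : ∀ P : MvPolynomial (Fin d) ℝ,
      ContDiff ℝ (⊤ : ℕ∞) fun x : Vec d => MvPolynomial.eval (fun i => x i) P := by
    intro P
    induction P using MvPolynomial.induction_on with
    | C a => simpa using contDiff_const
    | add p q hp hq => simpa using hp.add hq
    | mul_X p i hp =>
      have : ContDiff ℝ (⊤ : ℕ∞) fun x : Vec d => x i := by fun_prop
      simpa using hp.mul this
  rcases h with ⟨-, P, -, hP⟩ | ⟨-, P, -, hP⟩
  · exact ⟨_, hpoly P, hP⟩
  · exact ⟨_, (hpoly P).comp (hcoord (𝓣.coord D)), hP⟩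

theorem memLp_of_forall_elems (hΩ : IsPolyDomain Ω)
    (h : ∀ K ∈ 𝓣.elems, MemLp f 2 (volume.restrict K)) : MemLp f 2 (volume.restrict Ω) := by
  rw [𝓣.restrict_eq_sum hΩ]
  have hm : AEStronglyMeasurable f (Measure.sum fun K : 𝓣.elems => volume.restrict (K : Set (Vec d))) :=
    aestronglyMeasurable_sum_measure_iff.2 fun K => (h K K.2).1
  refine ⟨hm, ?_⟩
  by_contra hcon
  rw [not_lt, top_le_iff] at hcon
  have h2 := eLpNorm_two_sq (Measure.sum fun K : 𝓣.elems => volume.restrict (K : Set (Vec d))) f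
  rw [hcon, lintegral_sum_measure, tsum_fintype] at h2
  have h3 : ∑ K : 𝓣.elems, ∫⁻ x in (K : Set (Vec d)), ‖f x‖ₑ ^ 2 < ⊤ := by
    refine ENNReal.sum_lt_top.2 fun K _ => ?_
    rw [← eLpNorm_two_sq]
    exact ENNReal.pow_lt_top (h K K.2).2
  rw [← h2] at h3
  simp at h3

theorem PolyVol.memLp {𝓣 : Mesh Ω} (hΩ : IsPolyDomain Ω) {m : ℕ} {ι : Type} {w : ι → Vec d → ℝ}
    (h : 𝓣.PolyVol m w) (i : ι) : MemLp (w i) 2 (volume.restrict Ω) := by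
  refine 𝓣.memLp_of_forall_elems hΩ fun K hK => ?_
  obtain ⟨φ, hφ, he⟩ := (h K hK i).exists_contDiff
  have hel := 𝓣.isElement K hK
  rw [← 𝓣.restrict_interior hK]
  refine (memLp_restrict_of_continuous (hel.isCompact.isBounded.subset _root_.interior_subset)
    isOpen_interior.measurableSet hφ.continuous).ae_eq ?_
  filter_upwards [ae_restrict_mem isOpen_interior.measurableSet] with x hx
  exact (he x hx).symm

end Mesh
end HDG

namespace HDG
variable {d : ℕ} {f : Vec d → ℝ}

namespace Mesh

variable {Ω : Set (Vec d)} (𝓣 : Mesh Ω) {K K' F : Set (Vec d)}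

/-! ### Elementwise integration by parts with hybrid test functions -/

theorem hasWeakPartial_of_eqOn {U : Set (Vec d)} (hU : IsOpen U) {w φ : Vec d → ℝ}
    (hφ : ContDiff ℝ (⊤ : ℕ∞) φ) (h : ∀ x ∈ U, w x = φ x) (i : Fin d) :
    HasWeakPartial U i w (fun x => fderiv ℝ φ x (EuclideanSpace.single i 1)) := by
  have he : φ =ᵐ[volume.restrict U] w := by
    filter_upwards [ae_restrict_mem hU.measurableSet] with x hx
    exact (h x hx).symm
  exact (HasWeakPartial.of_contDiff i (hφ.of_le (by simp))).congr he (EventuallyEq.refl _ _)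

/-- The trace of a function that is smooth on the interior of an element is its smooth extension; values
on the boundary of the element play no role. -/
theorem trace_ae_eq_of_eqOn (hd : 0 < d) (hΩ : IsPolyDomain Ω) (hK : K ∈ 𝓣.elems) (hF : F ∈ 𝓣.facesOf K)
    {w φ : Vec d → ℝ} (hφ : ContDiff ℝ (⊤ : ℕ∞) φ) (h : ∀ x ∈ interior K, w x = φ x) :
    trace (interior K) F w =ᵐ[(surf d).restrict F] φ := by
  have he : φ =ᵐ[volume.restrict (interior K)] w := by
    filter_upwards [ae_restrict_mem isOpen_interior.measurableSet] with x hx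
    exact (h x hx).symm
  exact 𝓣.trace_ae_eq hd hΩ hK hF
    ((𝓣.hasTrace_of_contDiff hd hΩ hK hF hφ).congr he (EventuallyEq.refl _ _))

theorem memLp_weakPartial (hK : K ∈ 𝓣.elems) {w φ : Vec d → ℝ} (hφ : ContDiff ℝ (⊤ : ℕ∞) φ)
    (h : ∀ x ∈ interior K, w x = φ x) (i : Fin d) :
    MemLp (weakPartial (interior K) i w) 2 (volume.restrict (interior K)) := by
  have hel := 𝓣.isElement K hK
  have hcv := (hφ.of_le (m := 1) (by simp)).continuous_fderiv one_ne_zero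
  exact (memLp_restrict_of_continuous (hel.isCompact.isBounded.subset _root_.interior_subset)
    isOpen_interior.measurableSet (by fun_prop)).ae_eq
    ((hasWeakPartial_of_eqOn isOpen_interior hφ h i).weakPartial_ae_eq isOpen_interior).symm

theorem integrable_weakPartial_mul (hΩ : IsPolyDomain Ω) (hK : K ∈ 𝓣.elems) {q : Vec d → Vec d}
    (hq : ∀ i, MemLp (compV q i) 2 (volume.restrict Ω)) {w φ : Vec d → ℝ}
    (hφ : ContDiff ℝ (⊤ : ℕ∞) φ) (h : ∀ x ∈ interior K, w x = φ x) (i : Fin d) :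
    Integrable (fun x => weakPartial (interior K) i w x * q x i) (volume.restrict K) := by
  rw [← 𝓣.restrict_interior hK]
  exact (𝓣.memLp_weakPartial hK hφ h i).integrable_mul ((hq i).mono_measure
    (Measure.restrict_mono (𝓣.interior_subset hΩ hK) le_rfl))

theorem memLp_face_of_continuous (hd : 0 < d) (hΩ : IsPolyDomain Ω) (hF : F ∈ 𝓣.faces)
    {φ : Vec d → ℝ} (hφ : Continuous φ) : MemLp φ 2 ((surf d).restrict F) := by
  obtain ⟨K, hK, hFK⟩ := 𝓣.exists_subset_of_mem_faces hF
  obtain ⟨x₀, b, hb, hT⟩ := 𝓣.exists_isTraceSet hd hΩ hK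
  exact (hT F ⟨hF, hFK⟩).memLp_of_continuous hφ

theorem memLp_face_of_eqOn (hd : 0 < d) (hΩ : IsPolyDomain Ω) (hF : F ∈ 𝓣.faces)
    {w φ : Vec d → ℝ} (hφ : Continuous φ) (h : ∀ x ∈ F, w x = φ x) : MemLp w 2 ((surf d).restrict F) := by
  refine (𝓣.memLp_face_of_continuous hd hΩ hF hφ).ae_eq ?_
  filter_upwards [ae_restrict_mem (𝓣.isCompact_of_mem_faces hF).isClosed.measurableSet] with x hx
  exact (h x hx).symm

/-- Elementwise integration by parts against a piecewise smooth function `w`. Since the normal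
component of `q` is single-valued, a single-valued function `wh` on the skeleton can be subtracted
from the trace of `w`. -/
theorem volSum_sub_bdrySum (hd : 0 < d) (hΩ : IsPolyDomain Ω) {q : Vec d → Vec d} {g : Vec d → ℝ}
    (hq : ∀ i, MemLp (compV q i) 2 (volume.restrict Ω)) (hg : MemLp g 2 (volume.restrict Ω))
    (hqg : HasWeakDiv Ω q g) {t : Set (Vec d) → Set (Vec d) → Fin d → Vec d → ℝ}
    (ht : ∀ K ∈ 𝓣.elems, ∀ F ∈ 𝓣.facesOf K, ∀ i, HasTrace (interior K) F (compV q i) (t K F i))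
    {w : Vec d → ℝ} {wh : Set (Vec d) → Vec d → ℝ}
    (hw : ∀ K ∈ 𝓣.elems, ∃ φ, ContDiff ℝ (⊤ : ℕ∞) φ ∧ ∀ x ∈ interior K, w x = φ x)
    (hwh : ∀ F ∈ 𝓣.faces, ∃ φ, ContDiff ℝ (⊤ : ℕ∞) φ ∧ ∀ x ∈ F, wh F x = φ x)
    (hb : ∀ K ∈ 𝓣.elems, ∀ F ∈ 𝓣.facesOf K, F ∈ boundaryFaces Ω 𝓣.elems →
      ∀ᵐ x ∂(surf d).restrict F, (∑ i, normal K F i * t K F i x) * wh F x = 0) :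
    𝓣.volSum (fun K x => ∑ i, weakPartial (interior K) i w x * q x i) -
      𝓣.bdrySum (fun K F x => (∑ i, normal K F i * t K F i x) * (trace (interior K) F w x - wh F x)) =
    -∫ x in Ω, w x * g x := by
  have hsub : ∀ {K}, K ∈ 𝓣.elems → (volume : Measure (Vec d)).restrict (interior K) ≤ volume.restrict Ω :=
    fun hK => Measure.restrict_mono (𝓣.interior_subset hΩ hK) le_rfl
  have hw2 : MemLp w 2 (volume.restrict Ω) := by
    refine 𝓣.memLp_of_forall_elems hΩ fun K hK => ?_
    obtain ⟨φ, hφ, he⟩ := hw K hK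
    rw [← 𝓣.restrict_interior hK]
    refine (memLp_restrict_of_continuous ((𝓣.isElement K hK).isCompact.isBounded.subset
      _root_.interior_subset) isOpen_interior.measurableSet hφ.continuous).ae_eq ?_
    filter_upwards [ae_restrict_mem isOpen_interior.measurableSet] with x hx
    exact (he x hx).symm
  have hnt : ∀ K ∈ 𝓣.elems, ∀ F ∈ 𝓣.facesOf K,
      MemLp (fun x => ∑ i, normal K F i * t K F i x) 2 ((surf d).restrict F) := fun K hK F hF =>
    memLp_finsetSum _ fun i _ => (ht K hK F hF i).1.const_mul _
  let c : Set (Vec d) → Set (Vec d) → ℝ := fun K F =>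
    ∫ x in F, (∑ i, normal K F i * t K F i x) * wh F x ∂surf d
  -- the contributions of `wh` cancel
  have hcancel : ∑ K ∈ 𝓣.elems, ∑ᶠ F ∈ 𝓣.facesOf K, c K F = 0 := by
    refine 𝓣.sum_facesOf_eq_zero hd c (fun K hK F hF hFb => ?_) fun K hK K' hK' hne hF => ?_
    · exact integral_eq_zero_of_ae (hb K hK F hF hFb)
    · have hFK : K ∩ K' ∈ 𝓣.facesOf K := ⟨hF, inter_subset_left⟩
      have key := 𝓣.normal_trace_add_eq_zero hd hΩ hK hK' hne hFK hq hg hqg ht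
      have e : c K (K ∩ K') = -c K' (K ∩ K') := by
        simp only [c]
        rw [← integral_neg]
        refine integral_congr_ae ?_
        filter_upwards [key] with x hx
        rw [eq_neg_of_add_eq_zero_left hx]
        ring
      rw [e, neg_add_cancel]
  have helem : ∀ K ∈ 𝓣.elems, (∫ x in K, ∑ i, weakPartial (interior K) i w x * q x i) -
      ∑ᶠ F ∈ 𝓣.facesOf K, ∫ x in F,
        (∑ i, normal K F i * t K F i x) * (trace (interior K) F w x - wh F x) ∂surf d =
      -(∫ x in K, w x * g x) + ∑ᶠ F ∈ 𝓣.facesOf K, c K F := by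
    intro K hK
    obtain ⟨φ, hφ, he⟩ := hw K hK
    have hgreen := 𝓣.integral_weakDiv_mul hd hΩ hK (fun i => (hq i).mono_measure (hsub hK))
      (hg.mono_measure (hsub hK)) (hqg.mono (𝓣.interior_subset hΩ hK)) (ht K hK) hφ
    have e1 : ∫ x in K, ∑ i, weakPartial (interior K) i w x * q x i =
        ∑ i, ∫ x in K, fderiv ℝ φ x (EuclideanSpace.single i 1) * q x i := by
      rw [integral_finsetSum _ fun i _ => 𝓣.integrable_weakPartial_mul hΩ hK hq hφ he i]
      refine Finset.sum_congr rfl fun i _ => integral_congr_ae ?_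
      have := (hasWeakPartial_of_eqOn isOpen_interior hφ he i).weakPartial_ae_eq isOpen_interior
      rw [𝓣.restrict_interior hK] at this
      filter_upwards [this] with x hx
      rw [hx]
    have e2 : ∫ x in K, w x * g x = ∫ x in K, φ x * g x := by
      rw [← 𝓣.restrict_interior hK]
      refine setIntegral_congr_fun isOpen_interior.measurableSet fun x hx => ?_
      simp only [he x hx]
    have e3 : ∀ F ∈ 𝓣.facesOf K, ∫ x in F,
        (∑ i, normal K F i * t K F i x) * (trace (interior K) F w x - wh F x) ∂surf d =
        (∑ i, ∫ x in F, φ x * normal K F i * t K F i x ∂surf d) - c K F := by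
      intro F hF
      obtain ⟨φh, hφh, heh⟩ := hwh F hF.1
      have hφF := 𝓣.memLp_face_of_continuous hd hΩ hF.1 hφ.continuous
      have hwhF := 𝓣.memLp_face_of_eqOn hd hΩ hF.1 hφh.continuous heh
      have hi : ∀ i, Integrable (fun x => φ x * normal K F i * t K F i x) ((surf d).restrict F) := by
        intro i
        simp_rw [mul_assoc]
        exact hφF.integrable_mul ((ht K hK F hF i).1.const_mul _)
      have hi2 : Integrable (fun x => (∑ i, normal K F i * t K F i x) * wh F x) ((surf d).restrict F) :=
        (hnt K hK F hF).integrable_mul hwhF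
      rw [← integral_finsetSum _ fun i _ => hi i, ← integral_sub (integrable_finsetSum _ fun i _ => hi i)
        hi2]
      refine integral_congr_ae ?_
      filter_upwards [𝓣.trace_ae_eq_of_eqOn hd hΩ hK hF hφ he] with x hx
      rw [hx]
      simp only [mul_sub, mul_assoc, ← Finset.mul_sum]
      ring
    rw [e1, e2, finsum_mem_congr rfl e3]
    simp only [finsum_mem_eq_finite_toFinset_sum _ 𝓣.finite_facesOf] at hgreen ⊢
    rw [Finset.sum_sub_distrib, ← hgreen]
    ring
  have hwg : Integrable (fun x => w x * g x) (volume.restrict Ω) := hw2.integrable_mul hg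
  rw [volSum, bdrySum, ← Finset.sum_sub_distrib, Finset.sum_congr rfl helem, Finset.sum_add_distrib,
    hcancel, add_zero, 𝓣.integral_eq_volSum hΩ hwg, volSum, Finset.sum_neg_distrib]

theorem volSum_finsetSum {ι : Type*} (s : Finset ι) {w : ι → Set (Vec d) → Vec d → ℝ}
    (h : ∀ a ∈ s, ∀ K ∈ 𝓣.elems, Integrable (w a K) (volume.restrict K)) :
    𝓣.volSum (fun K x => ∑ a ∈ s, w a K x) = ∑ a ∈ s, 𝓣.volSum (w a) := by
  unfold volSum
  rw [Finset.sum_comm]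
  exact Finset.sum_congr rfl fun K hK => integral_finsetSum _ fun a ha => h a ha K hK

theorem bdrySum_finsetSum {ι : Type*} (s : Finset ι) {w : ι → Set (Vec d) → Set (Vec d) → Vec d → ℝ}
    (h : ∀ a ∈ s, ∀ K ∈ 𝓣.elems, ∀ F ∈ 𝓣.facesOf K, Integrable (w a K F) ((surf d).restrict F)) :
    𝓣.bdrySum (fun K F x => ∑ a ∈ s, w a K F x) = ∑ a ∈ s, 𝓣.bdrySum (w a) := by
  unfold bdrySum
  rw [Finset.sum_comm]
  refine Finset.sum_congr rfl fun K hK => ?_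
  simp only [finsum_mem_eq_finite_toFinset_sum _ 𝓣.finite_facesOf]
  rw [Finset.sum_comm]
  refine Finset.sum_congr rfl fun F hF => ?_
  exact integral_finsetSum _ fun a ha => h a ha K hK F ((Set.Finite.mem_toFinset _).1 hF)

theorem volSum_congr {w w' : Set (Vec d) → Vec d → ℝ}
    (h : ∀ K ∈ 𝓣.elems, w K =ᵐ[volume.restrict K] w' K) : 𝓣.volSum w = 𝓣.volSum w' :=
  Finset.sum_congr rfl fun K hK => integral_congr_ae (h K hK)

theorem bdrySum_congr {w w' : Set (Vec d) → Set (Vec d) → Vec d → ℝ}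
    (h : ∀ K ∈ 𝓣.elems, ∀ F ∈ 𝓣.facesOf K, w K F =ᵐ[(surf d).restrict F] w' K F) :
    𝓣.bdrySum w = 𝓣.bdrySum w' :=
  Finset.sum_congr rfl fun K hK => finsum_mem_congr rfl fun F hF => integral_congr_ae (h K hK F hF)

theorem bdrySum_eq_zero {w : Set (Vec d) → Set (Vec d) → Vec d → ℝ}
    (h : ∀ K ∈ 𝓣.elems, ∀ F ∈ 𝓣.facesOf K, w K F =ᵐ[(surf d).restrict F] 0) : 𝓣.bdrySum w = 0 := by
  rw [𝓣.bdrySum_congr (w' := fun _ _ => 0) h]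
  simp [bdrySum]

/-- The version of `Mesh.volSum_sub_bdrySum` for finite families of fields and test functions. -/
theorem volSum_sub_bdrySum_family {ι : Type*} [Fintype ι] (hd : 0 < d) (hΩ : IsPolyDomain Ω)
    {q : ι → Vec d → Vec d} {g : ι → Vec d → ℝ}
    (hq : ∀ a i, MemLp (compV (q a) i) 2 (volume.restrict Ω))
    (hg : ∀ a, MemLp (g a) 2 (volume.restrict Ω)) (hqg : ∀ a, HasWeakDiv Ω (q a) (g a))
    {t : ι → Set (Vec d) → Set (Vec d) → Fin d → Vec d → ℝ}
    (ht : ∀ a, ∀ K ∈ 𝓣.elems, ∀ F ∈ 𝓣.facesOf K, ∀ i,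
      HasTrace (interior K) F (compV (q a) i) (t a K F i))
    {w : ι → Vec d → ℝ} {wh : ι → Set (Vec d) → Vec d → ℝ}
    (hw : ∀ a, ∀ K ∈ 𝓣.elems, ∃ φ, ContDiff ℝ (⊤ : ℕ∞) φ ∧ ∀ x ∈ interior K, w a x = φ x)
    (hwh : ∀ a, ∀ F ∈ 𝓣.faces, ∃ φ, ContDiff ℝ (⊤ : ℕ∞) φ ∧ ∀ x ∈ F, wh a F x = φ x)
    (hb : ∀ a, ∀ K ∈ 𝓣.elems, ∀ F ∈ 𝓣.facesOf K, F ∈ boundaryFaces Ω 𝓣.elems →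
      ∀ᵐ x ∂(surf d).restrict F, (∑ i, normal K F i * t a K F i x) * wh a F x = 0) :
    𝓣.volSum (fun K x => ∑ a, ∑ i, weakPartial (interior K) i (w a) x * q a x i) -
      𝓣.bdrySum (fun K F x => ∑ a, (∑ i, normal K F i * t a K F i x) *
        (trace (interior K) F (w a) x - wh a F x)) =
    -∑ a, ∫ x in Ω, w a x * g a x := by
  rw [𝓣.volSum_finsetSum, 𝓣.bdrySum_finsetSum, ← Finset.sum_sub_distrib, ← Finset.sum_neg_distrib]
  · exact Finset.sum_congr rfl fun a _ => 𝓣.volSum_sub_bdrySum hd hΩ (hq a) (hg a) (hqg a) (ht a) (hw a)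
      (hwh a) (hb a)
  · intro a _ K hK F hF
    obtain ⟨φ, hφ, he⟩ := hw a K hK
    obtain ⟨φh, hφh, heh⟩ := hwh a F hF.1
    refine MemLp.integrable_mul (p := 2) (q := 2)
      (memLp_finsetSum _ fun i _ => (ht a K hK F hF i).1.const_mul _) (MemLp.sub ?_ ?_)
    · exact (𝓣.memLp_face_of_continuous hd hΩ hF.1 hφ.continuous).ae_eq
        (𝓣.trace_ae_eq_of_eqOn hd hΩ hK hF hφ he).symm
    · exact 𝓣.memLp_face_of_eqOn hd hΩ hF.1 hφh.continuous heh
  · intro a _ K hK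
    obtain ⟨φ, hφ, he⟩ := hw a K hK
    exact integrable_finsetSum _ fun i _ => 𝓣.integrable_weakPartial_mul hΩ hK (hq a) hφ he i

end Mesh
end HDG

namespace HDG
variable {d : ℕ} {Ω : Set (Vec d)}

/-! ### The bilinear form for the exact solution and for discrete test functions -/

theorem inner_symPart (τ : SymMat d) (a : Fin d → Fin d → ℝ) :
    inner ℝ τ (symPart a) = ∑ i, ∑ j, a i j * τ.1 (i, j) := by
  have h : ∀ i j, τ.1 (i, j) = τ.1 (j, i) := τ.2
  have e : ∑ i, ∑ j, a j i * τ.1 (i, j) = ∑ i, ∑ j, a i j * τ.1 (i, j) := by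
    rw [Finset.sum_comm]
    simp_rw [fun i j => h j i]
  rw [Submodule.coe_inner, PiLp.inner_apply, Fintype.sum_prod_type]
  simp only [symPart, RCLike.inner_apply, conj_trivial]
  calc ∑ i, ∑ j, (a i j + a j i) / 2 * τ.1 (i, j)
      = ((∑ i, ∑ j, a i j * τ.1 (i, j)) + ∑ i, ∑ j, a j i * τ.1 (i, j)) / 2 := by
        rw [← Finset.sum_add_distrib, Finset.sum_div]
        refine Finset.sum_congr rfl fun i _ => ?_
        rw [← Finset.sum_add_distrib, Finset.sum_div]
        exact Finset.sum_congr rfl fun j _ => by ring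
    _ = _ := by
        rw [e]
        ring

theorem integrable_inner_of_memLp {α E : Type*} [MeasurableSpace α] {μ : Measure α}
    [NormedAddCommGroup E] [InnerProductSpace ℝ E] {f g : α → E} (hf : MemLp f 2 μ) (hg : MemLp g 2 μ) :
    Integrable (fun x => (inner ℝ (f x) (g x) : ℝ)) μ := by
  rw [← memLp_one_iff_integrable]
  refine MemLp.of_bilin (r := 1) (fun a b : E => (inner ℝ a b : ℝ)) 1 hf hg (hf.1.inner hg.1)
    (Eventually.of_forall fun x => ?_)
  rw [one_mul]
  exact nnnorm_inner_le_nnnorm (𝕜 := ℝ) _ _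

theorem MemHdiv.weakDiv_spec (hΩ : IsOpen Ω) {q : Vec d → Vec d} (h : MemHdiv Ω q) :
    HasWeakDiv Ω q (weakDiv Ω q) ∧ MemLp (weakDiv Ω q) 2 (volume.restrict Ω) := by
  obtain ⟨-, g, hg, hg2⟩ := h
  exact ⟨hg.weakDiv, hg2.ae_eq (hg.weakDiv_ae_eq hΩ).symm⟩

theorem MemH1.weakPartial_spec (hΩ : IsOpen Ω) {f : Vec d → ℝ} (h : MemH1 Ω f) (i : Fin d) :
    HasWeakPartial Ω i f (weakPartial Ω i f) ∧ MemLp (weakPartial Ω i f) 2 (volume.restrict Ω) := by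
  obtain ⟨g, hg, hg2⟩ := h.2 i
  exact ⟨hg.weakPartial, hg2.ae_eq (hg.weakPartial_ae_eq hΩ).symm⟩

theorem memLp_compV {V : Set (Vec d)} {q : Vec d → Vec d} (h : MemLp q 2 (volume.restrict V)) (i : Fin d) :
    MemLp (compV q i) 2 (volume.restrict V) :=
  (EuclideanSpace.proj (𝕜 := ℝ) i).comp_memLp' h

theorem memLp_of_compV {V : Set (Vec d)} {q : Vec d → Vec d}
    (h : ∀ i, MemLp (compV q i) 2 (volume.restrict V)) : MemLp q 2 (volume.restrict V) := by
  have e : q = fun x => ∑ i, ContinuousLinearMap.toSpanSingleton ℝ (EuclideanSpace.single i 1 : Vec d)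
      (compV q i x) := by
    ext1 x
    simp only [ContinuousLinearMap.toSpanSingleton_apply, compV]
    exact (sum_smul_single (q x)).symm
  rw [e]
  exact memLp_finsetSum _ fun i _ => (ContinuousLinearMap.toSpanSingleton ℝ _).comp_memLp' (h i)

theorem memLp_symPart {V : Set (Vec d)} {a : Vec d → Fin d → Fin d → ℝ}
    (h : ∀ i j, MemLp (fun x => a x i j) 2 (volume.restrict V)) :
    MemLp (fun x => symPart (a x)) 2 (volume.restrict V) := by
  let L : (Fin d → Fin d → ℝ) →ₗ[ℝ] SymMat d :=
    { toFun := symPart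
      map_add' := fun a b => by
        ext ij
        simp only [symPart, Submodule.coe_add, PiLp.add_apply, Pi.add_apply]
        ring
      map_smul' := fun r a => by
        ext ij
        simp only [symPart, Submodule.coe_smul, PiLp.smul_apply, Pi.smul_apply, smul_eq_mul,
          RingHom.id_apply]
        ring }
  have h2 : MemLp a 2 (volume.restrict V) :=
    memLp_pi_iff.2 fun i => memLp_pi_iff.2 fun j => h i j
  exact (L.toContinuousLinearMap).comp_memLp' h2

theorem memLp_compM {V : Set (Vec d)} {τ : Vec d → SymMat d} (h : MemLp τ 2 (volume.restrict V))
    (ij : Fin d × Fin d) : MemLp (compM τ ij) 2 (volume.restrict V) :=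
  ((EuclideanSpace.proj (𝕜 := ℝ) ij).comp (SymMat d).subtypeL).comp_memLp' h

theorem memLp_of_compM {V : Set (Vec d)} {τ : Vec d → SymMat d}
    (h : ∀ ij, MemLp (compM τ ij) 2 (volume.restrict V)) : MemLp τ 2 (volume.restrict V) := by
  have e : τ = fun x => symPart fun i j => compM τ (i, j) x := by
    ext x ⟨i, j⟩
    have : (τ x).1 (i, j) = (τ x).1 (j, i) := (τ x).2 i j
    simp only [symPart, compM, ← this]
    ring
  rw [e]
  exact memLp_symPart fun i j => h (i, j)

theorem Coeff.memLp_total (c : Coeff d) {σE σV : Vec d → SymMat d} {ψ : Vec d → ℝ}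
    (hE : MemLp σE 2 (volume.restrict Ω)) (hV : MemLp σV 2 (volume.restrict Ω))
    (hψ : MemLp ψ 2 (volume.restrict Ω)) : MemLp (c.total σE σV ψ) 2 (volume.restrict Ω) := by
  refine (hE.add (hV.const_smul c.ω)).sub ?_
  exact (ContinuousLinearMap.toSpanSingleton ℝ (idMat d)).comp_memLp' (hψ.const_mul c.α)

namespace Mesh

variable (𝓣 : Mesh Ω)

theorem weakPartial_interior_ae_eq (hΩ : IsPolyDomain Ω) {K : Set (Vec d)} (hK : K ∈ 𝓣.elems)
    {f : Vec d → ℝ} (hf : MemH1 Ω f) (i : Fin d) :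
    weakPartial (interior K) i f =ᵐ[volume.restrict K] weakPartial Ω i f := by
  rw [← 𝓣.restrict_interior hK]
  exact ((hf.weakPartial_spec hΩ.isOpen i).1.mono (𝓣.interior_subset hΩ hK)).weakPartial_ae_eq
    isOpen_interior

theorem weakDiv_interior_ae_eq (hΩ : IsPolyDomain Ω) {K : Set (Vec d)} (hK : K ∈ 𝓣.elems)
    {q : Vec d → Vec d} (hq : MemHdiv Ω q) :
    weakDiv (interior K) q =ᵐ[volume.restrict K] weakDiv Ω q := by
  rw [← 𝓣.restrict_interior hK]
  exact ((hq.weakDiv_spec hΩ.isOpen).1.mono (𝓣.interior_subset hΩ hK)).weakDiv_ae_eq isOpen_interior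

theorem jump_ae_eq_zero (hd : 0 < d) (hΩ : IsPolyDomain Ω) {u : Vec d → Vec d}
    {uh : Set (Vec d) → Set (Vec d) → Vec d → Vec d} (h : 𝓣.IsElemTrace u uh) {K F : Set (Vec d)}
    (hK : K ∈ 𝓣.elems) (hF : F ∈ 𝓣.facesOf K) : jump u uh K F =ᵐ[(surf d).restrict F] 0 := by
  have := fun i => 𝓣.trace_ae_eq hd hΩ hK hF (h K hK F hF i)
  filter_upwards [ae_all_iff.2 this] with x hx
  ext i
  simp only [jump, PiLp.sub_apply, Pi.zero_apply, PiLp.zero_apply]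
  exact sub_eq_zero.2 (hx i)

/-- The stabilization vanishes because the exact solution has no jumps. -/
theorem stab_eq_zero (hd : 0 < d) (hΩ : IsPolyDomain Ω) (k : ℕ) {u : Vec d → Vec d}
    {uh : Set (Vec d) → Set (Vec d) → Vec d → Vec d} (h : 𝓣.IsElemTrace u uh) (v : Vec d → Vec d)
    (vh : Set (Vec d) → Set (Vec d) → Vec d → Vec d) : 𝓣.stab k u uh v vh = 0 := by
  refine 𝓣.bdrySum_eq_zero fun K hK F hF => ?_
  filter_upwards [𝓣.jump_ae_eq_zero hd hΩ h hK hF] with x hx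
  simp [hx]

/-- With the traces of `(u, p)` as hybrid variables, `B_h((u, p), ·)` reduces to volume terms. -/
theorem Bh_elemTrace (hd : 0 < d) (hΩ : IsPolyDomain Ω) (c : Coeff d) {u p : Vec d → Vec d}
    {uh ph : Set (Vec d) → Set (Vec d) → Vec d → Vec d} (hu : ∀ i, MemH1 Ω (compV u i))
    (hp : MemHdiv Ω p) (huh : 𝓣.IsElemTrace u uh) (hph : 𝓣.IsElemTrace p ph)
    {τE τV : Vec d → SymMat d} {φ : Vec d → ℝ}
    (hE : MemLp τE 2 (volume.restrict Ω)) (hV : MemLp τV 2 (volume.restrict Ω))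
    (hφ : MemLp φ 2 (volume.restrict Ω)) :
    𝓣.Bh c u uh p ph τE τV φ =
      (∫ x in Ω, inner ℝ (c.total τE τV φ x) (strain Ω u x)) - ∫ x in Ω, φ x * weakDiv Ω p x := by
  have hs : MemLp (strain Ω u) 2 (volume.restrict Ω) :=
    memLp_symPart fun i j => ((hu i).weakPartial_spec hΩ.isOpen j).2
  have h1 : Integrable (fun x => inner ℝ (c.total τE τV φ x) (strain Ω u x)) (volume.restrict Ω) :=
    integrable_inner_of_memLp (c.memLp_total hE hV hφ) hs
  have h2 : Integrable (fun x => φ x * weakDiv Ω p x) (volume.restrict Ω) :=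
    hφ.integrable_mul (hp.weakDiv_spec hΩ.isOpen).2
  rw [Bh, 𝓣.integral_eq_volSum hΩ h1, 𝓣.integral_eq_volSum hΩ h2]
  rw [𝓣.bdrySum_eq_zero (w := fun K F x => inner ℝ
      (traceMn (interior K) F (c.total τE τV φ) (normal K F) x) (jump u uh K F x)),
    𝓣.bdrySum_eq_zero (w := fun K F x => inner ℝ (trace (interior K) F φ x • normal K F)
      (jump p ph K F x)), sub_zero, add_zero]
  · congr 1
    · refine 𝓣.volSum_congr fun K hK => ?_
      have := fun i j => 𝓣.weakPartial_interior_ae_eq hΩ hK (hu i) j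
      filter_upwards [ae_all_iff.2 fun i => ae_all_iff.2 (this i)] with x hx
      simp only [strain, hx]
    · refine 𝓣.volSum_congr fun K hK => ?_
      filter_upwards [𝓣.weakDiv_interior_ae_eq hΩ hK hp] with x hx
      rw [hx]
  · intro K hK F hF
    filter_upwards [𝓣.jump_ae_eq_zero hd hΩ hph hK hF] with x hx
    simp [hx]
  · intro K hK F hF
    filter_upwards [𝓣.jump_ae_eq_zero hd hΩ huh hK hF] with x hx
    simp [hx]

/-- For a stress in `H(div)` and a pressure in `H¹` with zero trace, `B_h(·, (σE, σV, ψ))` is obtained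
by testing the divergence of the stress and the gradient of the pressure. -/
theorem Bh_of_memHdiv (hd : 0 < d) (hΩ : IsPolyDomain Ω) (c : Coeff d) {σE σV : Vec d → SymMat d}
    {ψ : Vec d → ℝ} (hE : MemLp σE 2 (volume.restrict Ω)) (hV : MemLp σV 2 (volume.restrict Ω))
    (hψ : MemH1D Ω ψ) (hdiv : ∀ i, MemHdiv Ω (fun x => row (c.total σE σV ψ x) i))
    (hT : 𝓣.HasTraces (compM (c.total σE σV ψ))) {k : ℕ} {v q : Vec d → Vec d}
    {vh qh : Set (Vec d) → Vec d → Vec d} (hv : 𝓣.MemUh k v vh) (hq : 𝓣.MemQh k q qh) :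
    𝓣.Bh c v (fun _ F => vh F) q (fun _ F => qh F) σE σV ψ =
      -(∑ a, ∫ x in Ω, v x a * weakDivM Ω (c.total σE σV ψ) x a) +
        ∑ a, ∫ x in Ω, q x a * weakGrad Ω ψ x a := by
  have hψ1 : MemH1 Ω ψ := memHs_one_iff.1 hψ.1
  set S := c.total σE σV ψ with hS
  have hS2 : MemLp S 2 (volume.restrict Ω) := c.memLp_total hE hV hψ1.1
  have htS : ∀ K ∈ 𝓣.elems, ∀ F ∈ 𝓣.facesOf K, ∀ ij, HasTrace (interior K) F (compM S ij)
      (trace (interior K) F (compM S ij)) := by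
    intro K hK F hF ij
    obtain ⟨g, hg⟩ := hT K hK F hF ij
    exact hg.trace
  have htψ : ∀ K ∈ 𝓣.elems, ∀ F ∈ 𝓣.facesOf K, HasTrace (interior K) F ψ
      (trace (interior K) F ψ) := by
    intro K hK F hF
    obtain ⟨g, hg⟩ := 𝓣.exists_hasTrace_of_memH1 hd hΩ hK hF hψ1
    exact hg.trace
  -- the momentum part: the rows of the stress, tested with the components of `v`
  have A := 𝓣.volSum_sub_bdrySum_family hd hΩ (q := fun a x => row (S x) a)
    (g := fun a => weakDiv Ω fun x => row (S x) a) (fun a i => memLp_compM hS2 (a, i))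
    (fun a => ((hdiv a).weakDiv_spec hΩ.isOpen).2) (fun a => ((hdiv a).weakDiv_spec hΩ.isOpen).1)
    (t := fun a K F i => trace (interior K) F (compM S (a, i)))
    (fun a K hK F hF i => htS K hK F hF (a, i)) (w := compV v) (wh := fun a F => compV (vh F) a)
    (fun a K hK => (hv.1 K hK a).exists_contDiff) (fun a F hF => (hv.2.1 F hF a).exists_contDiff)
    (fun a K hK F hF hFb => by
      filter_upwards [ae_restrict_mem (𝓣.isCompact_of_mem_faces hF.1).isClosed.measurableSet] with x hx
      simp [compV, hv.2.2 F hFb x hx])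
  -- the flux part: the fields `ψ eₐ`, tested with the components of `q`
  have B := 𝓣.volSum_sub_bdrySum_family hd hΩ
    (q := fun a x => ψ x • (EuclideanSpace.single a 1 : Vec d)) (g := fun a => weakPartial Ω a ψ)
    (fun a i => memLp_smul_single hψ1.1 a i) (fun a => (hψ1.weakPartial_spec hΩ.isOpen a).2)
    (fun a => (hψ1.weakPartial_spec hΩ.isOpen a).1.hasWeakDiv_smul)
    (t := fun a K F i => if i = a then trace (interior K) F ψ else fun _ => 0)
    (fun a K hK F hF i => 𝓣.hasTrace_smul_single hd hΩ hK hF (htψ K hK F hF) a i)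
    (w := compV q) (wh := fun a F => compV (qh F) a)
    (fun a K hK => (hq.1 K hK a).exists_contDiff) (fun a F hF => (hq.2 F hF a).exists_contDiff)
    (fun a K hK F hF hFb => by
      filter_upwards [𝓣.trace_ae_eq_zero hd hΩ hK hF hFb hψ.2 (htψ K hK F hF)] with x hx
      have : ∀ i, (if i = a then trace (interior K) F ψ else fun _ => 0) x = (0 : ℝ) := fun i => by
        split_ifs
        · exact hx
        · rfl
      simp [this])
  have e1 : 𝓣.volSum (fun K x => inner ℝ (S x) (strain (interior K) v x)) =
      𝓣.volSum (fun K x => ∑ a, ∑ i, weakPartial (interior K) i (compV v a) x * row (S x) a i) := by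
    refine 𝓣.volSum_congr fun K hK => Eventually.of_forall fun x => ?_
    exact inner_symPart _ _
  have e2 : 𝓣.volSum (fun K x => ψ x * weakDiv (interior K) q x) =
      𝓣.volSum (fun K x => ∑ a, ∑ i, weakPartial (interior K) i (compV q a) x *
        (ψ x • (EuclideanSpace.single a 1 : Vec d)) i) := by
    refine 𝓣.volSum_congr fun K hK => ?_
    have hw : ∀ i, HasWeakPartial (interior K) i (compV q i)
        (weakPartial (interior K) i (compV q i)) := by
      intro i
      obtain ⟨φ, hφ, he⟩ := (hq.1 K hK i).exists_contDiff
      exact (hasWeakPartial_of_eqOn isOpen_interior hφ he i).weakPartial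
    have hdv := (HasWeakDiv.of_partial hw).weakDiv_ae_eq isOpen_interior
    rw [𝓣.restrict_interior hK] at hdv
    filter_upwards [hdv] with x hx
    rw [hx, Finset.mul_sum]
    refine Finset.sum_congr rfl fun a _ => ?_
    rw [Finset.sum_eq_single_of_mem a (Finset.mem_univ a)]
    · simp [mul_comm]
    · intro j _ hj
      simp [hj]
  have e3 : 𝓣.bdrySum (fun K F x => inner ℝ (traceMn (interior K) F S (normal K F) x)
        (jump v (fun _ F => vh F) K F x)) =
      𝓣.bdrySum (fun K F x => ∑ a, (∑ i, normal K F i * trace (interior K) F (compM S (a, i)) x) *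
        (trace (interior K) F (compV v a) x - compV (vh F) a x)) := by
    refine 𝓣.bdrySum_congr fun K hK F hF => Eventually.of_forall fun x => ?_
    simp only [PiLp.inner_apply, traceMn, jump, traceV, compV, RCLike.inner_apply, conj_trivial,
      PiLp.sub_apply]
    refine Finset.sum_congr rfl fun a _ => ?_
    rw [mul_comm]
    congr 1
    exact Finset.sum_congr rfl fun i _ => mul_comm _ _
  have e4 : 𝓣.bdrySum (fun K F x => inner ℝ (trace (interior K) F ψ x • normal K F)
        (jump q (fun _ F => qh F) K F x)) =
      𝓣.bdrySum (fun K F x => ∑ a, (∑ i, normal K F i *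
        (if i = a then trace (interior K) F ψ else fun _ => 0) x) *
        (trace (interior K) F (compV q a) x - compV (qh F) a x)) := by
    refine 𝓣.bdrySum_congr fun K hK F hF => Eventually.of_forall fun x => ?_
    simp only [PiLp.inner_apply, jump, traceV, compV, RCLike.inner_apply, conj_trivial,
      PiLp.sub_apply, PiLp.smul_apply, smul_eq_mul]
    refine Finset.sum_congr rfl fun a _ => ?_
    rw [Finset.sum_eq_single_of_mem a (Finset.mem_univ a)]
    · simp only [if_true]
      ring
    · intro j _ hj
      simp [hj]
  have e5 : ∀ a, ∫ x in Ω, v x a * weakDivM Ω S x a =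
      ∫ x in Ω, compV v a x * weakDiv Ω (fun x => row (S x) a) x := fun a => rfl
  have e6 : ∀ a, ∫ x in Ω, q x a * weakGrad Ω ψ x a = ∫ x in Ω, compV q a x * weakPartial Ω a ψ x :=
    fun a => rfl
  simp_rw [e5, e6]
  rw [Bh, ← hS, e1, e2, e3, e4]
  linarith

end Mesh
end HDG

namespace HDG
variable {d : ℕ} {Ω : Set (Vec d)}

/-! ### Consistency of the semi-discrete equation -/

/-- Positive definite maps are invertible, so `ContinuousLinearMap.inverse` is not its junk value `0`. -/
theorem inverse_apply_apply {E : Type*} [NormedAddCommGroup E] [InnerProductSpace ℝ E]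
    [FiniteDimensional ℝ E] (L : E →L[ℝ] E) (hL : ∀ x, x ≠ 0 → 0 < inner ℝ (L x) x) (x : E) :
    L.inverse (L x) = x := by
  have hinj : Function.Injective (L : E →ₗ[ℝ] E) := by
    rw [← LinearMap.ker_eq_bot, LinearMap.ker_eq_bot']
    intro y hy
    by_contra hne
    have := hL y hne
    have h0 : L y = 0 := hy
    simp [h0] at this
  let e : E ≃L[ℝ] E := (LinearEquiv.ofInjectiveEndo (L : E →ₗ[ℝ] E) hinj).toContinuousLinearEquiv
  have he : L = (e : E →L[ℝ] E) := by
    ext y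
    rfl
  rw [he, ContinuousLinearMap.inverse_equiv]
  exact e.symm_apply_apply x

theorem Coeff.A_C (c : Coeff d) (τ : SymMat d) : c.A (c.C τ) = τ :=
  inverse_apply_apply c.C c.C_pos τ

theorem Coeff.G_DC (c : Coeff d) (τ : SymMat d) : c.G ((c.D - c.C) τ) = τ :=
  inverse_apply_apply (c.D - c.C) c.DC_pos τ

/-- The trace of the strain is the divergence. -/
theorem inner_idMat_strain (hΩ : IsOpen Ω) {u : Vec d → Vec d} (hu : ∀ i, MemH1 Ω (compV u i)) :
    ∀ᵐ x ∂volume.restrict Ω, inner ℝ (idMat d) (strain Ω u x) = weakDiv Ω u x := by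
  have h := (HasWeakDiv.of_partial fun i => ((hu i).weakPartial_spec hΩ i).1).weakDiv_ae_eq hΩ
  filter_upwards [h] with x hx
  rw [hx, strain, inner_symPart]
  refine Finset.sum_congr rfl fun i _ => ?_
  rw [Finset.sum_eq_single_of_mem i (Finset.mem_univ i)]
  · simp [idMat, symPart]
  · intro j _ hj
    simp [idMat, symPart, hj, hj.symm]

theorem integral_inner_eq_sum {v w : Vec d → Vec d} (hv : MemLp v 2 (volume.restrict Ω))
    (hw : MemLp w 2 (volume.restrict Ω)) :
    ∫ x in Ω, inner ℝ (v x) (w x) = ∑ a, ∫ x in Ω, w x a * v x a := by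
  rw [← integral_finsetSum]
  · refine integral_congr_ae (Eventually.of_forall fun x => ?_)
    simp [PiLp.inner_apply]
  · intro a _
    exact (memLp_compV hw a).integrable_mul (memLp_compV hv a)

/-- The semi-discrete equation at a fixed time, from the equations of the continuous problem. -/
theorem Mesh.hdgEquation (𝓣 : Mesh Ω) (hd : 0 < d) (hΩ : IsPolyDomain Ω) (c : Coeff d) (k : ℕ)
    {u' p' : Vec d → Vec d} {σE' σV' : Vec d → SymMat d} {ψ' : Vec d → ℝ}
    {u p : Vec d → Vec d} {σE σV : Vec d → SymMat d} {ψ : Vec d → ℝ} {f : Vec d → Vec d} {g : Vec d → ℝ}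
    (hu' : MemLp u' 2 (volume.restrict Ω)) (hp' : MemLp p' 2 (volume.restrict Ω))
    (hσV' : MemLp σV' 2 (volume.restrict Ω))
    (hψ' : MemLp ψ' 2 (volume.restrict Ω)) (h1 : MemX1 Ω u p) (h2 : MemX2 c Ω σE σV ψ)
    (hT : 𝓣.HasTraces (compM (c.total σE σV ψ)))
    (momentum : ∀ᵐ x ∂volume.restrict Ω, c.ρ • u' x - weakDivM Ω (c.total σE σV ψ) x = f x)
    (elastic : ∀ᵐ x ∂volume.restrict Ω, σE' x = c.C (strain Ω u x))
    (viscous : ∀ᵐ x ∂volume.restrict Ω, c.ω • σV' x + σV x = (c.D - c.C) (strain Ω u x))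
    (flux : ∀ᵐ x ∂volume.restrict Ω, c.χ • p' x + c.β • p x + weakGrad Ω ψ x = 0)
    (conservation : ∀ᵐ x ∂volume.restrict Ω,
      c.s * ψ' x + weakDiv Ω p x + c.α * weakDiv Ω u x = g x)
    {v q : Vec d → Vec d} {vh qh : Set (Vec d) → Vec d → Vec d} {τE τV : Vec d → SymMat d}
    {φ : Vec d → ℝ} (hv : 𝓣.MemUh k v vh) (hq : 𝓣.MemQh k q qh) (hτ : 𝓣.MemH2h k τE τV φ)
    {uh ph : Set (Vec d) → Set (Vec d) → Vec d → Vec d} (huh : 𝓣.IsElemTrace u uh)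
    (hph : 𝓣.IsElemTrace p ph) :
    𝓣.HDGEquation c k u' p' σE' σV' ψ' u uh p ph σE σV ψ f g v (fun _ F => vh F) q
      (fun _ F => qh F) τE τV φ := by
  have hu : ∀ i, MemH1 Ω (compV u i) := fun i => memHs_one_iff.1 (h1.1 i).1
  obtain ⟨hσE, hσV, hψ, hdiv⟩ := h2
  have hψ1 : MemH1 Ω ψ := memHs_one_iff.1 hψ.1
  have hp := h1.2
  have hv2 : MemLp v 2 (volume.restrict Ω) := memLp_of_compV fun i => hv.1.memLp hΩ i
  have hq2 : MemLp q 2 (volume.restrict Ω) := memLp_of_compV fun i => hq.1.memLp hΩ i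
  have hτE : MemLp τE 2 (volume.restrict Ω) := memLp_of_compM fun i => hτ.1.memLp hΩ i
  have hτV : MemLp τV 2 (volume.restrict Ω) := memLp_of_compM fun i => hτ.2.1.memLp hΩ i
  have hφ : MemLp φ 2 (volume.restrict Ω) := hτ.2.2.memLp hΩ ()
  have hS : MemLp (weakDivM Ω (c.total σE σV ψ)) 2 (volume.restrict Ω) :=
    memLp_of_compV fun i => ((hdiv i).weakDiv_spec hΩ.isOpen).2
  have hgrad : MemLp (weakGrad Ω ψ) 2 (volume.restrict Ω) :=
    memLp_of_compV fun i => (hψ1.weakPartial_spec hΩ.isOpen i).2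
  have hε : MemLp (strain Ω u) 2 (volume.restrict Ω) :=
    memLp_symPart fun i j => ((hu i).weakPartial_spec hΩ.isOpen j).2
  have hdp := (hp.weakDiv_spec hΩ.isOpen).2
  have hdiv0 := HasWeakDiv.of_partial fun i => ((hu i).weakPartial_spec hΩ.isOpen i).1
  have hdu : MemLp (weakDiv Ω u) 2 (volume.restrict Ω) :=
    (memLp_finsetSum Finset.univ fun i _ => ((hu i).weakPartial_spec hΩ.isOpen i).2).ae_eq
      (hdiv0.weakDiv_ae_eq hΩ.isOpen).symm
  -- the equations of the continuous problem, tested with the discrete functions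
  have E1 : (∫ x in Ω, inner ℝ (c.ρ • u' x) (v x)) -
      ∫ x in Ω, inner ℝ (weakDivM Ω (c.total σE σV ψ) x) (v x) = ∫ x in Ω, inner ℝ (f x) (v x) := by
    have i1 : Integrable (fun x => inner ℝ (c.ρ • u' x) (v x)) (volume.restrict Ω) :=
      integrable_inner_of_memLp (hu'.const_smul c.ρ) hv2
    have i2 : Integrable (fun x => inner ℝ (weakDivM Ω (c.total σE σV ψ) x) (v x))
      (volume.restrict Ω) := integrable_inner_of_memLp hS hv2
    rw [← integral_sub i1 i2]
    refine integral_congr_ae ?_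
    filter_upwards [momentum] with x hx
    rw [← hx, inner_sub_left]
  have E2 : (∫ x in Ω, inner ℝ (c.χ • p' x) (q x)) + (∫ x in Ω, inner ℝ (c.β • p x) (q x)) +
      ∫ x in Ω, inner ℝ (weakGrad Ω ψ x) (q x) = 0 := by
    have i1 : Integrable (fun x => inner ℝ (c.χ • p' x) (q x)) (volume.restrict Ω) :=
      integrable_inner_of_memLp (hp'.const_smul c.χ) hq2
    have i2 : Integrable (fun x => inner ℝ (c.β • p x) (q x)) (volume.restrict Ω) :=
      integrable_inner_of_memLp (hp.1.const_smul c.β) hq2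
    have i12 : Integrable (fun x => inner ℝ (c.χ • p' x) (q x) + inner ℝ (c.β • p x) (q x))
      (volume.restrict Ω) := i1.add i2
    rw [← integral_add i1 i2, ← integral_add i12 (integrable_inner_of_memLp hgrad hq2)]
    refine integral_eq_zero_of_ae ?_
    filter_upwards [flux] with x hx
    rw [← inner_add_left, ← inner_add_left, hx, inner_zero_left]
    rfl
  have E3 : ∫ x in Ω, inner ℝ (c.A (σE' x)) (τE x) = ∫ x in Ω, inner ℝ (strain Ω u x) (τE x) := by
    refine integral_congr_ae ?_
    filter_upwards [elastic] with x hx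
    rw [hx, c.A_C]
  have E4 : (∫ x in Ω, inner ℝ (c.ω • c.G (σV' x)) (c.ω • τV x)) +
      (∫ x in Ω, inner ℝ (c.G (σV x)) (c.ω • τV x)) =
      ∫ x in Ω, inner ℝ (strain Ω u x) (c.ω • τV x) := by
    have i1 : Integrable (fun x => inner ℝ (c.ω • c.G (σV' x)) (c.ω • τV x))
      (volume.restrict Ω) := integrable_inner_of_memLp
        ((c.G.comp_memLp' hσV').const_smul c.ω) (hτV.const_smul c.ω)
    have i2 : Integrable (fun x => inner ℝ (c.G (σV x)) (c.ω • τV x)) (volume.restrict Ω) :=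
      integrable_inner_of_memLp (c.G.comp_memLp' hσV) (hτV.const_smul c.ω)
    rw [← integral_add i1 i2]
    refine integral_congr_ae ?_
    filter_upwards [viscous] with x hx
    have : c.ω • c.G (σV' x) + c.G (σV x) = strain Ω u x := by
      rw [← map_smul, ← map_add, hx, c.G_DC]
    rw [← this, inner_add_left]
  have E5 : (∫ x in Ω, c.s * ψ' x * φ x) + (∫ x in Ω, φ x * weakDiv Ω p x) +
      c.α * (∫ x in Ω, φ x * weakDiv Ω u x) = ∫ x in Ω, g x * φ x := by
    have i1 : Integrable (fun x => c.s * ψ' x * φ x) (volume.restrict Ω) :=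
      (hψ'.const_mul c.s).integrable_mul hφ
    have i2 : Integrable (fun x => φ x * weakDiv Ω p x) (volume.restrict Ω) := hφ.integrable_mul hdp
    have i3 : Integrable (fun x => c.α * (φ x * weakDiv Ω u x)) (volume.restrict Ω) :=
      (hφ.integrable_mul hdu).const_mul c.α
    have i12 : Integrable (fun x => c.s * ψ' x * φ x + φ x * weakDiv Ω p x) (volume.restrict Ω) :=
      i1.add i2
    rw [← integral_const_mul, ← integral_add i1 i2, ← integral_add i12 i3]
    refine integral_congr_ae ?_
    filter_upwards [conservation] with x hx
    rw [← hx]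
    ring
  have E6 : ∫ x in Ω, inner ℝ (c.total τE τV φ x) (strain Ω u x) =
      (∫ x in Ω, inner ℝ (strain Ω u x) (τE x)) + (∫ x in Ω, inner ℝ (strain Ω u x) (c.ω • τV x)) -
      c.α * ∫ x in Ω, φ x * weakDiv Ω u x := by
    have i1 : Integrable (fun x => inner ℝ (strain Ω u x) (τE x)) (volume.restrict Ω) :=
      integrable_inner_of_memLp hε hτE
    have i2 : Integrable (fun x => inner ℝ (strain Ω u x) (c.ω • τV x)) (volume.restrict Ω) :=
      integrable_inner_of_memLp hε (hτV.const_smul c.ω)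
    have i3 : Integrable (fun x => c.α * (φ x * weakDiv Ω u x)) (volume.restrict Ω) :=
      (hφ.integrable_mul hdu).const_mul c.α
    have i12 : Integrable (fun x => inner ℝ (strain Ω u x) (τE x) +
      inner ℝ (strain Ω u x) (c.ω • τV x)) (volume.restrict Ω) := i1.add i2
    rw [← integral_const_mul, ← integral_add i1 i2, ← integral_sub i12 i3]
    refine integral_congr_ae ?_
    filter_upwards [inner_idMat_strain hΩ.isOpen hu] with x hx
    have h : inner ℝ ((c.α * φ x) • idMat d) (strain Ω u x) = c.α * φ x * weakDiv Ω u x := by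
      rw [← hx]
      exact real_inner_smul_left (F := SymMat d) _ _ _
    rw [Coeff.total, inner_sub_left, inner_add_left, h,
      real_inner_comm (strain Ω u x) (τE x), real_inner_comm (strain Ω u x) (c.ω • τV x)]
    ring
  rw [HDGEquation, 𝓣.Bh_of_memHdiv hd hΩ c hσE hσV hψ hdiv hT hv hq,
    𝓣.Bh_elemTrace hd hΩ c hu hp huh hph hτE hτV hφ, 𝓣.stab_eq_zero hd hΩ k huh,
    𝓣.stab_eq_zero hd hΩ k hph, innerH1, innerH2, ← integral_inner_eq_sum hS hv2,
    ← integral_inner_eq_sum hgrad hq2, E6]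
  linarith

end HDG

theorem proposition2 (d : ℕ) (hd : d = 2 ∨ d = 3)
    (Ω : Set (HDG.Vec d)) (hΩ : HDG.IsPolyDomain Ω) (T : ℝ) (hT : 0 < T) (c : HDG.Coeff d)
    (f : ℝ → HDG.L2 Ω (HDG.Vec d)) (g : ℝ → HDG.L2 Ω ℝ)
    (u p : ℝ → HDG.L2 Ω (HDG.Vec d)) (σE σV : ℝ → HDG.L2 Ω (HDG.SymMat d)) (ψ : ℝ → HDG.L2 Ω ℝ)
    (hsol : HDG.IsSolution c Ω T f g u p σE σV ψ)
    (𝓣 : HDG.Mesh Ω) (r : ℝ) (hr : 1 / 2 < r)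
    (hσ : 𝓣.ContBroken r T (fun t => HDG.compM (c.total (σE t) (σV t) (ψ t))))
    (hu : 𝓣.ContBroken r T (fun t => HDG.compV (u t)))
    (hp : 𝓣.ContBroken r T (fun t => HDG.compV (p t)))
    (k : ℕ) (t : ℝ) (ht : t ∈ Set.Icc 0 T) :
    -- all traces that enter the equation exist, and `(u, u|_{ℱ_h})` vanishes on boundary faces
    𝓣.HasTraces (HDG.compM (c.total (σE t) (σV t) (ψ t))) ∧
    𝓣.HasTraces (fun _ : Unit => (ψ t : HDG.Vec d → ℝ)) ∧
    (∃ uh, 𝓣.IsFaceTrace (u t) uh ∧ ∀ F ∈ HDG.boundaryFaces Ω 𝓣.elems,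
      ∀ᵐ x ∂(HDG.surf d).restrict F, uh F x = 0) ∧
    (∃ ph, 𝓣.IsElemTrace (p t) ph) ∧
    -- the exact solution satisfies the semi-discrete equation
    ∀ (v : HDG.Vec d → HDG.Vec d) (vh : Set (HDG.Vec d) → HDG.Vec d → HDG.Vec d)
      (q : HDG.Vec d → HDG.Vec d) (qh : Set (HDG.Vec d) → HDG.Vec d → HDG.Vec d)
      (τE τV : HDG.Vec d → HDG.SymMat d) (φ : HDG.Vec d → ℝ),
      𝓣.MemUh k v vh → 𝓣.MemQh k q qh → 𝓣.MemH2h k τE τV φ →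
      ∀ uh, 𝓣.IsFaceTrace (u t) uh →
        -- with the single-valued trace of `p` on the skeleton
        (∀ ph : Set (HDG.Vec d) → HDG.Vec d → HDG.Vec d, 𝓣.IsFaceTrace (p t) ph →
          𝓣.HDGEquation c k (HDG.dot T u t) (HDG.dot T p t) (HDG.dot T σE t) (HDG.dot T σV t)
            (HDG.dot T ψ t) (u t) (fun _ F => uh F) (p t) (fun _ F => ph F) (σE t) (σV t) (ψ t)
            (f t) (g t) v (fun _ F => vh F) q (fun _ F => qh F) τE τV φ) ∧
        -- and, whether or not it is single-valued, with the traces of `p` from the elements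
        (∀ ph, 𝓣.IsElemTrace (p t) ph →
          𝓣.HDGEquation c k (HDG.dot T u t) (HDG.dot T p t) (HDG.dot T σE t) (HDG.dot T σV t)
            (HDG.dot T ψ t) (u t) (fun _ F => uh F) (p t) ph (σE t) (σV t) (ψ t)
            (f t) (g t) v (fun _ F => vh F) q (fun _ F => qh F) τE τV φ) := by
  have hd0 : 0 < d := by rcases hd with rfl | rfl <;> norm_num
  have h1 := hsol.mem_X1 t ht
  have h2 := hsol.mem_X2 t ht
  have hTσ : 𝓣.HasTraces (HDG.compM (c.total (σE t) (σV t) (ψ t))) := fun K hK F hF i =>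
    𝓣.exists_hasTrace hd0 hΩ hK hF hr (hσ.1 t ht K hK i)
  have heq : ∀ (v : HDG.Vec d → HDG.Vec d) (vh : Set (HDG.Vec d) → HDG.Vec d → HDG.Vec d)
      (q : HDG.Vec d → HDG.Vec d) (qh : Set (HDG.Vec d) → HDG.Vec d → HDG.Vec d)
      (τE τV : HDG.Vec d → HDG.SymMat d) (φ : HDG.Vec d → ℝ),
      𝓣.MemUh k v vh → 𝓣.MemQh k q qh → 𝓣.MemH2h k τE τV φ →
      ∀ uh, 𝓣.IsFaceTrace (u t) uh → ∀ ph, 𝓣.IsElemTrace (p t) ph →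
        𝓣.HDGEquation c k (HDG.dot T u t) (HDG.dot T p t) (HDG.dot T σE t) (HDG.dot T σV t)
          (HDG.dot T ψ t) (u t) (fun _ F => uh F) (p t) ph (σE t) (σV t) (ψ t)
          (f t) (g t) v (fun _ F => vh F) q (fun _ F => qh F) τE τV φ :=
    fun v vh q qh τE τV φ hv hq hτ uh huh ph hph =>
      𝓣.hdgEquation hd0 hΩ c k (Lp.memLp _) (Lp.memLp _) (Lp.memLp _) (Lp.memLp _) h1 h2
        hTσ (hsol.momentum t ht) (hsol.elastic t ht) (hsol.viscous t ht) (hsol.flux t ht)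
        (hsol.conservation t ht) hv hq hτ huh hph
  refine ⟨hTσ, fun K hK F hF _ => ?_, 𝓣.exists_isFaceTrace hd0 hΩ h1.1, ?_, ?_⟩
  · exact 𝓣.exists_hasTrace_of_memH1 hd0 hΩ hK hF (HDG.memHs_one_iff.1 h2.2.2.1.1)
  · refine ⟨fun K F => HDG.traceV (interior K) F (p t), fun K hK F hF i => ?_⟩
    obtain ⟨g, hg⟩ := 𝓣.exists_hasTrace hd0 hΩ hK hF hr (hp.1 t ht K hK i)
    exact hg.trace
  · intro v vh q qh τE τV φ hv hq hτ uh huh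
    exact ⟨fun ph hph => heq v vh q qh τE τV φ hv hq hτ uh huh (fun _ F => ph F) hph,
      heq v vh q qh τE τV φ hv hq hτ uh huh⟩
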